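/- Let $A_k=\{a_1,\dots,a_k\}$ be a $k$-letter alphabet. A partial word of length $m$ over an alphabet $A$ is a map $u:\{0,\dots,m-1\}\to A\cup\{\diamond\}$; positions with value $\diamond$ are holes, and filling a hole means replacing $\diamond$ by a letter of $A$. A two-sided infinite word $w:\mathbb Z\to A$ meets $u$ if for some $i\in\mathbb Z$ we have $w(i+p)=u(p)$ for every $p$ with $u(p)\neq\diamond$. A set of partial words over $A$ is unavoidable if every two-sided infinite word over $A$ meets one of its elements, and avoidable otherwise. A set is $m$-uniform if all its elements have length $m$ and their positions $0$ and $m-1$ are not holes. Let $H^k_{m,n}$ be the minimum of the total number of holes (summed over all elements) of an unavoidable $m$-uniform set of exactly $n$ partial words over $A_k$. Let $X_0=\{a_i\diamond^{m-2}a_j\mid 1\le i\le j\le k\}$ be the basic $m$-uniform unavoidable set of size $k+\binom k2$ over $A_k$. Conjecture 1. For all integers $m\ge 3$ and $x_1,x_2,y_1,y_2\ge 0$ with $x_1+x_2=y_1+y_2=m-3$ and $y_1\le x_2\le x_1\le y_2$, the set $$\{a\diamond^{m-2}a,\ b\diamond^{m-2}b,\ c\diamond^{m-2}c,\ a\diamond^{x_1}b\diamond^{x_2}b,\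 b\diamond^{y_1}b\diamond^{y_2}c,\ a\diamond^{m-2}c\}$$ is avoidable over the three-letter alphabet $\{a,b,c\}$. Theorem. Assume Conjecture 1, and let $m\ge 4$ and $k\ge 2$. Then the largest number of holes (counted over all words) that can be filled in $X_0$ so that the resulting set is unavoidable is $m-1$ if $m$ is even and $m$ if $m$ is odd. Moreover, $$H^k_{m,k+\binom k2}=\begin{cases}\left(k+\binom k2\right)(m-2)-(m-1)&\text{if } m \text{ is even},\\ \left(k+\binom k2\right)(m-2)-m&\text{if } m\text{ is odd}.\end{cases}$$ -/

import Mathlib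

/-- Partial words of length `m` over `A`; the value `none` marks a hole. -/
abbrev PartialWord (A : Type) (m : ℕ) : Type := Fin m → Option A

namespace PartialWord

variable {A : Type} {m : ℕ}

/-- The number `h(u)` of holes of `u`. -/
def holes (u : PartialWord A m) : ℕ :=
  (Finset.univ.filter fun p => (u p).isNone).card

/-- `u ↑ v`: the two partial words agree wherever both are defined. -/
def Compatible (u v : PartialWord A m) : Prop :=
  ∀ p a b, u p = some a → v p = some b → a = b

/-- `v` arises from `u` by replacing some (possibly no) holes of `u` by letters. -/
def Fills (u v : PartialWord A m) : Prop :=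
  ∀ p a, u p = some a → v p = some a

/-- The number of holes of `u` that have become letters in `v`. -/
def numFilled (u v : PartialWord A m) : ℕ :=
  (Finset.univ.filter fun p => (u p).isNone ∧ (v p).isSome).card

/-- The factor of length `m` at position `i` of a two-sided infinite word,
as a (total) partial word. -/
def factor (m : ℕ) (w : ℤ → A) (i : ℤ) : PartialWord A m :=
  fun p => some (w (i + ((p : ℕ) : ℤ)))

/-- The two-sided infinite word `w` meets `u`: some factor of `w` is compatible with `u`. -/
def Meets (w : ℤ → A) (u : PartialWord A m) : Prop :=
  ∃ i : ℤ, Compatible (factor m w i) u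

/-- A set of partial words is unavoidable if every two-sided infinite word meets one of
its elements. -/
def Unavoidable (X : Set (PartialWord A m)) : Prop :=
  ∀ w : ℤ → A, ∃ u ∈ X, Meets w u

/-- A set of partial words is avoidable if some two-sided infinite word meets none of
its elements. -/
def Avoidable (X : Set (PartialWord A m)) : Prop :=
  ∃ w : ℤ → A, ∀ u ∈ X, ¬ Meets w u

/-- The convention on `m`-uniform sets: all the words have length `m` (here by typing), and
their positions `0` and `m - 1` are not holes. -/
def EndsDefined (X : Set (PartialWord A m)) : Prop :=
  ∀ u ∈ X, ∀ p : Fin m, ((p : ℕ) = 0 ∨ (p : ℕ) + 1 = m) → (u p).isSome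

/-- The partial word `a ⋄^(m-2) b` (for `2 ≤ m`). -/
def ends (m : ℕ) (a b : A) : PartialWord A m :=
  fun p => if (p : ℕ) = 0 then some a else if (p : ℕ) + 1 = m then some b else none

/-- The partial word `a ⋄^x c ⋄^y b` of length `m`, where `x + y + 3 = m`. -/
def endsMid (m x : ℕ) (a c b : A) : PartialWord A m :=
  fun p => if (p : ℕ) = x + 1 then some c else ends m a b p

end PartialWord

open PartialWord

/-- The basic `m`-uniform set `X₀ = {a_i ⋄^(m-2) a_j | i ≤ j}` over the alphabet
`A_k = {a_1, …, a_k}`, which is taken to be `Fin k`. -/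
def basicSet (k m : ℕ) : Finset (PartialWord (Fin k) m) :=
  (Finset.univ.filter fun q : Fin k × Fin k => q.1 ≤ q.2).image fun q => ends m q.1 q.2

/-- `X` arises from `X₀` by filling in exactly `n` holes altogether, where the word obtained
from `u ∈ X₀` is `f u`. -/
def FillsHoles {k m : ℕ} (X₀ X : Finset (PartialWord (Fin k) m)) (n : ℕ) : Prop :=
  ∃ f : PartialWord (Fin k) m → PartialWord (Fin k) m,
    (∀ u ∈ X₀, Fills u (f u)) ∧ X = X₀.image f ∧ n = ∑ u ∈ X₀, numFilled u (f u)

/-- The numbers of holes that can be filled in the set `X₀` over `A_k` so that the resulting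
set is unavoidable. -/
def fillableCounts {k m : ℕ} (X₀ : Finset (PartialWord (Fin k) m)) : Set ℕ :=
  {n | ∃ X : Finset (PartialWord (Fin k) m),
    FillsHoles X₀ X n ∧ Unavoidable (X : Set (PartialWord (Fin k) m))}

/-- The total numbers of holes of the unavoidable `m`-uniform sets of size `n` over `A_k`.
The number `H^k_{m,n}` is the least element of this set. -/
def holeCounts (k m n : ℕ) : Set ℕ :=
  {h | ∃ X : Finset (PartialWord (Fin k) m),
    EndsDefined (X : Set (PartialWord (Fin k) m)) ∧ X.card = n ∧
    Unavoidable (X : Set (PartialWord (Fin k) m)) ∧ ∑ u ∈ X, holes u = h}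

/-- The set `{a⋄^(m-2)a, b⋄^(m-2)b, c⋄^(m-2)c, a⋄^(x₁)b⋄^(x₂)b, b⋄^(y₁)b⋄^(y₂)c, a⋄^(m-2)c}`
over the three-letter alphabet `a = 0`, `b = 1`, `c = 2`, where
`x₁ + x₂ = y₁ + y₂ = m - 3`. -/
def conjectureSet (m x₁ y₁ : ℕ) : Set (PartialWord (Fin 3) m) :=
  {ends m 0 0, ends m 1 1, ends m 2 2, endsMid m x₁ 0 1 1, endsMid m y₁ 1 1 2, ends m 0 2}

/-- The conjecture: the sets above are avoidable whenever `y₁ ≤ x₂ ≤ x₁ ≤ y₂`. -/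
def AvoidabilityConjecture : Prop :=
  ∀ m x₁ x₂ y₁ y₂ : ℕ, x₁ + x₂ + 3 = m → y₁ + y₂ + 3 = m →
    y₁ ≤ x₂ → x₂ ≤ x₁ → x₁ ≤ y₂ → Avoidable (conjectureSet m x₁ y₁)

/-! Put n = m - 1. Whether a word meets a member of the set at p depends first on the letters at p
and p + n, then on the filled interior. Call a partial word with equal end letters diagonal.

The value is attained by filling `0⋄…⋄0` completely, together with the last hole (the last two if n
is even) of `0⋄…⋄1`. A word avoiding this set has only the letters 0 and 1, and its occurrences of 1
then propagate to the left until they contradict distance n (`exists_meeting_position`).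

For the converse, an unavoidable set with C(k+1,2) words and defined ends has exactly one word for
each unordered pair of end letters, since words of period 2n must be met. Words of period 3n show
that the resulting orientation of the pairs is acyclic, so it is a linear order. Up to renaming
letters every competitor is therefore a filled basic set, and both claims reduce to
`sum_card_filled_le`: at most n interior positions (n + 1 if n is even) are filled.

That bound comes from constructing avoiding words. Two off-diagonal words cannot both be filled
(`filled_unique`); the hard case is a chain a < b < c with the letter b filled in both, and the
conjecture is used only for part of it (`chainAvoidable`). A union bound gives 2^γ ≤ n for the
number γ of positions filled in an off-diagonal word. Words of period n see only diagonal words, so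
these correspond to colourings of ℤ/n without monochromatic translates: fewer than n positions are
filled in them, and at least log n are lost if two are filled. Finally one diagonal word is played
off against the off-diagonal one; parity enters in `exists_avoidsFilled`, through divisors of n in
ratio 2. -/

/-! ### Independent sets, sign sequences and progressions -/

/-- In a finite abelian group, a maximal set without two elements differing by a member of a
finite set of nonzero differences. -/
theorem exists_maximal_independent {G : Type*} [AddCommGroup G] [Fintype G] [DecidableEq G]
    (H : Finset G) (h0 : (0 : G) ∉ H) :
    ∃ I : Finset G, (∀ x ∈ I, ∀ h ∈ H, x + h ∉ I) ∧
      ∀ x, x ∈ I ∨ ∃ h ∈ H, x + h ∈ I ∨ x - h ∈ I := by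
  classical
  let F : Finset (Finset G) := Finset.univ.filter fun I => ∀ x ∈ I, ∀ h ∈ H, x + h ∉ I
  have hF : F.Nonempty := ⟨∅, by simp [F]⟩
  obtain ⟨I, hI, hmax⟩ := F.exists_max_image Finset.card hF
  have hI' : ∀ x ∈ I, ∀ h ∈ H, x + h ∉ I := by simpa [F] using hI
  refine ⟨I, hI', fun x => ?_⟩
  by_contra hcon
  push Not at hcon
  obtain ⟨hx, hcon⟩ := hcon
  have : insert x I ∈ F := by
    simp only [F, Finset.mem_filter, Finset.mem_univ, true_and]
    intro y hy h hh hmem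
    rw [Finset.mem_insert] at hy hmem
    rcases hy with rfl | hy
    · rcases hmem with hm | hm
      · exact h0 (by simpa [add_eq_left.mp hm] using hh)
      · exact (hcon h hh).1 hm
    · rcases hmem with hm | hm
      · apply (hcon h hh).2
        rw [← hm, add_sub_cancel_right]; exact hy
      · exact hI' y hy h hh hm
  have := hmax _ this
  rw [Finset.card_insert_of_notMem hx] at this
  omega

/-- Such a maximal set has at least `|G| / (2 |H| + 1)` elements. -/
theorem card_le_of_dominating {G : Type*} [AddCommGroup G] [Fintype G] [DecidableEq G]
    (H I : Finset G) (hdom : ∀ x, x ∈ I ∨ ∃ h ∈ H, x + h ∈ I ∨ x - h ∈ I) :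
    Fintype.card G ≤ (2 * H.card + 1) * I.card := by
  classical
  have hsub : (Finset.univ : Finset G) ⊆
      I ∪ (Finset.image₂ (fun h y => y - h) H I ∪ Finset.image₂ (fun h y => y + h) H I) := by
    intro x _
    simp only [Finset.mem_union, Finset.mem_image₂]
    rcases hdom x with hx | ⟨h, hh, hx | hx⟩
    · exact Or.inl hx
    · exact Or.inr (Or.inl ⟨h, hh, _, hx, by abel⟩)
    · exact Or.inr (Or.inr ⟨h, hh, _, hx, by abel⟩)
  have h1 := Finset.card_le_card hsub
  rw [Finset.card_univ] at h1
  have h2 := Finset.card_union_le I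
    (Finset.image₂ (fun h y => y - h) H I ∪ Finset.image₂ (fun h y => y + h) H I)
  have h3 := Finset.card_union_le (Finset.image₂ (fun h y => y - h) H I)
    (Finset.image₂ (fun h y => y + h) H I)
  have h4 := Finset.card_image₂_le (fun h y : G => y - h) H I
  have h5 := Finset.card_image₂_le (fun h y : G => y + h) H I
  nlinarith

/-- A periodic set of integers without two elements at distance `h`, meeting every
`{x, x + h, x + 2 h}`. -/
theorem exists_periodic_dominating (N : ℕ) (hN : 0 < N) (h : ℤ) (hh : ¬ (N : ℤ) ∣ h) :
    ∃ B : ℤ → Prop, (∀ x, B (x + N) ↔ B x) ∧ (∀ x, B x → ¬ B (x + h)) ∧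
      ∀ x, B x ∨ B (x + h) ∨ B (x + 2 * h) := by
  have : NeZero N := ⟨hN.ne'⟩
  have h0 : (h : ZMod N) ≠ 0 := by
    rwa [Ne, ZMod.intCast_zmod_eq_zero_iff_dvd]
  obtain ⟨I, hI, hdom⟩ := exists_maximal_independent ({(h : ZMod N)} : Finset (ZMod N))
    (by simpa using h0.symm)
  refine ⟨fun x => (x : ZMod N) ∈ I, fun x => by simp, fun x hx => ?_, fun x => ?_⟩
  · have := hI _ hx _ (Finset.mem_singleton_self _)
    simpa using this
  · have := hdom ((x + h : ℤ) : ZMod N)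
    simp only [Finset.mem_singleton, exists_eq_left] at this
    push_cast at this ⊢
    rw [add_sub_cancel_right] at this
    rcases this with h1 | h1 | h1
    · exact Or.inr (Or.inl h1)
    · right; right; convert h1 using 1; ring
    · exact Or.inl h1

/-- An antiperiodic sequence of signs that is prescribed along the paths of an acyclic
periodic functional graph. -/
theorem exists_antiperiodic_of_acyclic (n : ℕ) (step : ℤ → ℤ) (term e : ℤ → Bool)
    (hn : 0 < n) (hstep : ∀ i, step (i + n) = step i + n) (hterm : ∀ i, term (i + n) = term i)
    (he : ∀ i, e (i + n) = e i) (hreach : ∀ i, ∃ k, term (step^[k] i) = true) :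
    ∃ s : ℤ → Bool, (∀ i, s (i + n) = !s i) ∧
      ∀ i, term i = false → s (step i) = xor (s i) (e i) := by
  classical
  have hn' : (n : ℤ) ≠ 0 := by exact_mod_cast hn.ne'
  let base : ℤ → Bool := fun i => decide (Even (i / n))
  have hbase : ∀ i, base (i + n) = !base i := by
    intro i
    have : (i + n) / (n : ℤ) = i / n + 1 := by
      rw [Int.add_ediv_of_dvd_right (dvd_refl _), Int.ediv_self hn']
    simp only [base, this, Int.even_add_one]
    by_cases hc : Even (i / (n : ℤ)) <;> simp [hc]
  -- `S d i` carries the base sign back to i along a path of at most d steps. With d the distance to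
  -- a terminal position, consecutive signs satisfy the prescribed relation, and antiperiodicity is
  -- inherited from `base`.
  let S : ℕ → ℤ → Bool := fun d => Nat.rec (fun i => base i)
    (fun _ prev i => if term i then base i else xor (prev (step i)) (e i)) d
  have hS0 : ∀ i, S 0 i = base i := fun i => rfl
  have hS1 : ∀ d i, S (d + 1) i = if term i then base i else xor (S d (step i)) (e i) :=
    fun d i => rfl
  have hSn : ∀ d i, S d (i + n) = !S d i := by
    intro d
    induction d with
    | zero => intro i; rw [hS0, hS0, hbase]
    | succ d ih =>
      intro i
      rw [hS1, hS1, hterm, he, hstep, ih, hbase]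
      split <;> simp
  have hit : ∀ k i, step^[k] (i + n) = step^[k] i + n := by
    intro k
    induction k with
    | zero => intro i; rfl
    | succ k ih => intro i; rw [Function.iterate_succ_apply, Function.iterate_succ_apply, hstep, ih]
  let τ : ℤ → ℕ := fun i => Nat.find (hreach i)
  have hτn : ∀ i, τ (i + n) = τ i := by
    intro i
    simp only [τ]
    congr 1
    funext k
    rw [hit, hterm]
  have hτs : ∀ i, term i = false → τ i = τ (step i) + 1 := by
    intro i hi
    apply (Nat.find_eq_iff _).2
    constructor
    · rw [Function.iterate_succ_apply]
      exact Nat.find_spec (hreach (step i))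
    · intro k hk
      cases k with
      | zero => simp [hi]
      | succ k =>
        rw [Function.iterate_succ_apply]
        exact Nat.find_min (hreach (step i)) (by simpa [τ] using hk)
  refine ⟨fun i => S (τ i) i, fun i => ?_, fun i hi => ?_⟩
  · simp only [hτn, hSn]
  · simp only [hτs i hi, hS1, hi]
    simp

/-- A periodic two-colouring of the integers such that no progression of difference `f` avoids
a colour. -/
theorem exists_coloring_meeting_progressions (n f : ℕ) (hf : 0 < f) (hfn : f < n) (b : Bool)
    (i : ℤ) : ∃ k : ℕ, decide (2 * ((i + k * f) % (n : ℤ)) < n) = b := by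
  have hn : (0 : ℤ) < n := by omega
  set d := Nat.gcd f n with hd
  have hdpos : 0 < d := Nat.gcd_pos_of_pos_left _ hf
  have hdn : d ∣ n := Nat.gcd_dvd_right _ _
  -- d is a proper divisor of n because 0 < f < n. Hence each half of the residues modulo n contains
  -- a representative of every class modulo d: i % d in the lower half, i % d + (n - d) in the upper
  -- one.
  have h2d : 2 * d ≤ n := by
    obtain ⟨c, hc⟩ := hdn
    have hdf : d ≤ f := Nat.le_of_dvd hf (Nat.gcd_dvd_left _ _)
    have : 2 ≤ c := by
      by_contra hlt
      have : c ≤ 1 := by omega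
      have : d * c ≤ d * 1 := Nat.mul_le_mul_left _ this
      omega
    calc 2 * d = d * 2 := by ring
      _ ≤ d * c := Nat.mul_le_mul_left _ this
      _ = n := hc.symm
  -- every integer congruent to `i` modulo `d` is reached modulo `n`
  have key : ∀ r : ℤ, (d : ℤ) ∣ r - i → ∃ k : ℕ, (i + k * f) % (n : ℤ) = r % n := by
    intro r ⟨c, hc⟩
    have hb := Nat.gcd_eq_gcd_ab f n
    rw [← hd] at hb
    let K : ℤ := c * Nat.gcdA f n
    refine ⟨(K % n).toNat, ?_⟩
    rw [Int.toNat_of_nonneg (Int.emod_nonneg _ hn.ne')]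
    have h1 : K % n ≡ K [ZMOD n] := Int.mod_modEq _ _
    have h2 : i + K * f ≡ r [ZMOD n] := by
      apply Int.modEq_iff_dvd.2
      refine ⟨c * Nat.gcdB f n, ?_⟩
      have : r = i + d * c := by linarith
      rw [this, hb]
      simp only [K]
      ring
    exact ((h1.mul_right _).add_left _).trans h2
  have hid0 : 0 ≤ i % d := Int.emod_nonneg _ (by exact_mod_cast hdpos.ne')
  have hid1 : i % d < d := Int.emod_lt_of_pos _ (by exact_mod_cast hdpos)
  have hdvd : (d : ℤ) ∣ i % d - i := by
    refine ⟨-(i / d), ?_⟩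
    have := Int.emod_add_mul_ediv i d
    linarith
  cases b with
  | true =>
    obtain ⟨k, hk⟩ := key (i % d) hdvd
    refine ⟨k, ?_⟩
    rw [hk, Int.emod_eq_of_lt hid0 (by omega), decide_eq_true_iff]
    omega
  | false =>
    obtain ⟨k, hk⟩ := key (i % d + (n - d)) (by
      have h3 : (d : ℤ) ∣ (n : ℤ) - d := dvd_sub (by exact_mod_cast hdn) (dvd_refl _)
      rw [show i % (d : ℤ) + (n - d) - i = (i % d - i) + (n - d) by ring]
      exact dvd_add hdvd h3)
    refine ⟨k, ?_⟩
    rw [hk, Int.emod_eq_of_lt (by omega) (by omega), decide_eq_false_iff_not]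
    omega

/-! ### Odd multipliers modulo 2n -/

/-- With q = ⌈n/σ⌉ both q and q + 1 satisfy the two inequalities, and one of them is odd. -/
theorem exists_odd_between (n σ : ℕ) (hσ : 1 ≤ σ) (h : (2 * σ - 1) * (σ + 1) ≤ n * (σ - 1)) :
    ∃ k : ℕ, Odd k ∧ n ≤ k * σ ∧ k * (σ + 1) ≤ 2 * n := by
  obtain ⟨s, rfl⟩ : ∃ s, σ = s + 1 := ⟨σ - 1, by omega⟩
  set q := (n + s) / (s + 1) with hq
  have h1 : q * (s + 1) ≤ n + s := Nat.div_mul_le_self _ _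
  have h2 : n ≤ q * (s + 1) := by
    have := Nat.lt_div_mul_add (a := n + s) (b := s + 1) (by omega)
    rw [← hq] at this
    omega
  have h' : (2 * s + 1) * (s + 2) ≤ n * s := by
    have e1 : 2 * (s + 1) - 1 = 2 * s + 1 := by omega
    simpa [e1, Nat.add_sub_cancel] using h
  have h3 : (q + 1) * (s + 2) ≤ 2 * n := by
    by_contra hlt
    push Not at hlt
    nlinarith
  rcases Nat.even_or_odd q with hq | hq
  · exact ⟨q + 1, hq.add_one, by nlinarith, h3⟩
  · exact ⟨q, hq, h2, by nlinarith⟩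

/-- An odd multiple of `σ` lying in `[n, 2 n - k]` modulo `2 n`. -/
theorem exists_odd_mul_mem (n σ : ℕ) (h2 : 2 ≤ σ) (hσ : σ + 2 ≤ n) (hc : Nat.Coprime σ n)
    (hp : Odd (n + σ)) (hF : ¬ (n = 7 ∧ (σ = 2 ∨ σ = 4))) :
    ∃ (k : ℕ) (r : ℤ), Odd k ∧ (n : ℤ) ≤ k * σ - 2 * n * r ∧
      (k : ℤ) * σ - 2 * n * r ≤ 2 * n - k := by
  have h3 : ¬ (3 ∣ σ ∧ 3 ∣ n) := fun ⟨h, h'⟩ => by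
    have := Nat.dvd_gcd h h'
    rw [hc] at this
    norm_num at this
  obtain ⟨c, hcc⟩ := hp
  by_cases hA : n ≤ 3 * σ ∧ 3 * σ + 3 ≤ 2 * n
  · exact ⟨3, 0, by decide, by omega, by omega⟩
  by_cases hB : 3 * σ < n
  · have : (2 * σ - 1) * (σ + 1) ≤ n * (σ - 1) := by
      obtain ⟨s, rfl⟩ : ∃ s, σ = s + 2 := ⟨σ - 2, by omega⟩
      have e1 : 2 * (s + 2) - 1 = 2 * s + 3 := by omega
      have e2 : s + 2 - 1 = s + 1 := by omega
      rw [e1, e2]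
      rcases Nat.lt_or_ge s 3 with hs | hs
      · interval_cases s <;> omega
      · nlinarith
    obtain ⟨k, hk, hk1, hk2⟩ := exists_odd_between n σ (by omega) this
    refine ⟨k, 0, hk, by nlinarith, ?_⟩
    zify at hk2
    nlinarith
  -- Reflection: for k = 2j + 1 one has kσ - 2n(j - 1) = 3n - k(μ + 1), so the two inequalities for
  -- σ become those of `exists_odd_between` for μ. Its criterion fails only at n = 8, μ = 2, where k
  -- = 5 works.
  · obtain ⟨μ, hμ⟩ : ∃ μ, n = σ + (μ + 1) := ⟨n - σ - 1, by omega⟩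
    have hk : ∃ k : ℕ, Odd k ∧ n ≤ k * μ ∧ k * (μ + 1) ≤ 2 * n := by
      by_cases h8 : n = 8 ∧ μ = 2
      · exact ⟨5, by decide, by omega, by omega⟩
      apply exists_odd_between n μ (by omega)
      obtain ⟨s, rfl⟩ : ∃ s, μ = s + 2 := ⟨μ - 2, by omega⟩
      have e1 : 2 * (s + 2) - 1 = 2 * s + 3 := by omega
      have e2 : s + 2 - 1 = s + 1 := by omega
      rw [e1, e2]
      rcases Nat.lt_or_ge s 3 with hs | hs
      · interval_cases s <;> omega
      · have h7 : 3 * s + 7 ≤ n := by omega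
        have := Nat.mul_le_mul_right (s + 1) h7
        nlinarith
    obtain ⟨k, hk, hk1, hk2⟩ := hk
    obtain ⟨j, rfl⟩ := hk
    refine ⟨2 * j + 1, j - 1, ⟨j, rfl⟩, ?_, ?_⟩
    · zify at hk1 hk2 hμ
      push_cast
      have : (σ : ℤ) = n - (μ + 1) := by linarith
      rw [this]
      nlinarith
    · zify at hk1 hk2 hμ
      push_cast
      have : (σ : ℤ) = n - (μ + 1) := by linarith
      rw [this]
      nlinarith

theorem multiplier_of_residues {n f g : ℕ} (hn : 0 < n) {A x z : ℤ} (hA : Odd A)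
    (hx : A * f ≡ x [ZMOD 2 * n]) (hz : A * g ≡ z [ZMOD 2 * n]) (h0 : 0 ≤ x) (h1 : x ≤ z)
    (h2 : z ≤ n) :
    ∃ A : ℤ, Odd A ∧ (A * f) % (2 * n) ≤ (A * g) % (2 * n) ∧ (A * g) % (2 * n) ≤ n := by
  refine ⟨A, hA, ?_⟩
  have hn' : (0 : ℤ) < n := by exact_mod_cast hn
  rw [hx.eq, hz.eq, Int.emod_eq_of_lt h0 (by omega), Int.emod_eq_of_lt (by omega) (by omega)]
  exact ⟨h1, h2⟩

theorem exists_inverse_mod {a m : ℕ} (h : Nat.Coprime a m) : ∃ b : ℤ, b * a ≡ 1 [ZMOD m] := by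
  refine ⟨Nat.gcdA a m, ?_⟩
  have := Nat.gcd_eq_gcd_ab a m
  rw [h] at this
  apply Int.modEq_iff_dvd.2
  refine ⟨Nat.gcdB a m, ?_⟩
  push_cast at this
  linarith

theorem odd_of_mul_modEq_odd {A x : ℤ} {a n : ℕ} (h : A * a ≡ x [ZMOD 2 * n]) (hx : Odd x) :
    Odd A := by
  have h2 : A * a ≡ x [ZMOD 2] := h.of_mul_right _
  rw [Int.ModEq] at h2
  rw [Int.odd_iff] at hx
  have : Odd (A * a) := by rw [Int.odd_iff]; omega
  exact (Int.odd_mul.1 this).1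

/-- If the odd number `A₀` has the right residue against `e a`, it can be shifted so as to keep this
residue and to obtain any prescribed compatible residue against `b`. -/
theorem shift_multiplier {e n' a b : ℕ} (hb : Nat.Coprime b e) {A₀ x z : ℤ} (hA : Odd A₀)
    (hx : A₀ * (e * a : ℕ) ≡ x [ZMOD 2 * (e * n' : ℕ)]) (hz : A₀ * b ≡ z [ZMOD 2 * n']) :
    ∃ A : ℤ, Odd A ∧ A * (e * a : ℕ) ≡ x [ZMOD 2 * (e * n' : ℕ)] ∧
      A * b ≡ z [ZMOD 2 * (e * n' : ℕ)] := by
  obtain ⟨c, hc⟩ := exists_inverse_mod hb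
  obtain ⟨q, hq⟩ := Int.modEq_iff_dvd.1 hz
  obtain ⟨t, ht⟩ := Int.modEq_iff_dvd.1 hc
  -- A multiple of 2n' added to A₀ leaves the residue against e a unchanged modulo 2 e n'. Since c
  -- inverts b modulo e, this choice moves the residue against b by exactly 2n'q.
  refine ⟨A₀ + 2 * (n' * (c * q)), hA.add_even (even_two_mul _), ?_, ?_⟩
  · refine Int.ModEq.trans ?_ hx
    apply Int.modEq_iff_dvd.2
    exact ⟨-(c * q * a), by push_cast; ring⟩
  · apply Int.modEq_iff_dvd.2
    refine ⟨t * q, ?_⟩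
    push_cast
    have h1 : z = A₀ * b + 2 * n' * q := by linarith
    have h2 : (e : ℤ) * t = 1 - c * b := by linarith
    calc z - (A₀ + 2 * (n' * (c * q))) * b = 2 * n' * q * (1 - c * b) := by rw [h1]; ring
      _ = _ := by rw [← h2]; ring

/-- With e = gcd(f, n), A can be chosen so that A f ≡ e x with x ∈ {0, 1}. Since g is coprime to e,
`shift_multiplier` then places A g anywhere in its class modulo 2n', in particular in a window of
length 2n' starting at e x. This window ends by n = e n' except when e = 2 and x = 1; the one bad
residue n + 1 then gives g ≡ f/2 modulo n, that is f = 2g. -/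
theorem multiplier_of_gcd_left (n f g : ℕ) (hg : 0 < g) (hgf : g < f) (hfn : 2 * f < n)
    (h2 : f ≠ 2 * g) (hc : Nat.gcd (Nat.gcd f g) n = 1) (he : Nat.gcd f n ≠ 1) :
    ∃ A : ℤ, Odd A ∧ (A * f) % (2 * n) ≤ (A * g) % (2 * n) ∧ (A * g) % (2 * n) ≤ n := by
  set e := Nat.gcd f n with hedef
  have he0 : 0 < e := Nat.gcd_pos_of_pos_left _ (by omega)
  obtain ⟨f', hf'⟩ : e ∣ f := Nat.gcd_dvd_left _ _
  obtain ⟨n', hn'⟩ : e ∣ n := Nat.gcd_dvd_right _ _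
  have hcop : Nat.Coprime f' n' := by
    have h := Nat.gcd_mul_left e f' n'
    rw [← hf', ← hn', ← hedef] at h
    exact Nat.eq_of_mul_eq_mul_left he0 (by rw [mul_one]; exact h.symm)
  have hge : Nat.Coprime g e := by
    rw [Nat.Coprime, hedef, ← Nat.gcd_assoc, Nat.gcd_comm g f]; exact hc
  have he2 : 2 ≤ e := by omega
  have hn2 : 3 ≤ n' := by
    by_contra hlt
    have : n' ≤ 2 := by omega
    have hef : e ≤ f := Nat.le_of_dvd (by omega) (Nat.gcd_dvd_left _ _)
    nlinarith
  -- a first multiplier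
  obtain ⟨A₀, x, hA₀, hx, hxe⟩ : ∃ A₀ x : ℤ, Odd A₀ ∧ A₀ * f' ≡ x [ZMOD 2 * n'] ∧
      (x = 0 ∨ x = 1) := by
    rcases Nat.even_or_odd f' with hf | hf
    · have hno : Odd n' := by
        by_contra hne
        rw [Nat.not_odd_iff_even] at hne
        have := Nat.dvd_gcd hf.two_dvd hne.two_dvd
        rw [hcop] at this
        norm_num at this
      refine ⟨n', 0, by exact_mod_cast hno, ?_, Or.inl rfl⟩
      obtain ⟨c, hc⟩ := hf.two_dvd
      apply Int.modEq_iff_dvd.2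
      exact ⟨-c, by rw [hc]; push_cast; ring⟩
    · have : Nat.Coprime f' (2 * n') := Nat.Coprime.mul_right (by simpa using hf) hcop
      obtain ⟨b, hb⟩ := exists_inverse_mod this
      push_cast at hb
      exact ⟨b, 1, odd_of_mul_modEq_odd hb odd_one, hb, Or.inr rfl⟩
  have hx' : A₀ * (e * f' : ℕ) ≡ e * x [ZMOD 2 * (e * n' : ℕ)] := by
    have := hx.mul_left' (c := (e : ℤ))
    push_cast
    convert this using 1 <;> ring
  -- the residues available for `g`
  set z : ℤ := e * x + (A₀ * g - e * x) % (2 * n') with hzdef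
  have hn'0 : (0 : ℤ) < 2 * n' := by omega
  have hz0 : 0 ≤ (A₀ * g - e * x) % (2 * n' : ℤ) := Int.emod_nonneg _ hn'0.ne'
  have hz1 : (A₀ * g - e * x) % (2 * n' : ℤ) < 2 * n' := Int.emod_lt_of_pos _ hn'0
  have hz : A₀ * g ≡ z [ZMOD 2 * n'] := by
    have := (Int.mod_modEq (A₀ * g - e * x) (2 * n')).symm.add_left (e * x)
    rw [hzdef]
    convert this using 1; ring
  obtain ⟨A, hA, hAf, hAg⟩ := shift_multiplier hge hA₀ hx' hz
  rw [← hf', ← hn'] at hAf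
  rw [← hn'] at hAg
  have he0' : (2 : ℤ) ≤ e := by exact_mod_cast he2
  have hn2' : (3 : ℤ) ≤ n' := by exact_mod_cast hn2
  have hnn : (n : ℤ) = e * n' := by exact_mod_cast hn'
  have hex : 0 ≤ e * x := by rcases hxe with rfl | rfl <;> simp
  by_cases hzn : z ≤ n
  · exact multiplier_of_residues (by omega) hA hAf hAg hex (by omega) hzn
  exfalso
  push Not at hzn
  have hee : e = 2 := by
    by_contra hne
    have : (3 : ℤ) ≤ e := by have : 3 ≤ e := by omega
                             exact_mod_cast this
    rcases hxe with rfl | rfl <;> nlinarith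
  rw [hee] at hf' hn' hnn hzdef
  push_cast at hnn hzdef
  rcases hxe with rfl | rfl
  · omega
  have hg1 : A₀ * g ≡ 1 [ZMOD n] := by
    have hz3 : z = 2 * n' + 1 := by
      rw [hee] at hz1; push_cast at hz1; simp only [mul_one] at hz1 hzdef hzn; omega
    rw [hz3] at hz
    rw [hnn]
    refine hz.trans (Int.modEq_iff_dvd.2 ⟨-1, by ring⟩)
  have hf1 : A₀ * f' ≡ 1 [ZMOD n] := by rw [hnn]; exact hx
  have h3 : (g : ℤ) ≡ f' [ZMOD n] := by
    have e1 := hf1.mul_left (g : ℤ)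
    have e2 := hg1.mul_left (f' : ℤ)
    rw [mul_one] at e1 e2
    refine e1.symm.trans (Int.ModEq.trans ?_ e2)
    rw [show (g : ℤ) * (A₀ * f') = f' * (A₀ * g) by ring]
  have h4 := Int.ModEq.eq h3
  rw [Int.emod_eq_of_lt (by omega) (by omega), Int.emod_eq_of_lt (by omega) (by omega)] at h4
  omega

/-- Dual to the previous case, with e = gcd(g, n): A g is pinned at n or n - e, and A f is moved
into [0, 2n'). The one obstruction is e = 2 with residue n - 1 for f, which would give g ≡ 2f modulo
n, impossible for g < f < n/2. -/
theorem multiplier_of_gcd_right (n f g : ℕ) (hg : 0 < g) (hgf : g < f) (hfn : 2 * f < n)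
    (hc : Nat.gcd (Nat.gcd f g) n = 1) (he : Nat.gcd g n ≠ 1) :
    ∃ A : ℤ, Odd A ∧ (A * f) % (2 * n) ≤ (A * g) % (2 * n) ∧ (A * g) % (2 * n) ≤ n := by
  set e := Nat.gcd g n with hedef
  have he0 : 0 < e := Nat.gcd_pos_of_pos_left _ (by omega)
  obtain ⟨g', hg'⟩ : e ∣ g := Nat.gcd_dvd_left _ _
  obtain ⟨n', hn'⟩ : e ∣ n := Nat.gcd_dvd_right _ _
  have hcop : Nat.Coprime g' n' := by
    have h := Nat.gcd_mul_left e g' n'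
    rw [← hg', ← hn', ← hedef] at h
    exact Nat.eq_of_mul_eq_mul_left he0 (by rw [mul_one]; exact h.symm)
  have hfe : Nat.Coprime f e := by
    rw [Nat.Coprime, hedef, ← Nat.gcd_assoc]; exact hc
  have he2 : 2 ≤ e := by omega
  have hn2 : 3 ≤ n' := by
    by_contra hlt
    have : n' ≤ 2 := by omega
    have hef : e ≤ g := Nat.le_of_dvd (by omega) (Nat.gcd_dvd_left _ _)
    nlinarith
  obtain ⟨A₀, y, hA₀, hy, hye⟩ : ∃ A₀ y : ℤ, Odd A₀ ∧ A₀ * g' ≡ y [ZMOD 2 * n'] ∧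
      (y = n' ∨ y = n' - 1) := by
    rcases Nat.even_or_odd g' with hg2 | hg2
    · have hno : Odd n' := by
        by_contra hne
        rw [Nat.not_odd_iff_even] at hne
        have := Nat.dvd_gcd hg2.two_dvd hne.two_dvd
        rw [hcop] at this
        norm_num at this
      obtain ⟨c, rfl⟩ := hg2.two_dvd
      obtain ⟨b, hb⟩ := exists_inverse_mod (Nat.Coprime.coprime_mul_left hcop)
      obtain ⟨h, hh⟩ := hno
      obtain ⟨t, ht⟩ := Int.modEq_iff_dvd.1 hb
      have hcast : (n' : ℤ) = 2 * h + 1 := by exact_mod_cast hh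
      have hmod : ∀ u : ℤ, (b * h + n' * u) * (2 * c : ℕ) ≡ n' - 1 [ZMOD 2 * n'] := by
        intro u
        apply Int.modEq_iff_dvd.2
        refine ⟨h * t - u * c, ?_⟩
        push_cast
        have : (b : ℤ) * c = 1 - n' * t := by linarith
        calc (n' : ℤ) - 1 - (b * h + n' * u) * (2 * c)
            = n' - 1 - 2 * h * (b * c) - 2 * n' * u * c := by ring
          _ = _ := by rw [this, hcast]; ring
      rcases Int.even_or_odd (b * h) with hbh | hbh
      · refine ⟨b * h + n' * 1, n' - 1, ?_, hmod 1, Or.inr rfl⟩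
        rw [mul_one]
        exact hbh.add_odd ⟨h, hcast⟩
      · exact ⟨b * h + n' * 0, n' - 1, by simpa using hbh, hmod 0, Or.inr rfl⟩
    · rcases Nat.even_or_odd n' with hno | hno
      · have : Nat.Coprime g' (2 * n') := Nat.Coprime.mul_right (by simpa using hg2) hcop
        obtain ⟨b, hb⟩ := exists_inverse_mod this
        push_cast at hb
        have hb2 : b * (n' - 1) * g' ≡ n' - 1 [ZMOD 2 * n'] := by
          have := hb.mul_right ((n' : ℤ) - 1)
          rw [one_mul] at this
          rwa [mul_right_comm]
        refine ⟨b * (n' - 1), n' - 1, odd_of_mul_modEq_odd hb2 ?_, hb2, Or.inr rfl⟩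
        have : Even (n' : ℤ) := by exact_mod_cast hno
        exact this.sub_odd odd_one
      · refine ⟨n', n', by exact_mod_cast hno, ?_, Or.inl rfl⟩
        obtain ⟨c, hc⟩ := hg2
        apply Int.modEq_iff_dvd.2
        exact ⟨-c, by rw [hc]; push_cast; ring⟩
  have hy' : A₀ * (e * g' : ℕ) ≡ e * y [ZMOD 2 * (e * n' : ℕ)] := by
    have := hy.mul_left' (c := (e : ℤ))
    push_cast
    convert this using 1 <;> ring
  set x : ℤ := (A₀ * f) % (2 * n') with hxdef
  have hn'0 : (0 : ℤ) < 2 * n' := by omega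
  have hx0 : 0 ≤ x := Int.emod_nonneg _ hn'0.ne'
  have hx1 : x < 2 * n' := Int.emod_lt_of_pos _ hn'0
  have hx : A₀ * f ≡ x [ZMOD 2 * n'] := (Int.mod_modEq _ _).symm
  obtain ⟨A, hA, hAg, hAf⟩ := shift_multiplier hfe hA₀ hy' hx
  rw [← hg', ← hn'] at hAg
  rw [← hn'] at hAf
  have he0' : (2 : ℤ) ≤ e := by exact_mod_cast he2
  have hn2' : (3 : ℤ) ≤ n' := by exact_mod_cast hn2
  have hnn : (n : ℤ) = e * n' := by exact_mod_cast hn'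
  by_cases hxz : x ≤ e * y
  · refine multiplier_of_residues (by omega) hA hAf hAg hx0 hxz ?_
    rw [hnn]
    rcases hye with rfl | rfl <;> nlinarith
  exfalso
  push Not at hxz
  rcases hye with rfl | rfl
  · nlinarith
  have hee : e = 2 := by
    by_contra hne
    have : (3 : ℤ) ≤ e := by have : 3 ≤ e := by omega
                             exact_mod_cast this
    nlinarith
  rw [hee] at hg' hn' hnn hxz
  push_cast at hnn hxz
  have hx2 : x = n - 1 := by omega
  rw [hx2, ← hnn] at hx
  have hf1 : A₀ * f ≡ -1 [ZMOD n] :=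
    hx.trans (Int.modEq_iff_dvd.2 ⟨-1, by ring⟩)
  have hg1 : A₀ * g ≡ -2 [ZMOD n] := by
    have := hy.mul_left 2
    rw [← hnn] at this
    rw [hg']
    push_cast
    rw [show A₀ * (2 * g') = 2 * (A₀ * g') by ring]
    exact this.trans (Int.modEq_iff_dvd.2 ⟨-1, by rw [hnn]; ring⟩)
  have h3 : (g : ℤ) ≡ 2 * f [ZMOD n] := by
    have e1 := hf1.mul_left (-(g : ℤ))
    have e2 := hg1.mul_left (-(f : ℤ))
    rw [show -(g : ℤ) * -1 = g by ring] at e1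
    rw [show -(f : ℤ) * -2 = 2 * f by ring] at e2
    refine e1.symm.trans (Int.ModEq.trans ?_ e2)
    rw [show -(g : ℤ) * (A₀ * f) = -f * (A₀ * g) by ring]
  have h4 := Int.ModEq.eq h3
  rw [Int.emod_eq_of_lt (by omega) (by omega), Int.emod_eq_of_lt (by omega) (by omega)] at h4
  omega

theorem coprime_of_modEq_neg {n f g σ : ℕ} {B : ℤ} (hB : B * g ≡ 1 [ZMOD 2 * n])
    (hf : Nat.Coprime f n) (h : B * f ≡ -σ [ZMOD 2 * n]) : Nat.Coprime σ n := by
  rw [← Nat.isCoprime_iff_coprime] at hf ⊢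
  obtain ⟨t, ht⟩ := Int.modEq_iff_dvd.1 hB
  obtain ⟨u, hu⟩ := Int.modEq_iff_dvd.1 h
  have h1 : IsCoprime B (n : ℤ) := ⟨g, 2 * t, by linarith⟩
  have h2 : IsCoprime (-(B * f)) (n : ℤ) := (h1.mul_left hf).neg_left
  have h3 : (σ : ℤ) = -(B * f) + n * (-2 * u) := by linarith
  rw [h3]
  exact h2.add_mul_left_left _

/-- Here f and g are odd. Normalise B g ≡ 1 and B f ≡ τ. If τ < n, the multiplier (n - 1)B sends g
to n - 1 and f to n - τ. Otherwise set σ = 2n - τ: the multiplier (n - k)B with k odd sends g to n -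
k and f to kσ - n modulo 2n, so `exists_odd_mul_mem` supplies k. -/
theorem multiplier_of_coprime_even (n f g : ℕ) (hg : 0 < g) (hgf : g < f) (hfn : 2 * f < n)
    (hfc : Nat.Coprime f n) (hgc : Nat.Coprime g n) (hn : Even n) :
    ∃ A : ℤ, Odd A ∧ (A * f) % (2 * n) ≤ (A * g) % (2 * n) ∧ (A * g) % (2 * n) ≤ n := by
  have hodd : ∀ a : ℕ, Nat.Coprime a n → Odd a := fun a ha => by
    by_contra hne
    rw [Nat.not_odd_iff_even] at hne
    have := Nat.dvd_gcd hne.two_dvd hn.two_dvd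
    rw [ha] at this
    norm_num at this
  have hf2 := hodd f hfc
  have hg2 := hodd g hgc
  obtain ⟨B, hB⟩ := exists_inverse_mod (Nat.Coprime.mul_right (by simpa using hg2) hgc :
    Nat.Coprime g (2 * n))
  push_cast at hB
  have hBo : Odd B := odd_of_mul_modEq_odd hB odd_one
  have hn0 : (0 : ℤ) < 2 * n := by omega
  set τ : ℤ := (B * f) % (2 * n) with hτ
  have hτ0 : 0 ≤ τ := Int.emod_nonneg _ hn0.ne'
  have hτ1 : τ < 2 * n := Int.emod_lt_of_pos _ hn0
  have hτB : B * f ≡ τ [ZMOD 2 * n] := (Int.mod_modEq _ _).symm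
  have hτo : Odd τ := by
    have h1 : Odd (B * f) := hBo.mul (by exact_mod_cast hf2)
    have h2 : B * f ≡ τ [ZMOD 2] := hτB.of_mul_right _
    rw [Int.ModEq] at h2
    rw [Int.odd_iff] at h1 ⊢
    omega
  have hne : Even (n : ℤ) := by exact_mod_cast hn
  have hAg : ∀ K : ℤ, (K * B) * g ≡ K [ZMOD 2 * n] := fun K => by
    have := hB.mul_left K
    rwa [mul_one, ← mul_assoc] at this
  have hAf : ∀ K : ℤ, (K * B) * f ≡ K * τ [ZMOD 2 * n] := fun K => by
    have := hτB.mul_left K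
    rwa [← mul_assoc] at this
  obtain ⟨c, hc⟩ := hτo
  obtain ⟨a, ha⟩ := hne
  rcases lt_or_ge τ n with hlt | hge
  · refine multiplier_of_residues (A := (n - 1) * B) (x := n - τ) (z := n - 1) (by omega)
      (Odd.mul ⟨a - 1, by omega⟩ hBo) ((hAf _).trans ?_) (hAg _) (by omega) (by omega) (by omega)
    apply Int.modEq_iff_dvd.2
    exact ⟨-c, by rw [hc]; ring⟩
  · obtain ⟨σ, hσ⟩ : ∃ σ : ℕ, (σ : ℤ) = 2 * n - τ := ⟨(2 * n - τ).toNat, by omega⟩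
    have hτσ : τ = 2 * n - σ := by omega
    have hneg : τ ≡ -σ [ZMOD 2 * n] := Int.modEq_iff_dvd.2 ⟨-1, by rw [hτσ]; ring⟩
    have hfg : τ * g ≡ f [ZMOD 2 * n] := by
      have e1 := (hτB.mul_right (g : ℤ)).symm
      have e2 := hB.mul_right (f : ℤ)
      rw [one_mul] at e2
      refine e1.trans (Int.ModEq.trans ?_ e2)
      rw [show B * f * g = B * g * f by ring]
    have hσ1 : σ ≠ 1 := by
      intro h
      rw [hτσ, h] at hfg
      obtain ⟨t, ht⟩ := Int.modEq_iff_dvd.1 hfg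
      have ht' : ((f : ℤ) + g) = 2 * n * (t + g) := by push_cast at ht; linarith
      have h1 : 0 < t + g := by
        by_contra hle
        have := mul_nonpos_of_nonneg_of_nonpos hn0.le (not_lt.1 hle)
        omega
      nlinarith
    have hσn : σ + 1 ≠ n := by
      intro h
      rw [hτσ] at hfg
      obtain ⟨d, hd⟩ := hg2
      obtain ⟨t, ht⟩ := Int.modEq_iff_dvd.1 hfg
      have hσz : (σ : ℤ) = n - 1 := by omega
      have hdz : (g : ℤ) = 2 * d + 1 := by exact_mod_cast hd
      have ht' : ((f : ℤ) - g) = n * (2 * t + g) := by rw [hσz] at ht; linarith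
      have h1 : 0 < 2 * t + g := by
        by_contra hle
        have := mul_nonpos_of_nonneg_of_nonpos (by omega : (0 : ℤ) ≤ n) (not_lt.1 hle)
        omega
      nlinarith
    have hpar : Odd (n + σ) := by
      have : Odd ((n + σ : ℕ) : ℤ) := ⟨3 * a - c - 1, by push_cast; omega⟩
      exact_mod_cast this
    obtain ⟨k, r, ⟨j, hk⟩, hk1, hk2⟩ := exists_odd_mul_mem n σ (by
        obtain ⟨b, hb⟩ := hpar; omega) (by omega)
      (coprime_of_modEq_neg hB hfc (hτB.trans hneg)) hpar (by omega)
    have hkz : (k : ℤ) = 2 * j + 1 := by exact_mod_cast hk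
    refine multiplier_of_residues (A := (n - k) * B) (x := k * σ - 2 * n * r - n) (z := n - k)
      (by omega) (Odd.mul ⟨a - j - 1, by omega⟩ hBo) ((hAf _).trans ?_) (hAg _) (by omega)
      (by omega) (by omega)
    apply Int.modEq_iff_dvd.2
    refine ⟨k - r - c - 1, ?_⟩
    have hs : (σ : ℤ) = 2 * n - (2 * c + 1) := by omega
    rw [hs, hc]
    ring

/-- The multiplier n sends even numbers to 0 and odd ones to n, which settles all parities but f
odd, g even. There normalise B f ≡ 1 and B g ≡ ρ: take B if ρ < n, and otherwise kB, with k from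
`exists_odd_mul_mem` for σ = 2n - ρ. The exception of that lemma at n = 7 forces (f, g) = (3, 2). -/
theorem multiplier_of_coprime_odd (n f g : ℕ) (hg : 0 < g) (hgf : g < f) (hfn : 2 * f < n)
    (hF : ¬ (n = 7 ∧ f = 3 ∧ g = 2))
    (hfc : Nat.Coprime f n) (hgc : Nat.Coprime g n) (hn : Odd n) :
    ∃ A : ℤ, Odd A ∧ (A * f) % (2 * n) ≤ (A * g) % (2 * n) ∧ (A * g) % (2 * n) ≤ n := by
  have hno : Odd (n : ℤ) := by exact_mod_cast hn
  have hn0 : (0 : ℤ) < 2 * n := by omega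
  rcases Nat.even_or_odd f with ⟨a, hf⟩ | hf2
  · have h1 : (n : ℤ) * f ≡ 0 [ZMOD 2 * n] :=
      Int.modEq_iff_dvd.2 ⟨-a, by rw [hf]; push_cast; ring⟩
    rcases Nat.even_or_odd g with ⟨b, hg'⟩ | ⟨b, hg'⟩
    · exact multiplier_of_residues (by omega) hno h1
        (z := 0) (Int.modEq_iff_dvd.2 ⟨-b, by rw [hg']; push_cast; ring⟩) le_rfl le_rfl (by omega)
    · exact multiplier_of_residues (by omega) hno h1
        (z := n) (Int.modEq_iff_dvd.2 ⟨-b, by rw [hg']; push_cast; ring⟩) le_rfl (by omega) le_rfl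
  rcases Nat.even_or_odd g with hg2 | ⟨b, hg'⟩
  swap
  · obtain ⟨a, hf⟩ := hf2
    exact multiplier_of_residues (by omega) hno
      (x := n) (Int.modEq_iff_dvd.2 ⟨-a, by rw [hf]; push_cast; ring⟩)
      (z := n) (Int.modEq_iff_dvd.2 ⟨-b, by rw [hg']; push_cast; ring⟩) (by omega) le_rfl le_rfl
  obtain ⟨B, hB⟩ := exists_inverse_mod (Nat.Coprime.mul_right (by simpa using hf2) hfc :
    Nat.Coprime f (2 * n))
  push_cast at hB
  have hBo : Odd B := odd_of_mul_modEq_odd hB odd_one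
  set ρ : ℤ := (B * g) % (2 * n) with hρ
  have hρ0 : 0 ≤ ρ := Int.emod_nonneg _ hn0.ne'
  have hρ1 : ρ < 2 * n := Int.emod_lt_of_pos _ hn0
  have hρB : B * g ≡ ρ [ZMOD 2 * n] := (Int.mod_modEq _ _).symm
  have hρe : Even ρ := by
    have h1 : Even (B * g) := Even.mul_left (by exact_mod_cast hg2) _
    have h2 : B * g ≡ ρ [ZMOD 2] := hρB.of_mul_right _
    rw [Int.ModEq] at h2
    rw [Int.even_iff] at h1 ⊢
    omega
  have hfg : ρ * f ≡ g [ZMOD 2 * n] := by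
    have e1 := (hρB.mul_right (f : ℤ)).symm
    have e2 := hB.mul_right (g : ℤ)
    rw [one_mul] at e2
    refine e1.trans (Int.ModEq.trans ?_ e2)
    rw [show B * g * f = B * f * g by ring]
  obtain ⟨c, hc⟩ := hρe
  obtain ⟨a, ha⟩ := hno
  rcases lt_or_ge ρ n with hlt | hge
  · have hρne : ρ ≠ 0 := by
      intro h
      rw [h, zero_mul] at hfg
      have := hfg.eq
      rw [Int.zero_emod, Int.emod_eq_of_lt (by omega) (by omega)] at this
      omega
    exact multiplier_of_residues (by omega) hBo hB hρB (by omega) (by omega) (by omega)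
  · obtain ⟨σ, hσ⟩ : ∃ σ : ℕ, (σ : ℤ) = 2 * n - ρ := ⟨(2 * n - ρ).toNat, by omega⟩
    have hρσ : ρ = 2 * n - σ := by omega
    have hneg : ρ ≡ -σ [ZMOD 2 * n] := Int.modEq_iff_dvd.2 ⟨-1, by rw [hρσ]; ring⟩
    have hσn : σ + 1 ≠ n := by
      intro h
      rw [hρσ] at hfg
      obtain ⟨d, hd⟩ := hf2
      obtain ⟨t, ht⟩ := Int.modEq_iff_dvd.1 hfg
      have hσz : (σ : ℤ) = n - 1 := by omega
      have ht' : ((f : ℤ) - g) = n * (-(2 * t + f)) := by rw [hσz] at ht; linarith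
      have h1 : 0 < -(2 * t + f : ℤ) := by
        by_contra hle
        have := mul_nonpos_of_nonneg_of_nonpos (by omega : (0 : ℤ) ≤ n) (not_lt.1 hle)
        omega
      nlinarith
    have hpar : Odd (n + σ) := by
      have : Odd ((n + σ : ℕ) : ℤ) := ⟨3 * a + 1 - c, by push_cast; omega⟩
      exact_mod_cast this
    have h7 : ¬ (n = 7 ∧ (σ = 2 ∨ σ = 4)) := by
      rintro ⟨rfl, h⟩
      have hf3 : f = 3 := by
        obtain ⟨d, hd⟩ := hf2
        obtain ⟨u, hu⟩ := hg2
        omega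
      subst hf3
      have := hfg.eq
      rw [hρσ] at this
      rcases h with rfl | rfl <;> norm_num at this <;> omega
    obtain ⟨k, r, hk, hk1, hk2⟩ := exists_odd_mul_mem n σ (by
        obtain ⟨b, hb⟩ := hpar; omega) (by omega)
      (coprime_of_modEq_neg hB hgc (hρB.trans hneg)) hpar h7
    have hAf : (k * B) * f ≡ k [ZMOD 2 * n] := by
      have := hB.mul_left (k : ℤ)
      rwa [mul_one, ← mul_assoc] at this
    have hAg : (k * B) * g ≡ 2 * n - (k * σ - 2 * n * r) [ZMOD 2 * n] := by
      have := (hρB.trans hneg).mul_left (k : ℤ)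
      rw [← mul_assoc] at this
      exact this.trans (Int.modEq_iff_dvd.2 ⟨1 + r, by ring⟩)
    have hko : Odd (k : ℤ) := by exact_mod_cast hk
    exact multiplier_of_residues (by omega) (hko.mul hBo) hAf hAg (by omega) (by omega) (by omega)

/-- A character of `ℤ / 2 n` for which the points `0`, `g`, `n + f` do not lie in a half-circle. -/
theorem exists_odd_multiplier (n f g : ℕ) (hg : 0 < g) (hgf : g < f) (hfn : 2 * f < n)
    (h2 : f ≠ 2 * g) (hF : ∀ d, ¬ (n = 7 * d ∧ f = 3 * d ∧ g = 2 * d)) :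
    ∃ A : ℤ, Odd A ∧ (A * f) % (2 * n) ≤ (A * g) % (2 * n) ∧ (A * g) % (2 * n) ≤ n := by
  set D := Nat.gcd (Nat.gcd f g) n with hD
  have hD0 : 0 < D := Nat.gcd_pos_of_pos_left _ (Nat.gcd_pos_of_pos_right _ hg)
  obtain ⟨f', hf'⟩ : D ∣ f := (Nat.gcd_dvd_left _ _).trans (Nat.gcd_dvd_left _ _)
  obtain ⟨g', hg'⟩ : D ∣ g := (Nat.gcd_dvd_left _ _).trans (Nat.gcd_dvd_right _ _)
  obtain ⟨n', hn'⟩ : D ∣ n := Nat.gcd_dvd_right _ _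
  have hcop : Nat.gcd (Nat.gcd f' g') n' = 1 := by
    have h := Nat.gcd_mul_left D (Nat.gcd f' g') n'
    rw [← Nat.gcd_mul_left, ← hf', ← hg', ← hn', ← hD] at h
    exact Nat.eq_of_mul_eq_mul_left hD0 (by rw [mul_one]; exact h.symm)
  have h0 : 0 < g' := Nat.pos_of_ne_zero fun h => by rw [h] at hg'; omega
  have h1 : g' < f' := by rw [hf', hg'] at hgf; exact Nat.lt_of_mul_lt_mul_left hgf
  have h3 : 2 * f' < n' := by
    rw [hf', hn', mul_left_comm] at hfn; exact Nat.lt_of_mul_lt_mul_left hfn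
  have h4 : f' ≠ 2 * g' := fun h => h2 (by rw [hf', hg', h]; ring)
  have h5 : ¬ (n' = 7 ∧ f' = 3 ∧ g' = 2) := fun ⟨a, b, c⟩ =>
    hF D ⟨by rw [hn', a]; ring, by rw [hf', b]; ring, by rw [hg', c]; ring⟩
  have key : ∃ A : ℤ, Odd A ∧ (A * f') % (2 * n') ≤ (A * g') % (2 * n') ∧
      (A * g') % (2 * n') ≤ n' := by
    by_cases ha : Nat.gcd f' n' = 1
    · by_cases hb : Nat.gcd g' n' = 1
      · rcases Nat.even_or_odd n' with hn | hn
        · exact multiplier_of_coprime_even n' f' g' h0 h1 h3 ha hb hn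
        · exact multiplier_of_coprime_odd n' f' g' h0 h1 h3 h5 ha hb hn
      · exact multiplier_of_gcd_right n' f' g' h0 h1 h3 hcop hb
    · exact multiplier_of_gcd_left n' f' g' h0 h1 h3 h4 hcop ha
  obtain ⟨A, hA, hA1, hA2⟩ := key
  have hDz : (0 : ℤ) < D := by exact_mod_cast hD0
  refine ⟨A, hA, ?_⟩
  have e1 : (A * f) % (2 * n : ℤ) = D * ((A * f') % (2 * n')) := by
    rw [hf', hn']; push_cast
    rw [← Int.mul_emod_mul_of_pos _ _ hDz]; congr 1 <;> ring
  have e2 : (A * g) % (2 * n : ℤ) = D * ((A * g') % (2 * n')) := by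
    rw [hg', hn']; push_cast
    rw [← Int.mul_emod_mul_of_pos _ _ hDz]; congr 1 <;> ring
  have e3 : (n : ℤ) = D * n' := by exact_mod_cast hn'
  rw [e1, e2, e3]
  exact ⟨mul_le_mul_of_nonneg_left hA1 hDz.le, mul_le_mul_of_nonneg_left hA2 hDz.le⟩

/-! ### Three-letter words for a chain a < b < c -/

theorem emod_add_cases (p N : ℤ) (hN : 0 < N) (k : ℤ) (hk0 : 0 ≤ k) (hk : k ≤ N) :
    (p % N + k < N ∧ (p + k) % N = p % N + k) ∨ (N ≤ p % N + k ∧ (p + k) % N = p % N + k - N) := by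
  have h0 := Int.emod_nonneg p hN.ne'
  have h1 := Int.emod_lt_of_pos p hN
  have h2 : (p + k) % N = (p % N + k) % N := (Int.emod_add_emod p N k).symm
  rw [h2]
  rcases lt_or_ge (p % N + k) N with h | h
  · exact Or.inl ⟨h, Int.emod_eq_of_lt (by omega) h⟩
  · refine Or.inr ⟨h, ?_⟩
    rw [← Int.sub_emod_right, Int.emod_eq_of_lt (by omega) (by omega)]

/-- A word over `a = 0 < b = 1 < c = 2` that avoids `a⋄b` with a `b` at position `f`, `b⋄c` with a `b`
at position `g`, and the other words of the basic set of length `n + 1`. -/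
def ChainAvoidable (n f g : ℕ) : Prop :=
  ∃ w : ℤ → Fin 3, (∀ p, w p ≠ w (p + n)) ∧ (∀ p, ¬ (w p = 0 ∧ w (p + n) = 2)) ∧
    (∀ p, ¬ (w p = 0 ∧ w (p + n) = 1 ∧ w (p + f) = 1)) ∧
    ∀ p, ¬ (w p = 1 ∧ w (p + n) = 2 ∧ w (p + g) = 1)

/-- Reading the word backwards while exchanging a and c preserves the order relations at distance n
and exchanges the two filled words. -/
theorem ChainAvoidable.reverse {n f g : ℕ} (hf : f ≤ n) (hg : g ≤ n)
    (h : ChainAvoidable n f g) : ChainAvoidable n (n - g) (n - f) := by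
  obtain ⟨w, h1, h2, h3, h4⟩ := h
  have e0 : ∀ x : Fin 3, Fin.rev x = 0 ↔ x = 2 := by decide
  have e1 : ∀ x : Fin 3, Fin.rev x = 1 ↔ x = 1 := by decide
  have e2 : ∀ x : Fin 3, Fin.rev x = 2 ↔ x = 0 := by decide
  refine ⟨fun x => Fin.rev (w (-x)), fun p hp => ?_, fun p hp => ?_, fun p hp => ?_,
    fun p hp => ?_⟩
  · apply h1 (-(p + n))
    rw [show -(p + (n : ℤ)) + n = -p by ring]
    exact (Fin.rev_injective hp).symm
  · simp only [e0, e2] at hp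
    apply h2 (-(p + n))
    rw [show -(p + (n : ℤ)) + n = -p by ring]
    exact ⟨hp.2, hp.1⟩
  · simp only [e0, e1] at hp
    apply h4 (-(p + n))
    rw [show -(p + (n : ℤ)) + n = -p by ring]
    refine ⟨hp.2.1, hp.1, ?_⟩
    rw [show -(p + (n : ℤ)) + g = -(p + ((n - g : ℕ) : ℤ)) by rw [Nat.cast_sub hg]; ring]
    exact hp.2.2
  · simp only [e1, e2] at hp
    apply h3 (-(p + n))
    rw [show -(p + (n : ℤ)) + n = -p by ring]
    refine ⟨hp.2.1, hp.1, ?_⟩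
    rw [show -(p + (n : ℤ)) + f = -(p + ((n - f : ℕ) : ℤ)) by rw [Nat.cast_sub hf]; ring]
    exact hp.2.2

theorem meets_of_forall {A : Type} {m : ℕ} {w : ℤ → A} {u : PartialWord A m} (i : ℤ)
    (h : ∀ (p : Fin m) b, u p = some b → w (i + (p : ℕ)) = b) : Meets w u := by
  refine ⟨i, fun p a b ha hb => ?_⟩
  have := h p b hb
  simp only [factor, Option.some.injEq] at ha
  rw [← ha, this]

theorem meets_ends {A : Type} {n : ℕ} {w : ℤ → A} {i : ℤ} {a b : A} (ha : w i = a)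
    (hb : w (i + n) = b) : Meets w (ends (n + 1) a b) := by
  refine meets_of_forall i fun p c hc => ?_
  simp only [ends] at hc
  split_ifs at hc with h1 h2
  · rw [h1]; simpa [ha] using hc
  · have : (p : ℕ) = n := by omega
    rw [this]; simpa [hb] using hc

theorem meets_endsMid {A : Type} {n x : ℕ} {w : ℤ → A} {i : ℤ} {a b c : A} (ha : w i = a)
    (hb : w (i + n) = b) (hc : w (i + (x + 1 : ℕ)) = c) :
    Meets w (endsMid (n + 1) x a c b) := by
  refine meets_of_forall i fun p d hd => ?_
  simp only [endsMid, ends] at hd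
  split_ifs at hd with h0 h1 h2
  · rw [h0, hc]; simpa using hd
  · rw [h1]; simpa [ha] using hd
  · have : (p : ℕ) = n := by omega
    rw [this]; simpa [hb] using hd

theorem chainAvoidable_of_conjecture (hconj : AvoidabilityConjecture) {n f g : ℕ} (hf : 0 < f)
    (hfn : f < n) (hg : 0 < g) (hgn : g < n) (h1 : g + f ≤ n) (h2 : n ≤ 2 * f) :
    ChainAvoidable n f g := by
  obtain ⟨w, hw⟩ := hconj (n + 1) (f - 1) (n - f - 1) (g - 1) (n - g - 1) (by omega) (by omega)
    (by omega) (by omega) (by omega)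
  simp only [conjectureSet, Set.mem_insert_iff, Set.mem_singleton_iff, forall_eq_or_imp,
    forall_eq] at hw
  obtain ⟨h00, h11, h22, h011, h112, h02⟩ := hw
  refine ⟨w, fun p hp => ?_, fun p hp => h02 (meets_ends hp.1 hp.2), fun p hp => ?_,
    fun p hp => ?_⟩
  · have : w p = 0 ∨ w p = 1 ∨ w p = 2 := by generalize w p = x; revert x; decide
    rcases this with h | h | h
    · exact h00 (meets_ends h (hp ▸ h))
    · exact h11 (meets_ends h (hp ▸ h))
    · exact h22 (meets_ends h (hp ▸ h))
  · exact h011 (meets_endsMid hp.1 hp.2.1 (by rw [Nat.sub_add_cancel hf]; exact hp.2.2))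
  · exact h112 (meets_endsMid hp.1 hp.2.1 (by rw [Nat.sub_add_cancel hg]; exact hp.2.2))

/-- Period 2n - f, made of a block of b of length n - f, a block of a of length n - f and a block of
c of length f. A shift by n takes the block of a onto that of b, and that of c into that of a. Only
the last f letters b go to c, and a shift by g ≥ f takes these out of the block of b. -/
theorem chainAvoidable_blocks {n f g : ℕ} (hf : 0 < f) (hgn : g < n) (h1 : f ≤ g)
    (h2 : 2 * f ≤ n) : ChainAvoidable n f g := by
  set N : ℤ := 2 * n - f with hN
  have hN0 : 0 < N := by omega
  refine ⟨fun x => if x % N < n - f then 1 else if x % N < 2 * (n - f) then 0 else 2, ?_⟩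
  have key : ∀ p : ℤ, 0 ≤ p % N ∧ p % N < N := fun p =>
    ⟨Int.emod_nonneg p hN0.ne', Int.emod_lt_of_pos p hN0⟩
  refine ⟨fun p => ?_, fun p => ?_, fun p => ?_, fun p => ?_⟩
  · have := key p
    have hn := emod_add_cases p N hN0 n (by omega) (by omega)
    beta_reduce
    split_ifs <;> first | decide | (exfalso; omega)
  · have := key p
    have hn := emod_add_cases p N hN0 n (by omega) (by omega)
    beta_reduce
    split_ifs <;> first | decide | (exfalso; omega)
  · have := key p
    have hn := emod_add_cases p N hN0 n (by omega) (by omega)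
    have hf' := emod_add_cases p N hN0 f (by omega) (by omega)
    beta_reduce
    split_ifs <;> first | decide | (exfalso; omega)
  · have := key p
    have hn := emod_add_cases p N hN0 n (by omega) (by omega)
    have hg' := emod_add_cases p N hN0 g (by omega) (by omega)
    beta_reduce
    split_ifs <;> first | decide | (exfalso; omega)

theorem chainAvoidable_double {n f g : ℕ} (hg : 0 < g) (hfg : f = 2 * g) (hfn : 2 * f < n) :
    ChainAvoidable n f g := by
  classical
  -- The period n - g makes a shift by n the same as a shift by g. Along steps of g the word repeats
  -- the cycles b a and b c a.
  obtain ⟨B, hBN, hB1, hB2⟩ := exists_periodic_dominating (n - g) (by omega) g (by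
    intro h
    have := Int.le_of_dvd (by omega) h
    omega)
  have hn : ∀ p, B (p + n) ↔ B (p + g) := fun p => by
    rw [← hBN (p + g)]
    rw [show p + (g : ℤ) + ((n - g : ℕ) : ℤ) = p + n by push_cast [Nat.cast_sub (by omega : g ≤ n)]; ring]
  have hn2 : ∀ p, B (p + n + g) ↔ B (p + 2 * g) := fun p => by
    rw [show p + (n : ℤ) + g = (p + g) + n by ring, hn, show p + (g : ℤ) + g = p + 2 * g by ring]
  refine ⟨fun x => if B x then 1 else if B (x + g) then 0 else 2, ?_⟩
  refine ⟨fun p => ?_, fun p => ?_, fun p => ?_, fun p => ?_⟩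
  · have := hB1 p
    have := hB2 p
    simp only [hn, hn2]
    split_ifs <;> first | decide | (exfalso; tauto)
  · simp only [hn, hn2]
    split_ifs <;> decide
  · have := hB1 (p + g)
    have e : B (p + g + g) ↔ B (p + f) := by rw [hfg]; push_cast; ring_nf
    simp only [hn, hn2]
    split_ifs <;> first | decide | (exfalso; tauto)
  · have := hB1 p
    simp only [hn, hn2]
    split_ifs <;> decide

/-- The one family without a multiplier: in blocks of length d the word abcabc… works, since 7 ≡ 1,
3 ≡ 0 and 2 ≢ 0 modulo 3. -/
theorem chainAvoidable_seven {n f g d : ℕ} (hd : 0 < d) (hn : n = 7 * d) (hf : f = 3 * d)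
    (hg : g = 2 * d) : ChainAvoidable n f g := by
  have hd' : (d : ℤ) ≠ 0 := by exact_mod_cast hd.ne'
  have e : ∀ (p : ℤ) (c : ℕ), (p + (c * d : ℕ)) / (d : ℤ) = p / d + c := fun p c => by
    rw [Nat.cast_mul, Int.add_mul_ediv_right _ _ hd']
  refine ⟨fun x => if (x / (d : ℤ)) % 3 = 0 then 0 else if (x / (d : ℤ)) % 3 = 1 then 1 else 2, ?_⟩
  subst hn hf hg
  simp only [e]
  refine ⟨fun p => ?_, fun p => ?_, fun p => ?_, fun p => ?_⟩ <;>
  · generalize p / (d : ℤ) = q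
    push_cast
    split_ifs <;> first | decide | (exfalso; omega)

/-- The letter b is placed where A x lies in the first half-circle modulo 2n, so b and non-b
alternate at distance n as A is odd. A non-b is a or c according to whether its sign agrees with the
one f later, which excludes a b at f in an a-to-b pair. In a b-to-c pair the sign changes at f,
hence also at g by the hypothesis on residues, so the letter at g is not b. -/
theorem chainAvoidable_of_multiplier {n f g : ℕ} (hn : 0 < n) {A : ℤ} (hA : Odd A)
    (h1 : (A * f) % (2 * n) ≤ (A * g) % (2 * n)) (h2 : (A * g) % (2 * n) ≤ n) :
    ChainAvoidable n f g := by
  classical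
  set N : ℤ := 2 * n with hN
  have hN0 : 0 < N := by omega
  let s : ℤ → Prop := fun i => (A * i) % N < n
  have key : ∀ p : ℤ, 0 ≤ p % N ∧ p % N < N := fun p =>
    ⟨Int.emod_nonneg p hN0.ne', Int.emod_lt_of_pos p hN0⟩
  have hadd : ∀ (p : ℤ) (t : ℕ), (A * (p + t)) % N = (A * p + (A * t) % N) % N := fun p t => by
    rw [mul_add, Int.add_emod_emod]
  have hAn : (A * n) % N = n := by
    obtain ⟨c, hc⟩ := hA
    rw [show A * n = n + N * c by rw [hc, hN]; ring, Int.add_mul_emod_self_left,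
      Int.emod_eq_of_lt (by omega) (by omega)]
  have hsn : ∀ p, s (p + n) ↔ ¬ s p := fun p => by
    simp only [s]
    rw [hadd, hAn]
    have := emod_add_cases (A * p) N hN0 n (by omega) (by omega)
    have := key (A * p)
    omega
  have hsfg : ∀ p, (s (p + g) ↔ s p) → (s (p + f) ↔ s p) := fun p => by
    simp only [s]
    rw [hadd, hadd]
    have h3 := key (A * g)
    have h4 := key (A * f)
    have := emod_add_cases (A * p) N hN0 ((A * g) % N) (by omega) (by omega)
    have := emod_add_cases (A * p) N hN0 ((A * f) % N) (by omega) (by omega)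
    have := key (A * p)
    omega
  have hsnn : ∀ p (t : ℕ), s (p + n + t) ↔ ¬ s (p + t) := fun p t => by
    rw [show p + (n : ℤ) + t = (p + t) + n by ring, hsn]
  refine ⟨fun x => if s x then 1 else if (s (x + f) ↔ s x) then 0 else 2, ?_⟩
  refine ⟨fun p => ?_, fun p => ?_, fun p => ?_, fun p => ?_⟩
  · simp only [hsn, hsnn]
    split_ifs <;> decide
  · simp only [hsn, hsnn]
    split_ifs <;> decide
  · simp only [hsn, hsnn]
    split_ifs <;> first | decide | (exfalso; tauto)
  · have := hsfg p
    simp only [hsn, hsnn]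
    split_ifs <;> first | decide | (exfalso; tauto)

theorem chainAvoidable_of_lt {n f g : ℕ} (hg : 0 < g) (hgf : g < f) (hfn : 2 * f < n) :
    ChainAvoidable n f g := by
  by_cases h2 : f = 2 * g
  · exact chainAvoidable_double hg h2 hfn
  by_cases hF : ∃ d, n = 7 * d ∧ f = 3 * d ∧ g = 2 * d
  · obtain ⟨d, h3, h4, h5⟩ := hF
    exact chainAvoidable_seven (by omega) h3 h4 h5
  push Not at hF
  obtain ⟨A, hA, h3, h4⟩ := exists_odd_multiplier n f g hg hgf hfn h2
    (fun d h => hF d h.1 h.2.1 h.2.2)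
  exact chainAvoidable_of_multiplier (by omega) hA h3 h4

/-- Up to reversal, f ≤ g is handled by blocks, and g < f with both on the same side of n/2 by
multipliers. Only g ≤ n/2 ≤ f with g < f needs the conjecture. -/
theorem chainAvoidable (hconj : AvoidabilityConjecture) {n f g : ℕ} (hf : 0 < f)
    (hfn : f < n) (hg : 0 < g) (hgn : g < n) : ChainAvoidable n f g := by
  have hrev : ChainAvoidable n (n - g) (n - f) → ChainAvoidable n f g := fun h => by
    have := h.reverse (by omega) (by omega)
    rwa [Nat.sub_sub_self hfn.le, Nat.sub_sub_self hgn.le] at this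
  rcases Nat.lt_or_ge g f with hgf | hgf
  · rcases Nat.lt_or_ge (2 * f) n with h | h
    · exact chainAvoidable_of_lt hg hgf h
    rcases Nat.lt_or_ge n (2 * g) with h' | h'
    · exact hrev (chainAvoidable_of_lt (by omega) (by omega) (by omega))
    rcases Nat.le_total (g + f) n with h3 | h3
    · exact chainAvoidable_of_conjecture hconj hf hfn hg hgn h3 h
    · exact hrev (chainAvoidable_of_conjecture hconj (by omega) (by omega) (by omega) (by omega)
        (by omega) (by omega))
  · rcases Nat.le_total (2 * f) n with h | h
    · exact chainAvoidable_blocks hf hgn hgf h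
    · exact hrev (chainAvoidable_blocks (by omega) (by omega) (by omega) (by omega))

/-! ### Words for a non-adjacent pair and for two kinds of classes -/

/-- A word over `a = 0 < b = 1 < c = 2` that avoids `a⋄c` with one hole filled, and the other words
of the basic set. -/
theorem exists_word_nonadjacent {n g : ℕ} (hg : 0 < g) (hgn : g < n) (x : Fin 3) (hx : x ≠ 1) :
    ∃ w : ℤ → Fin 3, (∀ p, w p ≠ w (p + n)) ∧ (∀ p, ¬ (w p = 0 ∧ w (p + n) = 1)) ∧
      (∀ p, ¬ (w p = 1 ∧ w (p + n) = 2)) ∧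
      ∀ p, ¬ (w p = 0 ∧ w (p + n) = 2 ∧ w (p + g) = x) := by
  classical
  -- the case of a letter `a` in the middle
  have main : ∀ g : ℕ, 0 < g → g < n → ∃ w : ℤ → Fin 3, (∀ p, w p ≠ w (p + n)) ∧
      (∀ p, ¬ (w p = 0 ∧ w (p + n) = 1)) ∧ (∀ p, ¬ (w p = 1 ∧ w (p + n) = 2)) ∧
      ∀ p, ¬ (w p = 0 ∧ w (p + n) = 2 ∧ w (p + g) = 0) := by
    intro g hg hgn
    -- The period n + g makes g act as -n, so a letter a at p excludes one at p + g. Along steps of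
    -- n the word repeats the cycles a c and a c b.
    obtain ⟨B, hBN, hB1, hB2⟩ := exists_periodic_dominating (n + g) (by omega) n (by
      intro h
      have := Int.le_of_dvd (by omega) h
      omega)
    have hg' : ∀ p, B (p + g) → ¬ B p := fun p h1 h2 => by
      apply hB1 _ h1
      rw [← hBN] at h2
      rwa [show p + (g : ℤ) + n = p + ((n + g : ℕ) : ℤ) by push_cast; ring]
    refine ⟨fun x => if B x then 0 else if B (x - n) then 2 else 1, ?_⟩
    simp only [add_sub_cancel_right]
    refine ⟨fun p => ?_, fun p => ?_, fun p => ?_, fun p => ?_⟩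
    · have h1 := hB1 p
      have h2 := hB2 (p - n)
      rw [sub_add_cancel, show p - (n : ℤ) + 2 * n = p + n by ring] at h2
      split_ifs <;> first | decide | (exfalso; tauto)
    · split_ifs <;> decide
    · split_ifs <;> decide
    · have := hg' p
      split_ifs <;> first | decide | (exfalso; tauto)
  have hx' : x = 0 ∨ x = 2 := by revert x; decide
  rcases hx' with rfl | rfl
  · exact main g hg hgn
  · obtain ⟨w, h1, h2, h3, h4⟩ := main (n - g) (by omega) (by omega)
    have e0 : ∀ x : Fin 3, Fin.rev x = 0 ↔ x = 2 := by decide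
    have e1 : ∀ x : Fin 3, Fin.rev x = 1 ↔ x = 1 := by decide
    have e2 : ∀ x : Fin 3, Fin.rev x = 2 ↔ x = 0 := by decide
    refine ⟨fun x => Fin.rev (w (-x)), fun p hp => ?_, fun p hp => ?_, fun p hp => ?_,
      fun p hp => ?_⟩
    · apply h1 (-(p + n))
      rw [show -(p + (n : ℤ)) + n = -p by ring]
      exact (Fin.rev_injective hp).symm
    · simp only [e0, e1] at hp
      apply h3 (-(p + n))
      rw [show -(p + (n : ℤ)) + n = -p by ring]
      exact ⟨hp.2, hp.1⟩
    · simp only [e2, e1] at hp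
      apply h2 (-(p + n))
      rw [show -(p + (n : ℤ)) + n = -p by ring]
      exact ⟨hp.2, hp.1⟩
    · simp only [e0, e2] at hp
      apply h4 (-(p + n))
      rw [show -(p + (n : ℤ)) + n = -p by ring]
      refine ⟨hp.2.1, hp.1, ?_⟩
      rw [show -(p + (n : ℤ)) + ((n - g : ℕ) : ℤ) = -(p + g) by rw [Nat.cast_sub hgn.le]; ring]
      exact hp.2.2

/-- Two kinds of residue classes modulo `n`, and an antiperiodic choice of signs with prescribed
relations at distance `f` between positions of the first kind, and at distance `g` after every
position of the second kind. -/
theorem exists_types_and_signs {n f g : ℕ} (hf : 0 < f) (hfn : f < n) (hg : 0 < g) (hgn : g < n)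
    (e₁ e₂ : Bool) :
    ∃ T s : ℤ → Bool, (∀ p, T (p + n) = T p) ∧ (∀ p, s (p + n) = !s p) ∧
      (∀ p, T p = true → T (p + f) = true → s (p + f) = xor (s p) e₁) ∧
      ∀ p, T p = false → s (p + g) = xor (s p) e₂ := by
  -- First kind: residue in the lower half modulo n. Every progression of difference f or g meets
  -- both kinds, so a path moves by g until it reaches the first kind, then by f until it is about
  -- to leave it; there it stops, so no cycle arises.
  let T : ℤ → Bool := fun i => decide (2 * (i % (n : ℤ)) < n)
  have hT : ∀ p, T (p + n) = T p := fun p => by simp [T]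
  have hTf : ∀ p, T (p + n + f) = T (p + f) := fun p => by
    rw [add_right_comm, hT]
  obtain ⟨s, hs1, hs2⟩ := exists_antiperiodic_of_acyclic n
    (fun i => if T i then i + f else i + g) (fun i => T i && !T (i + f))
    (fun i => if T i then e₁ else e₂) (by omega)
    (fun i => by rw [hT]; split_ifs <;> ring) (fun i => by rw [hT, hTf]) (fun i => by rw [hT])
    (fun i => by
      set step : ℤ → ℤ := fun i => if T i then i + f else i + g with hstep
      -- a position of the first kind reaches a terminal one
      have first : ∀ j, T j = true → ∃ k, (T (step^[k] j) && !T (step^[k] j + f)) = true := by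
        intro j hj
        have hex : ∃ k : ℕ, T (j + k * f) = false :=
          exists_coloring_meeting_progressions n f hf hfn false j
        classical
        have hmin : ∀ k, k < Nat.find hex → T (j + k * f) = true := fun k hk => by
          have := Nat.find_min hex hk
          simpa using this
        have hpos : 0 < Nat.find hex := by
          rw [Nat.pos_iff_ne_zero]
          intro h
          have := Nat.find_spec hex
          rw [h] at this
          simp [hj] at this
        have hit : ∀ k, k < Nat.find hex → step^[k] j = j + k * f := by
          intro k
          induction k with
          | zero => intro _; simp
          | succ k ih =>
            intro hk
            rw [Function.iterate_succ_apply', ih (by omega), hstep]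
            simp only [hmin k (by omega), if_true]
            push_cast; ring
        refine ⟨Nat.find hex - 1, ?_⟩
        rw [hit _ (by omega), hmin _ (by omega)]
        have := Nat.find_spec hex
        rw [show j + ((Nat.find hex - 1 : ℕ) : ℤ) * f + f = j + (Nat.find hex : ℕ) * f by
          push_cast [Nat.cast_sub hpos]; ring, this]
        rfl
      have hex : ∃ k : ℕ, T (i + k * g) = true :=
        exists_coloring_meeting_progressions n g hg hgn true i
      classical
      have hmin : ∀ k, k < Nat.find hex → T (i + k * g) = false := fun k hk => by
        have := Nat.find_min hex hk
        simpa using this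
      have hit : ∀ k, k ≤ Nat.find hex → step^[k] i = i + k * g := by
        intro k
        induction k with
        | zero => intro _; simp
        | succ k ih =>
          intro hk
          rw [Function.iterate_succ_apply', ih (by omega), hstep]
          simp only [hmin k (by omega), Bool.false_eq_true, if_false]
          push_cast; ring
      obtain ⟨k, hk⟩ := first (step^[Nat.find hex] i) (by
        rw [hit _ le_rfl]; exact Nat.find_spec hex)
      refine ⟨k + Nat.find hex, ?_⟩
      rw [Function.iterate_add_apply]
      exact hk)
  refine ⟨T, s, hT, hs1, fun p h1 h2 => ?_, fun p h1 => ?_⟩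
  · simpa [h1] using hs2 p (by simp [h1, h2])
  · simpa [h1] using hs2 p (by simp [h1])

/-! ### A diagonal word against an off-diagonal word sharing a letter -/

/-- As qN < n, the positions p + 1, …, p + n - 1 contain q disjoint full periods. -/
theorem mul_card_le_card_window {N : ℕ} [NeZero N] (I : Finset (ZMod N)) (n q : ℕ)
    (hq : q * N < n) (p : ℤ) :
    q * I.card ≤ ((Finset.Ioo 0 n).filter fun t : ℕ => ((p + t : ℤ) : ZMod N) ∈ I).card := by
  classical
  have hN : 0 < N := Nat.pos_of_ne_zero (NeZero.ne N)
  have h1 : q * I.card = (Finset.range q ×ˢ I).card := by simp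
  rw [h1]
  refine Finset.card_le_card_of_injOn
    (fun x => 1 + (x.1 * N + (x.2 - ((p + 1 : ℤ) : ZMod N)).val)) ?_ ?_
  · rintro ⟨j, y⟩ hx
    simp only [Finset.coe_product, Set.mem_prod, Finset.mem_coe, Finset.mem_range] at hx
    have hv := ZMod.val_lt (y - ((p + 1 : ℤ) : ZMod N))
    have hj : (j + 1) * N ≤ q * N := Nat.mul_le_mul_right _ hx.1
    simp only [Finset.coe_filter, Finset.mem_Ioo, Set.mem_ofPred_eq]
    refine ⟨⟨by omega, by rw [add_mul] at hj; omega⟩, ?_⟩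
    have : ((p + ((1 + (j * N + (y - ((p + 1 : ℤ) : ZMod N)).val) : ℕ) : ℤ) : ℤ) : ZMod N) = y := by
      push_cast
      rw [ZMod.natCast_zmod_val]
      rw [ZMod.natCast_self]
      ring
    rw [this]
    exact hx.2
  · rintro ⟨j, y⟩ hx ⟨j', y'⟩ hx' heq
    have hv := ZMod.val_lt (y - ((p + 1 : ℤ) : ZMod N))
    have hv' := ZMod.val_lt (y' - ((p + 1 : ℤ) : ZMod N))
    simp only at heq
    have heq2 : (y - ((p + 1 : ℤ) : ZMod N)).val + N * j =
        (y' - ((p + 1 : ℤ) : ZMod N)).val + N * j' := by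
      rw [mul_comm N j, mul_comm N j']; omega
    have hm := congrArg (· % N) heq2
    simp only [Nat.add_mul_mod_self_left, Nat.mod_eq_of_lt hv, Nat.mod_eq_of_lt hv'] at hm
    have hy : y = y' := sub_left_injective (ZMod.val_injective N hm)
    have hj : j = j' := by
      rw [hm] at heq2
      exact Nat.eq_of_mul_eq_mul_left hN (Nat.add_left_cancel heq2)
    rw [hy, hj]

theorem exists_mem_of_card_window {n h : ℕ} {S : Finset ℕ}
    (hS : (Finset.Ioo 0 n \ S).card ≤ h) (P : ℕ → Prop) [DecidablePred P]
    (hP : h < ((Finset.Ioo 0 n).filter P).card) : ∃ t ∈ S, P t := by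
  by_contra hcon
  push Not at hcon
  have : (Finset.Ioo 0 n).filter P ⊆ Finset.Ioo 0 n \ S := by
    intro t ht
    rw [Finset.mem_filter] at ht
    exact Finset.mem_sdiff.2 ⟨ht.1, fun h => hcon t h ht.2⟩
  have := Finset.card_le_card this
  omega

theorem five_mul_le_two_pow (h : ℕ) : 5 * h ≤ 2 ^ (h + 2) := by
  induction h with
  | zero => norm_num
  | succ h ih =>
    rcases Nat.lt_or_ge h 2 with h2 | h2
    · interval_cases h <;> norm_num
    · rw [show h + 1 + 2 = (h + 2) + 1 by ring, pow_succ]; omega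

theorem six_mul_lt_two_pow (h : ℕ) : 6 * h < 2 ^ (h + 2) := by
  induction h with
  | zero => norm_num
  | succ h ih =>
    rcases Nat.lt_or_ge h 2 with h2 | h2
    · interval_cases h <;> norm_num
    · rw [show h + 1 + 2 = (h + 2) + 1 by ring, pow_succ]; omega

/-- `D` is the set of positions of the letter `b` in a word over `a < b` that avoids `b⋄b`, the word
`a⋄a` with the holes in `S` filled, and the word `a⋄b` with letters `a` at `Ea` and `b` at `Eb`. -/
def AvoidsFilled (n : ℕ) (S Ea Eb : Finset ℕ) (D : ℤ → Prop) : Prop :=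
  (∀ p, D p → ¬ D (p + n)) ∧ (∀ p, ¬ D p → ¬ D (p + n) → ∃ t ∈ S, D (p + t)) ∧
    ∀ p, ¬ D p → D (p + n) → (∃ t ∈ Ea, D (p + t)) ∨ ∃ t ∈ Eb, ¬ D (p + t)

/-- A set of period n + 1 independent for the differences 1 and n - e: modulo n + 1 a shift by n is
a shift by -1, and a b at p + n excludes one at p + e. If p and p + n are not in the set, all its
residue classes occur strictly between them; there are at least (n + 1)/5 > h of them, so one falls
in S. -/
theorem exists_avoidsFilled_of_mem_right {n h e : ℕ} {S Ea Eb : Finset ℕ}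
    (hS : (Finset.Ioo 0 n \ S).card ≤ h) (hn : 2 ^ (h + 2) ≤ n) (he : e ∈ Eb) (he0 : 0 < e)
    (hen : e < n) : ∃ D, AvoidsFilled n S Ea Eb D := by
  classical
  have hz : ∀ t : ℕ, 0 < t → t < n + 1 → (t : ZMod (n + 1)) ≠ 0 := fun t h0 h1 h2 => by
    rw [ZMod.natCast_eq_zero_iff] at h2
    exact absurd (Nat.le_of_dvd h0 h2) (by omega)
  obtain ⟨I, hI, hdom⟩ := exists_maximal_independent
    ({((1 : ℕ) : ZMod (n + 1)), ((n - e : ℕ) : ZMod (n + 1))} : Finset (ZMod (n + 1))) (by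
      rw [Finset.mem_insert, Finset.mem_singleton, not_or]
      exact ⟨(hz 1 (by omega) (by omega)).symm, (hz (n - e) (by omega) (by omega)).symm⟩)
  have hcard := card_le_of_dominating _ I hdom
  have hn1 : ((n : ZMod (n + 1)) + 1) = 0 := by
    have := ZMod.natCast_self (n + 1)
    push_cast at this
    exact this
  have hIcard : h < I.card := by
    rw [ZMod.card] at hcard
    have h2 := Finset.card_le_two (a := ((1 : ℕ) : ZMod (n + 1)))
      (b := ((n - e : ℕ) : ZMod (n + 1)))
    have h5 := five_mul_le_two_pow h
    by_contra hle
    have : (2 * ({((1 : ℕ) : ZMod (n + 1)), ((n - e : ℕ) : ZMod (n + 1))} :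
        Finset (ZMod (n + 1))).card + 1) * I.card ≤ 5 * h :=
      Nat.mul_le_mul (by omega) (by omega)
    omega
  refine ⟨fun x => (x : ZMod (n + 1)) ∈ I, fun p h1 h2 => ?_, fun p h1 h2 => ?_,
    fun p h1 h2 => Or.inr ⟨e, he, fun h3 => ?_⟩⟩
  · have := hI _ h2 ((1 : ℕ) : ZMod (n + 1)) (Finset.mem_insert_self _ _)
    apply this
    push_cast
    rw [add_assoc, hn1, add_zero]
    exact h1
  · apply exists_mem_of_card_window hS (fun t : ℕ => ((p + t : ℤ) : ZMod (n + 1)) ∈ I)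
    refine hIcard.trans_le ?_
    refine Finset.card_le_card_of_injOn (fun y => (y - (p : ZMod (n + 1))).val) ?_ ?_
    · intro y hy
      have hv := ZMod.val_lt (y - (p : ZMod (n + 1)))
      have hval : (((y - (p : ZMod (n + 1))).val : ℕ) : ZMod (n + 1)) = y - p :=
        ZMod.natCast_zmod_val _
      have hmem : ((p + ((y - (p : ZMod (n + 1))).val : ℕ) : ℤ) : ZMod (n + 1)) = y := by
        push_cast
        rw [hval]
        ring
      simp only [Finset.coe_filter, Finset.mem_Ioo, Set.mem_ofPred_eq]
      refine ⟨⟨?_, ?_⟩, by rw [hmem]; exact hy⟩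
      · rw [Nat.pos_iff_ne_zero]
        intro h0
        rw [h0] at hmem
        simp only [Nat.cast_zero, add_zero] at hmem
        exact h1 (show ((p : ℤ) : ZMod (n + 1)) ∈ I by rw [hmem]; exact hy)
      · by_contra hlt
        have h0 : (y - (p : ZMod (n + 1))).val = n := by omega
        rw [h0] at hmem
        exact h2 (show ((p + n : ℤ) : ZMod (n + 1)) ∈ I by rw [hmem]; exact hy)
    · intro y _ y' _ heq
      exact sub_left_injective (ZMod.val_injective _ heq)
  · have := hI _ h3 ((n - e : ℕ) : ZMod (n + 1)) (by simp)
    apply this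
    have : ((p + (n : ℕ) : ℤ) : ZMod (n + 1)) ∈ I := h2
    push_cast [Nat.cast_sub hen.le] at this ⊢
    convert this using 1
    ring

/-- With period n - t, a b at p + n repeats at p + t, where the filled word demands a. Independence
for the difference n is possible exactly because n - t does not divide n. -/
theorem exists_avoidsFilled_of_not_dvd {n h t : ℕ} {S Ea Eb : Finset ℕ}
    (hS : (Finset.Ioo 0 n \ S).card ≤ h) (hn : 2 ^ (h + 2) ≤ n) (ht : t ∈ Ea) (ht0 : 0 < t)
    (htn : t < n) (hd : ¬ (n - t) ∣ n) : ∃ D, AvoidsFilled n S Ea Eb D := by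
  classical
  obtain ⟨e, he⟩ : ∃ e, e = n - t := ⟨_, rfl⟩
  rw [← he] at hd
  have : NeZero e := ⟨by omega⟩
  obtain ⟨I, hI, hdom⟩ := exists_maximal_independent ({(n : ZMod e)} : Finset (ZMod e)) (by
    rw [Finset.mem_singleton, eq_comm, ZMod.natCast_eq_zero_iff]
    exact hd)
  have hcard := card_le_of_dominating _ I hdom
  rw [ZMod.card, Finset.card_singleton] at hcard
  refine ⟨fun x => (x : ZMod e) ∈ I, fun p h1 => ?_, fun p h1 h2 => ?_,
    fun p h1 h2 => Or.inl ⟨t, ht, ?_⟩⟩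
  · have := hI _ h1 _ (Finset.mem_singleton_self _)
    simpa using this
  · apply exists_mem_of_card_window hS (fun t : ℕ => ((p + t : ℤ) : ZMod e) ∈ I)
    have hq1 : (n - 1) / e * e ≤ n - 1 := Nat.div_mul_le_self _ _
    have hq2 := Nat.lt_div_mul_add (a := n - 1) (b := e) (by omega)
    set q := (n - 1) / e with hq
    refine lt_of_lt_of_le ?_ (mul_card_le_card_window I n q (by omega) p)
    by_contra hle
    push Not at hle
    have hq0 : 1 ≤ q := (Nat.le_div_iff_mul_le (by omega)).2 (by omega)
    have h6 := six_mul_lt_two_pow h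
    have h7 : q * e + e ≤ 3 * (q * I.card) + 3 * I.card := by nlinarith
    have h8 : I.card ≤ q * I.card := Nat.le_mul_of_pos_left _ hq0
    omega
  · have h3 : ((p + (n : ℕ) : ℤ) : ZMod e) ∈ I := h2
    have h4 : n = t + e := by omega
    rw [h4] at h3
    push_cast at h3 ⊢
    simpa using h3

/-- The letters b sit at 0, q', …, Kq' modulo L = Kq' + p', so every b is preceded by another at
distance q' or p', which contradicts an a at n - q' or at n - p'. Two of them at distance n would
force q' = 2p'. A period contains K + 1 = M > h of them, so S is met. -/
theorem exists_avoidsFilled_of_dvd {n h M p' q' : ℕ} {S Ea Eb : Finset ℕ}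
    (hS : (Finset.Ioo 0 n \ S).card ≤ h) (hM : h + 2 ≤ M) (hn : n = M * q') (hp : 0 < p')
    (hpq : p' < q') (h2 : q' ≠ 2 * p') (hp' : n - p' ∈ Ea) (hq' : n - q' ∈ Ea) :
    ∃ D, AvoidsFilled n S Ea Eb D := by
  classical
  obtain ⟨K, rfl⟩ : ∃ K, M = K + 1 := ⟨M - 1, by omega⟩
  set L := K * q' + p' with hL
  have hnL : n + p' = L + q' := by rw [hn, hL]; ring
  have : NeZero L := ⟨by omega⟩
  have hqn : q' ≤ n := by nlinarith
  have hLcast : (K : ZMod L) * q' + p' = 0 := by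
    have := ZMod.natCast_self L
    rw [hL] at this
    push_cast at this
    exact this
  let I : Finset (ZMod L) := (Finset.range (K + 1)).image fun j : ℕ => ((j * q' : ℕ) : ZMod L)
  have hIcard : I.card = K + 1 := by
    rw [Finset.card_image_of_injOn, Finset.card_range]
    intro i hi j hj hij
    simp only [Finset.coe_range, Set.mem_Iio] at hi hj
    have hb : ∀ i, i < K + 1 → i * q' < L := fun i hi => by
      have : i * q' ≤ K * q' := Nat.mul_le_mul_right _ (by omega)
      omega
    have h3 := congrArg ZMod.val hij
    simp only [ZMod.val_natCast, Nat.mod_eq_of_lt (hb i hi), Nat.mod_eq_of_lt (hb j hj)] at h3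
    exact Nat.eq_of_mul_eq_mul_right (by omega) h3
  have hmemI : ∀ y, y ∈ I ↔ ∃ j < K + 1, ((j * q' : ℕ) : ZMod L) = y := fun y => by simp [I]
  refine ⟨fun x => (x : ZMod L) ∈ I, fun p h3 h4 => ?_, fun p h3 h4 => ?_, fun p h3 h4 => Or.inl ?_⟩
  · obtain ⟨j, hj, hj'⟩ := (hmemI _).1 h3
    obtain ⟨i, hi, hi'⟩ := (hmemI _).1 h4
    have h5 : (((j : ℤ) * q' + n - i * q' : ℤ) : ZMod L) = 0 := by
      push_cast at hj' hi' ⊢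
      rw [hj', hi']; ring
    rw [ZMod.intCast_zmod_eq_zero_iff_dvd] at h5
    obtain ⟨c, hc⟩ := h5
    have hnz : (n : ℤ) = (K + 1) * q' := by exact_mod_cast hn
    have hLz : (L : ℤ) = K * q' + p' := by exact_mod_cast hL
    have hq0 : (0 : ℤ) < q' := by omega
    have hK : (1 : ℤ) ≤ K := by omega
    have hKq : (q' : ℤ) ≤ K * q' := by nlinarith
    -- the difference is `L` or `2 L` only
    have e1 : ((j : ℤ) - i + 1) * q' - p' = L * (c - 1) := by
      rw [mul_sub, mul_one, ← hc, hnz, hLz]; ring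
    have u1 : ((j : ℤ) - i + 1) * q' ≤ (K + 1) * q' :=
      mul_le_mul_of_nonneg_right (by omega) hq0.le
    have u2 : (1 - K : ℤ) * q' ≤ ((j : ℤ) - i + 1) * q' :=
      mul_le_mul_of_nonneg_right (by omega) hq0.le
    have hc1 : c - 1 < 2 := by
      by_contra hge
      have : (L : ℤ) * 2 ≤ L * (c - 1) := mul_le_mul_of_nonneg_left (by omega) (by omega)
      nlinarith
    have hc0 : -1 < c - 1 := by
      by_contra hge
      have : (L : ℤ) * (c - 1) ≤ L * (-1) := mul_le_mul_of_nonneg_left (by omega) (by omega)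
      nlinarith
    have hc2 : c - 1 = 0 ∨ c - 1 = 1 := by omega
    rcases hc2 with hc2 | hc2
    · rw [hc2, mul_zero] at e1
      have : 0 < (j : ℤ) - i + 1 := by
        by_contra hle
        have := mul_nonpos_of_nonpos_of_nonneg (not_lt.1 hle) hq0.le
        omega
      have : 1 * (q' : ℤ) ≤ ((j : ℤ) - i + 1) * q' := mul_le_mul_of_nonneg_right (by omega) hq0.le
      omega
    · rw [hc2, mul_one, hLz] at e1
      have e2 : ((j : ℤ) - i + 1 - K) * q' = 2 * p' := by linarith
      have l1 : 0 < (j : ℤ) - i + 1 - K := by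
        by_contra hle
        have := mul_nonpos_of_nonpos_of_nonneg (not_lt.1 hle) hq0.le
        omega
      have l2 : (j : ℤ) - i + 1 - K < 2 := by
        by_contra hge
        have : 2 * (q' : ℤ) ≤ ((j : ℤ) - i + 1 - K) * q' :=
          mul_le_mul_of_nonneg_right (by omega) hq0.le
        omega
      have l3 : (j : ℤ) - i + 1 - K = 1 := by omega
      rw [l3, one_mul] at e2
      omega
  · apply exists_mem_of_card_window hS (fun t : ℕ => ((p + t : ℤ) : ZMod L) ∈ I)
    have := mul_card_le_card_window I n 1 (by omega) p
    rw [one_mul, hIcard] at this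
    omega
  · obtain ⟨j, hj, hj'⟩ := (hmemI _).1 h4
    cases j with
    | zero =>
      refine ⟨n - p', hp', (hmemI _).2 ⟨K, by omega, ?_⟩⟩
      push_cast [Nat.cast_sub (by omega : p' ≤ n)] at hj' ⊢
      linear_combination hLcast + hj'
    | succ j =>
      refine ⟨n - q', hq', (hmemI _).2 ⟨j, by omega, ?_⟩⟩
      push_cast [Nat.cast_sub hqn] at hj' ⊢
      linear_combination hj'

/-- After the two easy cases only letters a are filled, at positions n - e with e a divisor of n. At
most h of these divisors have n/e < h + 2, so two survive if n is odd and three if n is even. Two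
divisors of an odd number are never in ratio 2, while among any three numbers some two are not;
hence the dependence on parity. -/
theorem exists_avoidsFilled {n h : ℕ} {S Ea Eb : Finset ℕ}
    (hS : (Finset.Ioo 0 n \ S).card ≤ h) (ha : Ea ⊆ Finset.Ioo 0 n) (hb : Eb ⊆ Finset.Ioo 0 n)
    (hcard : h + (if Odd n then 2 else 3) ≤ Ea.card + Eb.card)
    (hpow : 2 ^ (Ea.card + Eb.card) ≤ n) : ∃ D, AvoidsFilled n S Ea Eb D := by
  classical
  have hn : 2 ^ (h + 2) ≤ n := le_trans (Nat.pow_le_pow_right (by norm_num) (by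
    split_ifs at hcard <;> omega)) hpow
  by_cases hbe : Eb.Nonempty
  · obtain ⟨e, he⟩ := hbe
    have := Finset.mem_Ioo.1 (hb he)
    exact exists_avoidsFilled_of_mem_right hS hn he this.1 this.2
  rw [Finset.not_nonempty_iff_eq_empty] at hbe
  rw [hbe, Finset.card_empty, add_zero] at hcard
  by_cases hd : ∃ t ∈ Ea, ¬ (n - t) ∣ n
  · obtain ⟨t, ht, hd⟩ := hd
    have := Finset.mem_Ioo.1 (ha ht)
    exact exists_avoidsFilled_of_not_dvd hS hn ht this.1 this.2 hd
  push Not at hd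
  have hfin : ∀ p' q' : ℕ, p' < q' → q' ≠ 2 * p' → p' < n → q' < n → n - p' ∈ Ea → n - q' ∈ Ea →
      0 < p' → h + 2 ≤ n / q' → ∃ D, AvoidsFilled n S Ea Eb D := by
    intro p' q' h1 h2 h3 h4 h5 h6 h7 h8
    have hdq := hd _ h6
    rw [Nat.sub_sub_self h4.le] at hdq
    exact exists_avoidsFilled_of_dvd hS h8 (Nat.div_mul_cancel hdq).symm h7 h1 h2 h5 h6
  set E := (Ea.image fun t => n - t).filter fun e => h + 2 ≤ n / e with hE
  have hEmem : ∀ e ∈ E, 0 < e ∧ e < n ∧ n - e ∈ Ea ∧ e ∣ n ∧ h + 2 ≤ n / e := by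
    intro e he
    rw [hE, Finset.mem_filter, Finset.mem_image] at he
    obtain ⟨⟨t, ht, rfl⟩, h8⟩ := he
    have := Finset.mem_Ioo.1 (ha ht)
    refine ⟨by omega, by omega, by rwa [Nat.sub_sub_self this.2.le], hd t ht, h8⟩
  have hEcard : Ea.card ≤ h + E.card := by
    have h1 : (Ea.image fun t => n - t).card = Ea.card := by
      apply Finset.card_image_of_injOn
      intro t ht t' ht' heq
      have h1 := Finset.mem_Ioo.1 (ha ht)
      have h2 := Finset.mem_Ioo.1 (ha ht')
      simp only at heq
      omega
    rw [← h1, ← Finset.card_filter_add_card_filter_not (s := Ea.image fun t => n - t)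
      (fun e => h + 2 ≤ n / e), add_comm]
    apply Nat.add_le_add_right
    have h3 : h = (Finset.Ico 2 (h + 2)).card := by simp
    conv_rhs => rw [h3]
    have hmem : ∀ e ∈ (Ea.image fun t => n - t).filter (fun e => ¬ h + 2 ≤ n / e),
        0 < e ∧ e < n ∧ e ∣ n ∧ n / e < h + 2 := by
      intro e he
      rw [Finset.mem_filter, Finset.mem_image] at he
      obtain ⟨⟨t, ht, rfl⟩, h8⟩ := he
      have := Finset.mem_Ioo.1 (ha ht)
      exact ⟨by omega, by omega, hd t ht, by omega⟩
    refine Finset.card_le_card_of_injOn (fun e => n / e) ?_ ?_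
    · intro e he
      obtain ⟨h4, h5, h6, h7⟩ := hmem e he
      rw [Finset.coe_Ico, Set.mem_Ico]
      refine ⟨?_, h7⟩
      change 2 ≤ n / e
      by_contra hlt
      have h8 : n / e ≤ 1 := by omega
      have := Nat.div_mul_cancel h6
      nlinarith
    · intro e he e' he' heq
      obtain ⟨h4, h5, h6, h7⟩ := hmem e he
      obtain ⟨h4', h5', h6', h7'⟩ := hmem e' he'
      simp only at heq
      have h9 := Nat.div_mul_cancel h6
      have h9' := Nat.div_mul_cancel h6'
      rw [heq] at h9
      have h10 : 0 < n / e' := Nat.div_pos h5'.le h4'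
      exact Nat.eq_of_mul_eq_mul_left h10 (h9.trans h9'.symm)
  have hpair : ∀ p' ∈ E, ∀ q' ∈ E, p' < q' → q' ≠ 2 * p' → ∃ D, AvoidsFilled n S Ea Eb D := by
    intro p' hp q' hq h1 h2
    obtain ⟨a1, a2, a3, a4, a5⟩ := hEmem p' hp
    obtain ⟨b1, b2, b3, b4, b5⟩ := hEmem q' hq
    exact hfin p' q' h1 h2 a2 b2 a3 b3 a1 b5
  by_cases hodd : Odd n
  · rw [if_pos hodd] at hcard
    obtain ⟨a, ha', b, hb', hab⟩ := Finset.one_lt_card.1 (by omega : 1 < E.card)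
    have key : ∀ x ∈ E, ∀ y, x ≠ 2 * y := by
      rintro x hx y rfl
      have h1 := (hEmem _ hx).2.2.2.1
      have h2 : 2 ∣ n := (Dvd.intro _ rfl).trans h1
      obtain ⟨c, hc⟩ := hodd
      omega
    rcases Nat.lt_or_gt_of_ne hab with h1 | h1
    · exact hpair a ha' b hb' h1 (key b hb' a)
    · exact hpair b hb' a ha' h1 (key a ha' b)
  · rw [if_neg hodd] at hcard
    obtain ⟨a, b, c, ha', hb', hc', hab, hac, hbc⟩ :=
      Finset.two_lt_card_iff.1 (by omega : 2 < E.card)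
    have key : ∀ x ∈ E, ∀ y ∈ E, ∀ z ∈ E, x < y → y < z → ∃ D, AvoidsFilled n S Ea Eb D := by
      intro x hx y hy z hz hxy hyz
      have := (hEmem x hx).1
      by_cases h1 : y = 2 * x
      · by_cases h2 : z = 2 * y
        · exact hpair x hx z hz (by omega) (by omega)
        · exact hpair y hy z hz hyz h2
      · exact hpair x hx y hy hxy h1
    rcases Nat.lt_or_gt_of_ne hab with h1 | h1 <;> rcases Nat.lt_or_gt_of_ne hac with h2 | h2 <;>
      rcases Nat.lt_or_gt_of_ne hbc with h3 | h3
    · exact key a ha' b hb' c hc' h1 h3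
    · exact key a ha' c hc' b hb' h2 h3
    · omega
    · exact key c hc' a ha' b hb' h2 h1
    · exact key b hb' a ha' c hc' h1 h2
    · omega
    · exact key b hb' c hc' a ha' h3 h2
    · exact key c hc' b hb' a ha' h3 h1

/-! ### Colourings of a finite group without monochromatic translates -/

theorem sq_le_two_pow {g : ℕ} (hg : 2 ≤ g) : g * g + 2 ≤ 2 ^ g + g := by
  induction g, hg using Nat.le_induction with
  | base => norm_num
  | succ g hg ih =>
    rw [pow_succ]
    have : g + 1 ≤ 2 ^ g := Nat.lt_two_pow_self
    rcases Nat.lt_or_ge g 4 with h | h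
    · interval_cases g <;> norm_num
    · nlinarith

section

variable {G : Type*} [AddCommGroup G] [DecidableEq G]

/-- A colouring of a group without a translate of `S i` in colour `i`. -/
def AvoidsTranslates {ι : Type*} (S : ι → Finset G) (P : G → ι) : Prop :=
  ∀ p, ∃ t ∈ S (P p), P (p + t) ≠ P p

/-- The elements of a set `B` can be given colours other than `i₀` in such a way that no colour
occurs too often. -/
theorem exists_avoidsTranslates_of_meeting {ι : Type*} [Fintype ι] [DecidableEq ι]
    (S : ι → Finset G) (i₀ : ι) (B : Finset G)
    (hB : B.card ≤ ∑ i ∈ Finset.univ.erase i₀, ((S i).card - 1))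
    (hS : ∀ i, (S i).Nonempty) (hmeet : ∀ p, p ∉ B → ∃ t ∈ S i₀, p + t ∈ B) :
    ∃ P : G → ι, AvoidsTranslates S P := by
  -- Colour i ≠ i₀ receives |S i| - 1 slots and B is injected into the slots, so none of these
  -- colours is frequent enough to fill a translate of S i.
  let Q : Finset (Σ _ : ι, ℕ) :=
    (Finset.univ.erase i₀).sigma fun i => Finset.range ((S i).card - 1)
  have hQ : B.card ≤ Q.card := by simpa [Q, Finset.card_sigma] using hB
  obtain ⟨Q', hQ', hcard⟩ := Finset.exists_subset_card_eq hQ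
  let e : B ≃ Q' := Finset.equivOfCardEq hcard.symm
  let P : G → ι := fun p => if h : p ∈ B then (e ⟨p, h⟩).1.1 else i₀
  have hPB : ∀ p ∈ B, P p ≠ i₀ := by
    intro p hp
    simp only [P, dif_pos hp]
    have := hQ' (e ⟨p, hp⟩).2
    simp only [Q, Finset.mem_sigma, Finset.mem_erase] at this
    exact this.1.1
  have hPn : ∀ p, p ∉ B → P p = i₀ := fun p hp => by simp only [P, dif_neg hp]
  refine ⟨P, fun p => ?_⟩
  by_cases hp : p ∈ B
  · by_contra hcon
    push Not at hcon
    have hi : P p ≠ i₀ := hPB p hp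
    -- the colour of `p` occurs `|S i|` times
    have hmem : ∀ t ∈ S (P p), p + t ∈ B := fun t ht => by
      by_contra hn
      exact hi ((hcon t ht).symm.trans (hPn _ hn))
    have hinj : (S (P p)).card ≤ ((S (P p)).card - 1) := by
      conv_rhs => rw [← Finset.card_range ((S (P p)).card - 1)]
      refine Finset.card_le_card_of_injOn
        (fun t => if h : p + t ∈ B then (e ⟨p + t, h⟩).1.2 else 0) ?_ ?_
      · intro t ht
        have h1 := hmem t ht
        have h2 := hcon t ht
        simp only [dif_pos h1]
        simp only [P, dif_pos h1] at h2
        have := hQ' (e ⟨p + t, h1⟩).2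
        simp only [Q, Finset.mem_sigma] at this
        have := this.2
        rw [h2] at this
        exact this
      · intro t ht t' ht' heq
        have h1 := hmem t ht
        have h1' := hmem t' ht'
        have h2 := hcon t ht
        have h2' := hcon t' ht'
        simp only [dif_pos h1, dif_pos h1'] at heq
        have h3 : (e ⟨p + t, h1⟩).1.1 = (e ⟨p + t', h1'⟩).1.1 := by
          have a1 : P (p + t) = (e ⟨p + t, h1⟩).1.1 := by simp only [P, dif_pos h1]
          have a2 : P (p + t') = (e ⟨p + t', h1'⟩).1.1 := by simp only [P, dif_pos h1']
          rw [← a1, ← a2, h2, h2']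
        have h4 : (e ⟨p + t, h1⟩) = (e ⟨p + t', h1'⟩) := by
          apply Subtype.ext
          exact Sigma.ext h3 (heq_of_eq heq)
        have h5 := congrArg Subtype.val (e.injective h4)
        exact add_left_cancel h5
    have := Finset.card_pos.2 (hS (P p))
    omega
  · obtain ⟨t, ht, htB⟩ := hmeet p hp
    rw [← hPn p hp] at ht
    refine ⟨t, ht, ?_⟩
    rw [hPn p hp]
    exact hPB _ htB

variable [Fintype G]

theorem sum_card_shift_inter (C : Finset G) :
    ∑ x ∈ Finset.univ.erase (0 : G), (C.filter fun q => q + x ∈ C).card =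
      C.card * (C.card - 1) := by
  simp only [Finset.card_filter]
  rw [Finset.sum_comm]
  have : ∀ q ∈ C, (∑ x ∈ Finset.univ.erase (0 : G), if q + x ∈ C then 1 else 0) =
      C.card - 1 := by
    intro q hq
    rw [← Finset.card_filter, ← Finset.card_erase_of_mem hq]
    apply Finset.card_bij (fun x _ => q + x)
    · intro x hx
      simp only [Finset.mem_filter, Finset.mem_erase, Finset.mem_univ, and_true] at hx ⊢
      exact ⟨by simpa using hx.1, hx.2⟩
    · intro x _ y _ h
      exact add_left_cancel h
    · intro y hy
      rw [Finset.mem_erase] at hy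
      refine ⟨y - q, ?_, by abel⟩
      simp only [Finset.mem_filter, Finset.mem_erase, Finset.mem_univ, and_true]
      exact ⟨sub_ne_zero.2 hy.1, by rw [add_sub_cancel]; exact hy.2⟩
  rw [Finset.sum_congr rfl this, Finset.sum_const, smul_eq_mul]

/-- A small set that meets every translate of `S`. -/
theorem exists_meeting_translates (S : Finset G) {g : ℕ} (hg : 2 ≤ g)
    (hpow : 2 ^ g ≤ Fintype.card G) (h1 : g ≤ Sᶜ.card) (h2 : g ≤ S.card) :
    ∃ B : Finset G, B.card + g ≤ 2 + Sᶜ.card ∧ ∀ p, ∃ b ∈ B, b - p ∈ S := by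
  set C := Sᶜ with hC
  have hcard : S.card + C.card = Fintype.card G := Finset.card_add_card_compl S
  -- Averaging over the nonzero shifts gives x with |C ∩ (C - x)| ≤ |C| - g. The pair {0, x} then
  -- meets all translates but those with -p in this intersection, and each of these costs one more
  -- element.
  obtain ⟨x, hx⟩ : ∃ x, (C.filter fun q => q + x ∈ C).card + g ≤ C.card := by
    by_contra hcon
    push Not at hcon
    have hsum := sum_card_shift_inter C
    have hle : ∑ _x ∈ Finset.univ.erase (0 : G), (C.card - g + 1) ≤
        ∑ x ∈ Finset.univ.erase (0 : G), (C.filter fun q => q + x ∈ C).card :=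
      Finset.sum_le_sum fun x _ => by have := hcon x; omega
    rw [hsum, Finset.sum_const, smul_eq_mul, Finset.card_erase_of_mem (Finset.mem_univ _),
      Finset.card_univ, ← hcard] at hle
    have hsq := sq_le_two_pow hg
    obtain ⟨a, ha⟩ := Nat.exists_eq_add_of_le h1
    obtain ⟨b, hb⟩ := Nat.exists_eq_add_of_le h2
    obtain ⟨g', rfl⟩ := Nat.exists_eq_add_of_le hg
    rw [ha, hb] at hle
    rw [ha, hb] at hcard
    have e1 : 2 + g' + b + (2 + g' + a) - 1 = 3 + 2 * g' + a + b := by omega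
    have e2 : 2 + g' + a - (2 + g') + 1 = a + 1 := by omega
    have e3 : 2 + g' + a - 1 = 1 + g' + a := by omega
    rw [e1, e2, e3] at hle
    nlinarith
  have hSne : S.Nonempty := Finset.card_pos.1 (by omega)
  obtain ⟨s, hs⟩ := hSne
  refine ⟨{0, x} ∪ (C.filter fun q => q + x ∈ C).image fun q => s - q, ?_, fun p => ?_⟩
  · have e1 := Finset.card_union_le {0, x} ((C.filter fun q => q + x ∈ C).image fun q => s - q)
    have e2 := Finset.card_le_two (a := (0 : G)) (b := x)
    have e3 := Finset.card_image_le (s := C.filter fun q => q + x ∈ C) (f := fun q => s - q)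
    omega
  · by_cases h3 : -p ∈ C
    · by_cases h4 : -p + x ∈ C
      · refine ⟨s - -p, ?_, by simpa using hs⟩
        apply Finset.mem_union_right
        exact Finset.mem_image_of_mem _ (Finset.mem_filter.2 ⟨h3, h4⟩)
      · refine ⟨x, by simp, ?_⟩
        rw [hC, Finset.mem_compl, not_not] at h4
        rwa [sub_eq_neg_add]
    · refine ⟨0, by simp, ?_⟩
      rw [hC, Finset.mem_compl, not_not] at h3
      rwa [zero_sub]

/-- A pair of elements with difference other than `t` that meets every translate of a large set. -/
theorem exists_pair_meeting_translates (S : Finset G) (t : G) {g : ℕ} (hg : 2 ≤ g)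
    (hpow : 2 ^ g ≤ Fintype.card G) (h1 : Sᶜ.card < g) :
    ∃ x : G, x ≠ 0 ∧ x ≠ t ∧ x ≠ -t ∧ ∀ p, -p ∈ S ∨ x - p ∈ S := by
  set C := Sᶜ with hC
  -- It suffices that x is not a difference of two elements of C, nor 0 or ±t; as |C| < g this
  -- excludes fewer than 2^g elements.
  have hbad : (C.offDiag.image (fun y => y.2 - y.1) ∪ {0, t, -t}).card < Fintype.card G := by
    have e1 := Finset.card_union_le (C.offDiag.image (fun y => y.2 - y.1)) {0, t, -t}
    have e2 := Finset.card_image_le (s := C.offDiag) (f := fun y => y.2 - y.1)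
    have e3 := Finset.card_le_three (a := (0 : G)) (b := t) (c := -t)
    rw [Finset.offDiag_card] at e2
    have hsq := sq_le_two_pow hg
    obtain ⟨a, ha⟩ : ∃ a, g = C.card + 1 + a := ⟨g - C.card - 1, by omega⟩
    have : C.card * C.card - C.card + 3 < 2 ^ g := by
      have h3 : C.card ≤ C.card * C.card := Nat.le_mul_self _
      rw [ha] at hsq hg
      zify [h3] at hsq hg ⊢
      rw [ha]
      nlinarith
    omega
  obtain ⟨x, -, hx⟩ := Finset.exists_mem_notMem_of_card_lt_card (by
    rwa [← Finset.card_univ] at hbad)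
  simp only [Finset.mem_union, Finset.mem_image, Finset.mem_offDiag, Prod.exists,
    Finset.mem_insert, Finset.mem_singleton, not_or, not_exists, not_and] at hx
  obtain ⟨hx1, hx2, hx3, hx4⟩ := hx
  refine ⟨x, hx2, hx3, hx4, fun p => ?_⟩
  by_contra hcon
  rw [not_or] at hcon
  refine hx1 (-p) (x - p) ⟨?_, ?_, fun h => hx2 ?_⟩ (by abel)
  · rw [hC, Finset.mem_compl]; exact hcon.1
  · rw [hC, Finset.mem_compl]; exact hcon.2
  · rw [sub_eq_neg_add] at h
    exact (left_eq_add.1 h)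

theorem exists_avoidsTranslates_of_card_le {ι : Type*} [Fintype ι] [DecidableEq ι]
    (S : ι → Finset G) (hS : ∀ i, (S i).Nonempty)
    (h : Fintype.card G ≤ ∑ i, ((S i).card - 1)) : ∃ P : G → ι, AvoidsTranslates S P := by
  have hpos : 0 < ∑ i, ((S i).card - 1) := (Fintype.card_pos_iff.2 ⟨0⟩).trans_le h
  obtain ⟨i₀, -, hi₀⟩ := Finset.exists_ne_zero_of_sum_ne_zero hpos.ne'
  have hle : (S i₀).card ≤ (Finset.univ : Finset G).card := Finset.card_le_card (Finset.subset_univ _)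
  obtain ⟨I, -, hI⟩ := Finset.exists_subset_card_eq
    (show (S i₀).card - 1 ≤ (Finset.univ : Finset G).card by omega)
  have hc := Finset.card_add_card_compl I
  have hsum := Finset.add_sum_erase Finset.univ (fun i => (S i).card - 1) (Finset.mem_univ i₀)
  apply exists_avoidsTranslates_of_meeting S i₀ Iᶜ (by omega) hS
  intro p _
  by_contra hcon
  push Not at hcon
  have : (S i₀).card ≤ I.card := by
    refine Finset.card_le_card_of_injOn (fun t => p + t) ?_ ?_
    · intro t ht
      have := hcon t ht
      rw [Finset.mem_compl, not_not] at this
      exact this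
    · intro t _ t' _ heq
      exact add_left_cancel heq
  omega

/-- If some S i₀ has at least g elements, then either its complement is small and two points of
another colour suffice, or `exists_meeting_translates` gives a B of exactly affordable size. If all
S i are smaller than g, colour i is given to a set independent for one t ∈ S i; it has at least
|G|/3 elements, more than is needed. -/
theorem exists_avoidsTranslates {ι : Type*} [Fintype ι] [DecidableEq ι]
    (S : ι → Finset G) (hS : ∀ i, 0 ∈ S i) {g : ℕ} (hg : 2 ≤ g) (hpow : 2 ^ g ≤ Fintype.card G)
    (h : Fintype.card G + 1 ≤ ∑ i, ((S i).card - 1) + g) {i j : ι} (hij : i ≠ j)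
    (hi : 1 < (S i).card) (hj : 1 < (S j).card) : ∃ P : G → ι, AvoidsTranslates S P := by
  have hne : ∀ i, (S i).Nonempty := fun i => ⟨0, hS i⟩
  by_cases hbig : ∃ i₀, g ≤ (S i₀).card
  · obtain ⟨i₀, hi₀⟩ := hbig
    have hsum := Finset.add_sum_erase Finset.univ (fun i => (S i).card - 1) (Finset.mem_univ i₀)
    have hc := Finset.card_add_card_compl (S i₀)
    rcases Nat.lt_or_ge (S i₀)ᶜ.card g with hlt | hge
    · obtain ⟨j', hj', hj1⟩ : ∃ j', j' ≠ i₀ ∧ 1 < (S j').card := by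
        by_cases h1 : i = i₀
        · exact ⟨j, fun h2 => hij (h1.trans h2.symm), hj⟩
        · exact ⟨i, h1, hi⟩
      obtain ⟨t, ht, ht0⟩ := Finset.exists_mem_ne hj1 0
      obtain ⟨x, hx0, hxt, hxt', hx⟩ := exists_pair_meeting_translates (S i₀) t hg hpow hlt
      refine ⟨fun p => if p = 0 ∨ p = x then j' else i₀, fun p => ?_⟩
      by_cases hp : p = 0 ∨ p = x
      · simp only [if_pos hp]
        refine ⟨t, ht, ?_⟩
        rw [if_neg]
        · exact hj'.symm
        · rintro (h1 | h1) <;> rcases hp with rfl | rfl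
          · exact ht0 (by simpa using h1)
          · exact hxt' (eq_neg_of_add_eq_zero_left h1)
          · exact hxt (by simpa using h1.symm)
          · exact ht0 (by simpa using h1)
      · simp only [if_neg hp]
        rcases hx p with h1 | h1
        · exact ⟨_, h1, by simp [hj']⟩
        · exact ⟨_, h1, by simp [hj']⟩
    · obtain ⟨B, hB1, hB2⟩ := exists_meeting_translates (S i₀) hg hpow hge hi₀
      apply exists_avoidsTranslates_of_meeting S i₀ B (by omega) hne
      intro p _
      obtain ⟨b, hb, hbp⟩ := hB2 p
      exact ⟨b - p, hbp, by rw [add_sub_cancel]; exact hb⟩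
  · push Not at hbig
    obtain ⟨t, ht, ht0⟩ := Finset.exists_mem_ne hi 0
    obtain ⟨I, hI, hdom⟩ := exists_maximal_independent ({t} : Finset G) (by simpa using ht0.symm)
    have hIc := card_le_of_dominating _ I hdom
    rw [Finset.card_singleton] at hIc
    have hc := Finset.card_add_card_compl I
    have hsum := Finset.add_sum_erase Finset.univ (fun i => (S i).card - 1) (Finset.mem_univ i)
    have h1 := hbig i
    obtain ⟨g', rfl⟩ := Nat.exists_eq_add_of_le hg
    have h6 := six_mul_lt_two_pow g'
    rw [add_comm g' 2] at h6
    apply exists_avoidsTranslates_of_meeting S i Iᶜ (by omega) hne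
    intro p hp
    rw [Finset.mem_compl, not_not] at hp
    exact ⟨t, ht, Finset.mem_compl.2 (hI p hp t (Finset.mem_singleton_self _))⟩

end

/-! ### A union bound for antiperiodic words -/

/-- An antiperiodic sign word in which every negative sign is followed by a deviation from a
prescribed pattern. -/
theorem exists_antiperiodic_avoiding {n : ℕ} (E : Finset ℕ) (hE : E ⊆ Finset.Ioo 0 n)
    (val : ℕ → Bool) (h : n < 2 ^ E.card) (hn : 0 < n) :
    ∃ s : ℤ → Bool, (∀ p, s (p + n) = !s p) ∧ ∀ p, s p = false → ∃ t ∈ E, s (p + t) ≠ val t := by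
  classical
  have : NeZero n := ⟨hn.ne'⟩
  have hn0 : (n : ℤ) ≠ 0 := by exact_mod_cast hn.ne'
  let ext : (ZMod n → Bool) → ℤ → Bool := fun s p => xor (s p) (decide (Odd (p / n)))
  have hext : ∀ s p, ext s (p + n) = !ext s p := fun s p => by
    have h1 : (p + n) / (n : ℤ) = p / n + 1 := by
      rw [Int.add_ediv_of_dvd_right (dvd_refl _), Int.ediv_self hn0]
    simp only [ext, h1, Int.cast_add, Int.cast_natCast, ZMod.natCast_self, add_zero]
    by_cases ho : Odd (p / (n : ℤ))
    · have : ¬ Odd (p / (n : ℤ) + 1) := by rw [Int.not_odd_iff_even]; exact ho.add_one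
      simp [ho, this]
    · have : Odd (p / (n : ℤ) + 1) := (Int.not_odd_iff_even.1 ho).add_one
      simp [ho, this]
  have hext2 : ∀ s p, ext s (p + (2 * n : ℤ)) = ext s p := fun s p => by
    rw [show p + (2 * n : ℤ) = p + n + n by ring, hext, hext, Bool.not_not]
  have hext2' : ∀ s p (c : ℤ), ext s (p + (2 * n : ℤ) * c) = ext s p := fun s p c =>
    (Function.Periodic.int_mul (f := ext s) (fun x => hext2 s x) c) p ▸ by rw [mul_comm]; simp
  let val' : ℕ → Bool := fun t => if t = 0 then false else val t
  have h0E : 0 ∉ E := fun h0 => by simpa using hE h0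
  let E' := insert 0 E
  have hE' : ∀ t ∈ E', t < n := fun t ht => by
    rcases Finset.mem_insert.1 ht with rfl | h1
    · exact hn
    · exact (Finset.mem_Ioo.1 (hE h1)).2
  -- The bad event at q: a negative sign at q followed by the whole pattern. It fixes |E| + 1
  -- independent signs, and there are 2n starting points, so the bad proportion is at most 2n /
  -- 2^(|E| + 1) < 1.
  let cyl : ℕ → Finset (ZMod n → Bool) := fun q =>
    Fintype.piFinset fun c => if (c - (q : ZMod n)).val ∈ E'
      then {xor (val' (c - (q : ZMod n)).val) (decide (Odd ((q + (c - (q : ZMod n)).val : ℤ) / n)))}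
      else Finset.univ
  have hcyl : ∀ q, (cyl q).card * 2 ^ (E.card + 1) = 2 ^ n := fun q => by
    have h1 : (cyl q).card = ∏ c : ZMod n, if c.val ∈ E' then 1 else 2 := by
      rw [Fintype.card_piFinset]
      refine Fintype.prod_equiv (Equiv.subRight (q : ZMod n)) _ _ fun c => ?_
      simp only [Equiv.subRight_apply]
      split_ifs <;> simp
    have h2 : (Finset.univ.filter fun c : ZMod n => c.val ∈ E').card = E.card + 1 := by
      rw [← Finset.card_insert_of_notMem h0E]
      refine Finset.card_bij (fun c _ => c.val) (fun c hc => (Finset.mem_filter.1 hc).2)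
        (fun c _ c' _ h => ZMod.val_injective n h) fun t ht => ?_
      refine ⟨(t : ZMod n), ?_, ZMod.val_natCast_of_lt (hE' t ht)⟩
      rw [Finset.mem_filter, ZMod.val_natCast_of_lt (hE' t ht)]
      exact ⟨Finset.mem_univ _, ht⟩
    have h3 := Finset.card_filter_add_card_filter_not (s := (Finset.univ : Finset (ZMod n)))
      (fun c => c.val ∈ E')
    rw [h2, Finset.card_univ, ZMod.card] at h3
    rw [h1, Finset.prod_ite, Finset.prod_const_one, one_mul, Finset.prod_const, ← pow_add]
    congr 1
    omega
  have hlt : ((Finset.range (2 * n)).biUnion cyl).card < (Finset.univ : Finset (ZMod n → Bool)).card := by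
    have h1 : ((Finset.range (2 * n)).biUnion cyl).card * 2 ^ (E.card + 1) ≤ 2 * n * 2 ^ n := by
      calc _ ≤ (∑ q ∈ Finset.range (2 * n), (cyl q).card) * 2 ^ (E.card + 1) :=
            Nat.mul_le_mul_right _ Finset.card_biUnion_le
        _ = _ := by
            rw [Finset.sum_mul, Finset.sum_congr rfl (fun q _ => hcyl q)]
            simp
    rw [Finset.card_univ, Fintype.card_fun, ZMod.card, Fintype.card_bool]
    by_contra hge
    rw [not_lt] at hge
    have h2 : 2 ^ n * 2 ^ (E.card + 1) ≤ 2 * n * 2 ^ n :=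
      (Nat.mul_le_mul_right _ hge).trans h1
    have h3 : 2 * n * 2 ^ n < 2 ^ n * 2 ^ (E.card + 1) := by
      rw [mul_comm (2 ^ n), pow_succ, mul_comm (2 ^ E.card)]
      exact Nat.mul_lt_mul_of_pos_right (by omega) (by positivity)
    omega
  obtain ⟨s, -, hs⟩ := Finset.exists_mem_notMem_of_card_lt_card hlt
  refine ⟨ext s, hext s, fun p hp => ?_⟩
  by_contra hcon
  push Not at hcon
  apply hs
  have hN0 : (0 : ℤ) < 2 * n := by omega
  obtain ⟨q, hq⟩ := Int.eq_ofNat_of_zero_le (Int.emod_nonneg p hN0.ne')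
  have hql : q < 2 * n := by
    have := Int.emod_lt_of_pos p hN0
    omega
  have hpq : ∀ t : ℕ, ext s (q + t) = ext s (p + t) := fun t => by
    rw [← hext2' s (q + t) (p / (2 * n))]
    congr 1
    have := Int.emod_add_mul_ediv p (2 * n)
    rw [hq] at this
    have h4 : ((Int.ofNat q : ℤ)) = (q : ℤ) := rfl
    linarith
  refine Finset.mem_biUnion.2 ⟨q, Finset.mem_range.2 hql, ?_⟩
  rw [Fintype.mem_piFinset]
  intro c
  split_ifs with hc
  · rw [Finset.mem_singleton]
    set t := (c - (q : ZMod n)).val with ht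
    have hct : (((q : ℤ) + (t : ℤ) : ℤ) : ZMod n) = c := by
      push_cast
      rw [ht, ZMod.natCast_zmod_val]
      abel
    have hval : ext s (q + t) = val' t := by
      rw [hpq]
      rcases Finset.mem_insert.1 hc with h0 | h1
      · simp only [h0, val', if_true, Nat.cast_zero, add_zero]
        exact hp
      · have : t ≠ 0 := fun h => h0E (h ▸ h1)
        simp only [val', if_neg this]
        exact hcon t h1
    rw [← hval]
    simp only [ext, hct]
    simp
  · exact Finset.mem_univ _

/-! ### Bounds on the filled positions for a linearly ordered alphabet -/

section Hits

variable {ι : Type*} {n : ℕ} {v : ι → ι → ℕ → Option ι}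

/-- The filled interior positions of the word with ends `i` and `j`. -/
def filled (n : ℕ) (v : ι → ι → ℕ → Option ι) (i j : ι) : Finset ℕ :=
  (Finset.Ioo 0 n).filter fun t => (v i j t).isSome

theorem mem_filled {i j : ι} {t : ℕ} :
    t ∈ filled n v i j ↔ (0 < t ∧ t < n) ∧ ∃ a, v i j t = some a := by
  simp [filled, Option.isSome_iff_exists]

theorem filled_subset (i j : ι) : filled n v i j ⊆ Finset.Ioo 0 n := Finset.filter_subset _ _

theorem card_filled_dual (i j : ι) :
    (filled (ι := ιᵒᵈ) n (fun i j t => v j i (n - t)) i j).card = (filled n v j i).card := by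
  refine Finset.card_bij (fun t _ => n - t) (fun t ht => ?_) (fun t ht t' ht' h => ?_)
    fun t ht => ?_
  · obtain ⟨⟨h1, h2⟩, a, ha⟩ := mem_filled.1 ht
    exact mem_filled.2 ⟨⟨by omega, by omega⟩, a, ha⟩
  · obtain ⟨⟨h1, h2⟩, -⟩ := mem_filled.1 ht
    obtain ⟨⟨h3, h4⟩, -⟩ := mem_filled.1 ht'
    omega
  · obtain ⟨⟨h1, h2⟩, a, ha⟩ := mem_filled.1 ht
    refine ⟨n - t, mem_filled.2 ⟨⟨by omega, by omega⟩, a, ?_⟩, by omega⟩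
    rw [show n - (n - t) = t by omega]
    exact ha

/-- The residues modulo `n` of the filled positions of the word with both ends `i`, and of the ends. -/
def filledResidues (n : ℕ) (v : ι → ι → ℕ → Option ι) (i : ι) : Finset (ZMod n) :=
  insert 0 ((filled n v i i).image fun t : ℕ => (t : ZMod n))

theorem natCast_zmod_injOn (hn : 0 < n) {t t' : ℕ} (ht : t < n) (ht' : t' < n)
    (h : (t : ZMod n) = t') : t = t' := by
  have : NeZero n := ⟨hn.ne'⟩
  have := congrArg ZMod.val h
  rwa [ZMod.val_natCast_of_lt ht, ZMod.val_natCast_of_lt ht'] at this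

theorem card_filledResidues (hn : 0 < n) (i : ι) :
    (filledResidues n v i).card = (filled n v i i).card + 1 := by
  rw [filledResidues, Finset.card_insert_of_notMem, Finset.card_image_of_injOn]
  · intro t ht t' ht' h
    exact natCast_zmod_injOn hn (mem_filled.1 ht).1.2 (mem_filled.1 ht').1.2 h
  · rw [Finset.mem_image]
    rintro ⟨t, ht, h⟩
    have h1 := (mem_filled.1 ht).1
    rw [← Nat.cast_zero] at h
    exact h1.1.ne' (natCast_zmod_injOn hn h1.2 hn h)

theorem mem_filledResidues {i : ι} {x : ZMod n} (h : x ∈ filledResidues n v i) (hx : x ≠ 0) :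
    ∃ t ∈ filled n v i i, x = t := by
  rcases Finset.mem_insert.1 h with h | h
  · exact absurd h hx
  · obtain ⟨t, ht, rfl⟩ := Finset.mem_image.1 h
    exact ⟨t, ht, rfl⟩

variable [LinearOrder ι]

/-- The word `w` meets, up to the letters at the ends, one of the partial words of length `n + 1`
with ends `i ≤ j` and interior `v i j`. -/
def Hits (n : ℕ) (v : ι → ι → ℕ → Option ι) (w : ℤ → ι) : Prop :=
  ∃ p : ℤ, w p ≤ w (p + n) ∧
    ∀ t : ℕ, 0 < t → t < n → ∀ a, v (w p) (w (p + n)) t = some a → w (p + t) = a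

theorem Hits.dual {w : ℤ → ι} (h : Hits n v w) :
    Hits (ι := ιᵒᵈ) n (fun i j t => v j i (n - t)) (fun x => w (-x)) := by
  obtain ⟨p, h1, h2⟩ := h
  refine ⟨-(p + n), ?_, fun t ht htn a ha => ?_⟩
  · change w _ ≤ w _
    rw [show -(-(p + (n : ℤ)) + n) = p by ring, neg_neg]
    exact h1
  · beta_reduce at ha ⊢
    rw [show -(-(p + (n : ℤ)) + n) = p by ring, neg_neg] at ha
    have := h2 (n - t) (by omega) (by omega) a ha
    rw [Nat.cast_sub htn.le] at this
    rw [show -(-(p + (n : ℤ)) + t) = p + (n - t) by ring]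
    exact this

theorem forall_hits_dual (hU : ∀ w, Hits n v w) :
    ∀ w, Hits (ι := ιᵒᵈ) n (fun i j t => v j i (n - t)) w := fun w => by
  have := (hU fun x => w (-x)).dual
  simpa only [neg_neg] using this

theorem eq_of_filled_self (hU : ∀ w, Hits n v w) {i a : ι} {t : ℕ} (ht : 0 < t) (htn : t < n)
    (h : v i i t = some a) : a = i := by
  obtain ⟨p, -, hp⟩ := hU fun _ => i
  exact (hp t ht htn a h).symm

theorem eq_or_eq_of_filled (hU : ∀ w, Hits n v w) {i j a : ι} (hij : i < j) {t : ℕ} (ht : 0 < t)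
    (htn : t < n) (h : v i j t = some a) : a = i ∨ a = j := by
  let w : ℤ → ι := fun p => if p % (2 * n : ℤ) < n then i else j
  have hN0 : (0 : ℤ) < 2 * n := by omega
  obtain ⟨p, hp, hp'⟩ := hU w
  have hw : w p = i ∧ w (p + n) = j := by
    have h1 := emod_add_cases p (2 * n) hN0 n (by omega) (by omega)
    have h2 := Int.emod_nonneg p hN0.ne'
    have h3 := Int.emod_lt_of_pos p hN0
    simp only [w] at hp ⊢
    rcases lt_or_ge (p % (2 * n : ℤ)) n with h | h
    · rw [if_pos h, if_neg (by omega)]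
      exact ⟨rfl, rfl⟩
    · rw [if_neg (by omega), if_pos (by omega)] at hp
      exact absurd hp (not_le.2 hij)
  rw [hw.1, hw.2] at hp'
  rw [← hp' t ht htn a h]
  simp only [w]
  split_ifs <;> simp

theorem two_pow_card_filled_le (hU : ∀ w, Hits n v w) (hn : 0 < n) {i j : ι} (hij : i < j) :
    2 ^ (filled n v i j).card ≤ n := by
  by_contra hlt
  rw [not_le] at hlt
  obtain ⟨s, hs1, hs2⟩ := exists_antiperiodic_avoiding (filled n v i j) (filled_subset i j)
    (fun t => decide (v i j t = some j)) hlt hn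
  obtain ⟨p, hp, hp'⟩ := hU fun x => if s x then j else i
  simp only [hs1] at hp hp'
  rcases hsp : s p with _ | _
  · simp only [hsp, Bool.false_eq_true, if_false, Bool.not_false, if_true] at hp'
    obtain ⟨t, ht, hne⟩ := hs2 p hsp
    obtain ⟨⟨h1, h2⟩, a, ha⟩ := mem_filled.1 ht
    have := hp' t h1 h2 a ha
    rcases eq_or_eq_of_filled hU hij h1 h2 ha with rfl | rfl
    · rcases hst : s (p + t) with _ | _
      · rw [ha, hst] at hne
        simp [hij.ne] at hne
      · rw [hst] at this
        simp only [if_true] at this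
        exact hij.ne' this
    · rcases hst : s (p + t) with _ | _
      · rw [hst] at this
        simp only [Bool.false_eq_true, if_false] at this
        exact hij.ne this
      · rw [ha, hst] at hne
        simp at hne
  · simp only [hsp, if_true, Bool.not_true, Bool.false_eq_true, if_false] at hp
    exact absurd hp (not_le.2 hij)

/-- A word of period n has equal letters at p and p + n, so only diagonal words can be hit. -/
theorem not_avoidsTranslates (hU : ∀ w, Hits n v w) (P : ZMod n → ι) :
    ¬ AvoidsTranslates (filledResidues n v) P := by
  intro hP
  obtain ⟨p, -, hp⟩ := hU fun x => P x
  obtain ⟨x, hx, hne⟩ := hP p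
  obtain ⟨t, ht, rfl⟩ := mem_filledResidues hx (fun h => hne (by rw [h, add_zero]))
  obtain ⟨⟨h1, h2⟩, a, ha⟩ := mem_filled.1 ht
  have h3 : (((p + n : ℤ)) : ZMod n) = p := by simp
  simp only [h3] at hp
  have h4 := hp t h1 h2 a ha
  rw [eq_of_filled_self hU h1 h2 ha] at h4
  apply hne
  rw [← h4]
  push_cast
  rfl

theorem sum_card_filled_self_lt (hU : ∀ w, Hits n v w) [Fintype ι] (hn : 0 < n) :
    ∑ i, (filled n v i i).card < n := by
  have : NeZero n := ⟨hn.ne'⟩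
  by_contra h
  obtain ⟨P, hP⟩ := exists_avoidsTranslates_of_card_le (filledResidues n v)
    (fun i => ⟨0, Finset.mem_insert_self _ _⟩) (by
      simp only [card_filledResidues hn, ZMod.card, add_tsub_cancel_right]
      omega)
  exact not_avoidsTranslates hU P hP

theorem sum_card_filled_self_add_le (hU : ∀ w, Hits n v w) [Fintype ι] {g : ℕ} (hg : 2 ≤ g)
    (hpow : 2 ^ g ≤ n) {i j : ι} (hij : i ≠ j) (hi : 0 < (filled n v i i).card)
    (hj : 0 < (filled n v j j).card) : ∑ i, (filled n v i i).card + g ≤ n := by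
  have hn : 0 < n := lt_of_lt_of_le (by positivity) hpow
  have : NeZero n := ⟨hn.ne'⟩
  by_contra h
  obtain ⟨P, hP⟩ := exists_avoidsTranslates (filledResidues n v)
    (fun i => Finset.mem_insert_self _ _) hg (by rwa [ZMod.card]) (by
      simp only [card_filledResidues hn, ZMod.card, add_tsub_cancel_right]
      omega) hij (by rw [card_filledResidues hn]; omega) (by rw [card_filledResidues hn]; omega)
  exact not_avoidsTranslates hU P hP

theorem card_filled_self_add_lt (hU : ∀ w, Hits n v w) {g : ℕ} (hg : 2 ≤ g)
    (hpow : 2 ^ g ≤ n) {i j l : ι} (hij : i < j) (hli : l ≠ i) (hlj : l ≠ j)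
    (hf : (filled n v i j).Nonempty) : (filled n v l l).card + g < n := by
  have hn : 0 < n := lt_of_lt_of_le (by positivity) hpow
  have : NeZero n := ⟨hn.ne'⟩
  have hn0 : (n : ℤ) ≠ 0 := by exact_mod_cast hn.ne'
  by_contra hcon
  obtain ⟨f, hf⟩ := hf
  obtain ⟨⟨hf0, hfn⟩, a, ha⟩ := mem_filled.1 hf
  have hfz : (f : ZMod n) ≠ 0 := fun h => hf0.ne' (natCast_zmod_injOn hn hfn hn (by simpa using h))
  obtain ⟨x, hx0, hxf, hxf', hx⟩ := exists_pair_meeting_translates (filledResidues n v l)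
    (f : ZMod n) hg (by rwa [ZMod.card]) (by
      have := Finset.card_add_card_compl (filledResidues n v l)
      rw [card_filledResidues hn, ZMod.card] at this
      omega)
  -- The word is l except on two residue classes, where i and j alternate with antiperiod n. The two
  -- classes meet every translate of the residues filled in the l-word, and their difference is not
  -- ±f, so the filled position f of the i-j word shows the letter l.
  let B : ZMod n → Prop := fun c => c = 0 ∨ c = x
  have hBf : ∀ c, B c → ¬ B (c + f) := by
    rintro c (rfl | rfl) (h | h)
    · exact hfz (by simpa using h)
    · exact hxf (by simpa using h.symm)
    · exact hxf' (eq_neg_of_add_eq_zero_left h)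
    · exact hfz (by simpa using h)
  let w : ℤ → ι := fun p =>
    if B p then (if Odd (p / (n : ℤ)) then j else i) else l
  have hwB : ∀ p : ℤ, B p → w p = i ∨ w p = j := fun p hp => by
    simp only [w, if_pos hp]
    split_ifs <;> simp
  have hwn : ∀ p : ℤ, ¬ B p → w p = l := fun p hp => by simp only [w, if_neg hp]
  obtain ⟨p, hp, hp'⟩ := hU w
  have h3 : (((p + n : ℤ)) : ZMod n) = p := by simp
  have h1 : (p + n) / (n : ℤ) = p / n + 1 := by
    rw [Int.add_ediv_of_dvd_right (dvd_refl _), Int.ediv_self hn0]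
  by_cases hB : B p
  · have hw : w p = i ∧ w (p + n) = j := by
      simp only [w, h3, if_pos hB, h1] at hp ⊢
      by_cases ho : Odd (p / (n : ℤ))
      · have h2 : ¬ Odd (p / (n : ℤ) + 1) := by rw [Int.not_odd_iff_even]; exact ho.add_one
        rw [if_pos ho, if_neg h2] at hp
        exact absurd hp (not_le.2 hij)
      · have h2 : Odd (p / (n : ℤ) + 1) := (Int.not_odd_iff_even.1 ho).add_one
        rw [if_neg ho, if_pos h2]
        exact ⟨rfl, rfl⟩
    rw [hw.1, hw.2] at hp'
    have h4 := hp' f hf0 hfn a ha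
    rw [hwn _ (by push_cast; exact hBf _ hB)] at h4
    rcases eq_or_eq_of_filled hU hij hf0 hfn ha with h | h
    · exact hli (h4.trans h)
    · exact hlj (h4.trans h)
  · rw [hwn p hB, hwn (p + n) (by rwa [h3])] at hp'
    obtain ⟨y, hy, hyB⟩ : ∃ y ∈ filledResidues n v l, B (p + y) := by
      rcases hx (p : ZMod n) with h | h
      · exact ⟨_, h, Or.inl (by simp)⟩
      · exact ⟨_, h, Or.inr (by simp)⟩
    obtain ⟨t, ht, rfl⟩ := mem_filledResidues hy (fun h => hB (by rwa [h, add_zero] at hyB))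
    obtain ⟨⟨h1, h2⟩, b, hb⟩ := mem_filled.1 ht
    have h4 := hp' t h1 h2 b hb
    rw [eq_of_filled_self hU h1 h2 hb] at h4
    rcases hwB (p + t) (by push_cast; exact hyB) with h | h
    · exact hli (h4.symm.trans h)
    · exact hlj (h4.symm.trans h)

/-- Two letters suffice. With h the number of holes left in the i-i word, exceeding the bound means
at least h + 2 (h + 3 if n is even) fillings in the i-j word, which is what `exists_avoidsFilled`
requires. -/
theorem card_filled_left_add_le (hU : ∀ w, Hits n v w) (hn : 0 < n) {i j : ι} (hij : i < j) :
    (filled n v i i).card + (filled n v i j).card ≤ if Odd n then n else n + 1 := by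
  classical
  by_contra hcon
  set Ea := (filled n v i j).filter fun t => v i j t = some i with hEa
  set Eb := (filled n v i j).filter fun t => ¬ v i j t = some i with hEb
  have hE : Ea.card + Eb.card = (filled n v i j).card := Finset.card_filter_add_card_filter_not _
  have hS := Finset.card_sdiff_add_card_eq_card (filled_subset (n := n) (v := v) i i)
  rw [Nat.card_Ioo] at hS
  obtain ⟨D, hD1, hD2, hD3⟩ := exists_avoidsFilled (n := n) (S := filled n v i i) (Ea := Ea)
    (Eb := Eb) le_rfl ((Finset.filter_subset _ _).trans (filled_subset i j))
    ((Finset.filter_subset _ _).trans (filled_subset i j)) (by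
      rw [hE]
      split_ifs at hcon ⊢ <;> omega) (by
      rw [hE]; exact two_pow_card_filled_le hU hn hij)
  obtain ⟨p, hp, hp'⟩ := hU fun x => if D x then j else i
  beta_reduce at hp hp'
  by_cases h1 : D p
  · rw [if_pos h1, if_neg (hD1 p h1)] at hp
    exact absurd hp (not_le.2 hij)
  by_cases h2 : D (p + n)
  · simp only [if_neg h1, if_pos h2] at hp'
    rcases hD3 p h1 h2 with ⟨t, ht, hD⟩ | ⟨t, ht, hD⟩
    · obtain ⟨ht, hv⟩ := Finset.mem_filter.1 ht
      obtain ⟨⟨h3, h4⟩, -⟩ := mem_filled.1 ht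
      have := hp' t h3 h4 i hv
      rw [if_pos hD] at this
      exact hij.ne' this
    · obtain ⟨ht, hv⟩ := Finset.mem_filter.1 ht
      obtain ⟨⟨h3, h4⟩, a, ha⟩ := mem_filled.1 ht
      have := hp' t h3 h4 a ha
      rw [if_neg hD] at this
      exact hv (this ▸ ha)
  · simp only [if_neg h1, if_neg h2] at hp'
    obtain ⟨t, ht, hD⟩ := hD2 p h1 h2
    obtain ⟨⟨h3, h4⟩, a, ha⟩ := mem_filled.1 ht
    have := hp' t h3 h4 a ha
    rw [if_pos hD, eq_of_filled_self hU h3 h4 ha] at this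
    exact hij.ne' this

theorem card_filled_right_add_le (hU : ∀ w, Hits n v w) (hn : 0 < n) {i j : ι} (hij : i < j) :
    (filled n v j j).card + (filled n v i j).card ≤ if Odd n then n else n + 1 := by
  have := card_filled_left_add_le (ι := ιᵒᵈ) (forall_hits_dual hU) hn (i := j) (j := i) hij
  rwa [card_filled_dual, card_filled_dual] at this

theorem filled_eq_empty_of_lt_of_lt (hU : ∀ w, Hits n v w) {a b c : ι} (hab : a < b) (hbc : b < c) :
    filled n v a c = ∅ := by
  by_contra hne
  obtain ⟨g, hg⟩ := Finset.nonempty_iff_ne_empty.2 hne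
  obtain ⟨⟨hg0, hgn⟩, l, hl⟩ := mem_filled.1 hg
  let e : Fin 3 → ι := ![a, b, c]
  have he : StrictMono e := by
    rw [Fin.strictMono_iff_lt_succ]
    intro i
    fin_cases i
    · exact hab
    · exact hbc
  obtain ⟨x, hx, hex⟩ : ∃ x : Fin 3, x ≠ 1 ∧ l = e x := by
    rcases eq_or_eq_of_filled hU (hab.trans hbc) hg0 hgn hl with rfl | rfl
    · exact ⟨0, by decide, rfl⟩
    · exact ⟨2, by decide, rfl⟩
  obtain ⟨w, h1, h2, h3, h4⟩ := exists_word_nonadjacent hg0 hgn x hx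
  obtain ⟨p, hp, hp'⟩ := hU fun q => e (w q)
  rw [he.le_iff_le] at hp
  have hcases : ∀ y z : Fin 3, y ≤ z → y ≠ z → ¬ (y = 0 ∧ z = 1) → ¬ (y = 1 ∧ z = 2) →
      y = 0 ∧ z = 2 := by decide
  obtain ⟨h5, h6⟩ := hcases _ _ hp (h1 p) (h2 p) (h3 p)
  have := hp' g hg0 hgn l (by simp only [h5, h6]; exact hl)
  rw [hex] at this
  exact h4 p ⟨h5, h6, he.injective this⟩

/-- Classes of the first kind alternate a and b, the others c and d. At the filled position the sign
is prescribed to give the wrong letter of the pair; if the position falls in the other kind of class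
and the wrong pair of letters appears, it is wrong anyway. -/
theorem not_filled_disjoint (hU : ∀ w, Hits n v w) {a b c d : ι} (hab : a < b) (hbc : b < c)
    (hcd : c < d) (h1 : (filled n v a b).Nonempty) : filled n v c d = ∅ := by
  by_contra hne
  obtain ⟨g, hg⟩ := Finset.nonempty_iff_ne_empty.2 hne
  obtain ⟨f, hf⟩ := h1
  obtain ⟨⟨hg0, hgn⟩, y, hy⟩ := mem_filled.1 hg
  obtain ⟨⟨hf0, hfn⟩, x, hx⟩ := mem_filled.1 hf
  obtain ⟨T, s, hT, hs, hsf, hsg⟩ :=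
    exists_types_and_signs hf0 hfn hg0 hgn (decide (x = a)) (decide (y = c))
  have hac := hab.trans hbc
  have hbd := hbc.trans hcd
  have had := hab.trans hbd
  obtain ⟨p, hp, hp'⟩ := hU fun q =>
    if T q then (if s q then a else b) else (if s q then c else d)
  have hx' := eq_or_eq_of_filled hU hab hf0 hfn hx
  have hy' := eq_or_eq_of_filled hU hcd hg0 hgn hy
  have hsf := hsf p
  have hsg := hsg p
  simp only [hT, hs] at hp hp'
  rcases hTp : T p with _ | _ <;> rcases hsp : s p with _ | _ <;>
    simp only [hTp, hsp, Bool.false_eq_true, if_false, if_true, Bool.not_false, Bool.not_true,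
      Bool.true_xor, forall_const, false_imp_iff] at hp hp' hsf hsg
  · exact absurd hp (not_le.2 hcd)
  · have h2 := hp' g hg0 hgn y hy
    rw [hsg] at h2
    rcases hy' with rfl | rfl
    · simp only [decide_true, Bool.not_true, Bool.false_eq_true, if_false] at h2
      split_ifs at h2
      · exact hbc.ne h2
      · exact hcd.ne' h2
    · simp only [hcd.ne', decide_false, Bool.not_false, if_true] at h2
      split_ifs at h2
      · exact had.ne h2
      · exact hcd.ne h2
  · exact absurd hp (not_le.2 hab)
  · have h2 := hp' f hf0 hfn x hx
    rcases hTf : T (p + f) with _ | _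
    · rw [hTf] at h2
      simp only [Bool.false_eq_true, if_false] at h2
      rcases hx' with rfl | rfl <;> split_ifs at h2
      · exact hac.ne' h2
      · exact had.ne' h2
      · exact hbc.ne' h2
      · exact hbd.ne' h2
    · rw [hTf, hsf hTf] at h2
      rcases hx' with rfl | rfl
      · simp only [decide_true, Bool.not_true, Bool.false_eq_true, if_false, if_true] at h2
        exact hab.ne' h2
      · simp only [hab.ne', decide_false, Bool.not_false, if_true] at h2
        exact hab.ne h2

/-- The letter b is put on the positive signs, and on the negative ones a or c by kind. At distance
f from an a of the first kind, a position of the first kind is made positive, and the other kind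
carries no a. The rule at distance g makes the letter filled in the b-c word wrong. -/
theorem not_filled_left_of_filled_right (hU : ∀ w, Hits n v w) {a b c : ι} (hab : a < b)
    (hbc : b < c) {f g : ℕ} (hg : g ∈ filled n v b c) (hf : 0 < f) (hfn : f < n) :
    v a b f ≠ some a := by
  intro hx
  obtain ⟨⟨hg0, hgn⟩, y, hy⟩ := mem_filled.1 hg
  obtain ⟨T, s, hT, hs, hsf, hsg⟩ :=
    exists_types_and_signs hf hfn hg0 hgn true (decide (y = b))
  have hac := hab.trans hbc
  obtain ⟨p, hp, hp'⟩ := hU fun q => if s q then b else if T q then a else c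
  have hy' := eq_or_eq_of_filled hU hbc hg0 hgn hy
  have hsf := hsf p
  have hsg := hsg p
  simp only [hT, hs] at hp hp'
  rcases hTp : T p with _ | _ <;> rcases hsp : s p with _ | _ <;>
    simp only [hTp, hsp, Bool.false_eq_true, if_false, if_true, Bool.not_false, Bool.not_true,
      Bool.true_xor, Bool.false_xor, forall_const, false_imp_iff] at hp hp' hsf hsg
  · exact absurd hp (not_le.2 hbc)
  · have h2 := hp' g hg0 hgn y hy
    rw [hsg] at h2
    rcases hy' with rfl | rfl
    · simp only [decide_true, Bool.not_true, Bool.false_eq_true, if_false] at h2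
      split_ifs at h2
      · exact hab.ne h2
      · exact hbc.ne' h2
    · simp only [hbc.ne', decide_false, Bool.not_false, if_true] at h2
      exact hbc.ne h2
  · have h2 := hp' f hf hfn a hx
    rcases hTf : T (p + f) with _ | _
    · rw [hTf] at h2
      simp only [Bool.false_eq_true, if_false] at h2
      split_ifs at h2
      · exact hab.ne' h2
      · exact hac.ne' h2
    · rw [hTf, hsf hTf] at h2
      simp only [if_true] at h2
      exact hab.ne' h2
  · exact absurd hp (not_le.2 hab)

/-- An a in the a-b word, and by duality a c in the b-c word, is excluded by the sign construction.
There remains the letter b in both. -/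
theorem not_filled_chain (hconj : AvoidabilityConjecture) (hU : ∀ w, Hits n v w) {a b c : ι}
    (hab : a < b) (hbc : b < c) (h1 : (filled n v a b).Nonempty) : filled n v b c = ∅ := by
  by_contra hne
  obtain ⟨g, hg⟩ := Finset.nonempty_iff_ne_empty.2 hne
  obtain ⟨f, hf⟩ := h1
  obtain ⟨⟨hg0, hgn⟩, y, hy⟩ := mem_filled.1 hg
  obtain ⟨⟨hf0, hfn⟩, x, hx⟩ := mem_filled.1 hf
  rcases eq_or_eq_of_filled hU hab hf0 hfn hx with rfl | rfl
  · exact not_filled_left_of_filled_right hU hab hbc hg hf0 hfn hx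
  rcases eq_or_eq_of_filled hU hbc hg0 hgn hy with rfl | rfl
  · let e : Fin 3 → ι := ![a, y, c]
    have he : StrictMono e := by
      rw [Fin.strictMono_iff_lt_succ]
      intro i
      fin_cases i
      · exact hab
      · exact hbc
    obtain ⟨w, h1, h2, h3, h4⟩ := chainAvoidable hconj hf0 hfn hg0 hgn
    obtain ⟨p, hp, hp'⟩ := hU fun q => e (w q)
    rw [he.le_iff_le] at hp
    have hcases : ∀ y z : Fin 3, y ≤ z → y ≠ z → ¬ (y = 0 ∧ z = 2) →
        (y = 0 ∧ z = 1) ∨ (y = 1 ∧ z = 2) := by decide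
    rcases hcases _ _ hp (h1 p) (h2 p) with ⟨h5, h6⟩ | ⟨h5, h6⟩
    · have := hp' f hf0 hfn y (by simp only [h5, h6]; exact hx)
      exact h3 p ⟨h5, h6, he.injective this⟩
    · have := hp' g hg0 hgn y (by simp only [h5, h6]; exact hy)
      exact h4 p ⟨h5, h6, he.injective this⟩
  · refine not_filled_left_of_filled_right (ι := ιᵒᵈ) (forall_hits_dual hU) (a := y) (b := x)
      (c := a) hbc hab (f := n - g) (g := n - f) ?_ (by omega) (by omega) ?_
    · refine mem_filled.2 ⟨⟨by omega, by omega⟩, x, ?_⟩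
      rw [show n - (n - f) = f by omega]
      exact hx
    · rw [show n - (n - g) = g by omega]
      exact hy

theorem filled_unique (hconj : AvoidabilityConjecture) (hU : ∀ w, Hits n v w) {a b c d : ι}
    (hab : a < b) (hcd : c < d) (h1 : (filled n v a b).Nonempty) (h2 : (filled n v c d).Nonempty) :
    a = c ∧ b = d := by
  have key : ∀ {a b c d : ι}, a < b → c < d → (filled n v a b).Nonempty →
      (filled n v c d).Nonempty → c ≤ a := by
    intro a b c d hab hcd h1 h2
    by_contra hac
    rw [not_le] at hac
    rcases lt_trichotomy b c with h | rfl | h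
    · exact h2.ne_empty (not_filled_disjoint hU hab h hcd h1)
    · exact h2.ne_empty (not_filled_chain hconj hU hab hcd h1)
    · exact h1.ne_empty (filled_eq_empty_of_lt_of_lt hU hac h)
  obtain rfl := le_antisymm (key hcd hab h2 h1) (key hab hcd h1 h2)
  refine ⟨rfl, ?_⟩
  rcases lt_trichotomy b d with h | h | h
  · exact absurd (filled_eq_empty_of_lt_of_lt hU hab h) h2.ne_empty
  · exact h
  · exact absurd (filled_eq_empty_of_lt_of_lt hU hcd h) h1.ne_empty

theorem sum_card_filled_le (hconj : AvoidabilityConjecture) (hU : ∀ w, Hits n v w) [Fintype ι]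
    (hn : 3 ≤ n) :
    ∑ q ∈ Finset.univ.filter (fun q : ι × ι => q.1 ≤ q.2), (filled n v q.1 q.2).card ≤
      if Odd n then n else n + 1 := by
  classical
  have hn0 : 0 < n := by omega
  have hle : n ≤ if Odd n then n else n + 1 := by split_ifs <;> omega
  have hsplit : ∑ q ∈ Finset.univ.filter (fun q : ι × ι => q.1 ≤ q.2), (filled n v q.1 q.2).card =
      ∑ i, (filled n v i i).card +
        ∑ q ∈ Finset.univ.filter (fun q : ι × ι => q.1 < q.2), (filled n v q.1 q.2).card := by
    have h1 : Finset.univ.filter (fun q : ι × ι => q.1 ≤ q.2) =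
        (Finset.univ.image fun i : ι => (i, i)) ∪ Finset.univ.filter (fun q : ι × ι => q.1 < q.2) := by
      ext ⟨i, j⟩
      simp [le_iff_eq_or_lt]
    rw [h1, Finset.sum_union, Finset.sum_image]
    · intro i _ j _ h
      exact (Prod.ext_iff.1 h).1
    · rw [Finset.disjoint_left]
      intro q hq hq'
      obtain ⟨i, -, rfl⟩ := Finset.mem_image.1 hq
      simp at hq'
  rw [hsplit]
  have hP0 := sum_card_filled_self_lt hU hn0
  by_cases hex : ∃ i j, i < j ∧ (filled n v i j).Nonempty
  swap
  · push Not at hex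
    have : ∑ q ∈ Finset.univ.filter (fun q : ι × ι => q.1 < q.2), (filled n v q.1 q.2).card = 0 :=
      Finset.sum_eq_zero fun q hq => by
        rw [hex q.1 q.2 (Finset.mem_filter.1 hq).2, Finset.card_empty]
    omega
  obtain ⟨i, j, hij, hne⟩ := hex
  have hsum : ∑ q ∈ Finset.univ.filter (fun q : ι × ι => q.1 < q.2), (filled n v q.1 q.2).card =
      (filled n v i j).card :=
    Finset.sum_eq_single_of_mem (i, j) (by simpa using hij) fun q hq hqne => by
      rw [Finset.card_eq_zero, ← Finset.not_nonempty_iff_eq_empty]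
      intro hq'
      obtain ⟨h1, h2⟩ := filled_unique hconj hU hij (Finset.mem_filter.1 hq).2 hne hq'
      exact hqne (Prod.ext h1.symm h2.symm)
  rw [hsum]
  have hpow := two_pow_card_filled_le hU hn0 hij
  have hlt := Nat.lt_two_pow_self (n := (filled n v i j).card)
  -- The group lemmas need some g ≥ 2 with 2^g ≤ n, which does not exist for n = 3.
  rcases Nat.lt_or_ge n 4 with h4 | h4
  · have : (filled n v i j).card < 2 := by
      by_contra hcon
      have := Nat.pow_le_pow_right (show 0 < 2 by norm_num) (not_lt.1 hcon)
      omega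
    omega
  obtain ⟨g, hg2, hγg, hgn⟩ : ∃ g, 2 ≤ g ∧ (filled n v i j).card ≤ g ∧ 2 ^ g ≤ n := by
    rcases Nat.lt_or_ge (filled n v i j).card 2 with h | h
    · exact ⟨2, le_rfl, h.le, h4⟩
    · exact ⟨_, h, le_rfl, hpow⟩
  by_cases hα : ∃ l, 0 < (filled n v l l).card
  swap
  · push Not at hα
    have : ∑ i, (filled n v i i).card = 0 := Finset.sum_eq_zero fun l _ => Nat.le_zero.1 (hα l)
    omega
  obtain ⟨l, hl⟩ := hα
  by_cases hα2 : ∃ l', l ≠ l' ∧ 0 < (filled n v l' l').card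
  · obtain ⟨l', hll', hl'⟩ := hα2
    have := sum_card_filled_self_add_le hU hg2 hgn hll' hl hl'
    omega
  push Not at hα2
  have hsum' : ∑ i, (filled n v i i).card = (filled n v l l).card :=
    Finset.sum_eq_single_of_mem l (Finset.mem_univ _) fun l' _ h => Nat.le_zero.1 (hα2 l' h.symm)
  rw [hsum']
  by_cases hli : l = i
  · subst hli
    exact card_filled_left_add_le hU hn0 hij
  by_cases hlj : l = j
  · subst hlj
    exact card_filled_right_add_le hU hn0 hij
  have := card_filled_self_add_lt hU hg2 hgn hij hli hlj hne
  omega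

end Hits

/-! ### Unavoidability of the optimal filling -/

theorem exists_meeting_position {n k : ℕ} (x : ℤ → ℕ) (hx : ∀ p, x p < k) :
    ∃ p : ℤ, (x p ≤ x (p + n) ∧ ¬ (x p = 0 ∧ x (p + n) ≤ 1)) ∨ (∀ t : ℕ, x (p + t) = 0) ∨
      (x p = 0 ∧ x (p + n) = 1 ∧ x (p + n - 1) = 0 ∧ (Even n → x (p + n - 2) = 0)) := by
  by_contra hcon
  push Not at hcon
  have h1 : ∀ p, x p ≤ x (p + n) → x p = 0 ∧ x (p + n) ≤ 1 := fun p => (hcon p).1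
  have h1' : ∀ p, x (p - n) ≤ x p → x (p - n) = 0 ∧ x p ≤ 1 := fun p => by
    simpa using h1 (p - n)
  have h2 : ∀ p, ∃ t : ℕ, x (p + t) ≠ 0 := fun p => (hcon p).2.1
  -- A letter of value at least 2 at p forces a larger one at p - n, so a bounded alphabet has none.
  have hbig : ∀ N : ℕ, ∀ p, ¬ (2 ≤ x p ∧ k ≤ x p + N) := by
    intro N
    induction N with
    | zero => intro p hp; have := hx p; omega
    | succ N ih =>
      intro p hp
      have h3 := h1' p
      have h4 := ih (p - n)
      omega
  have hle : ∀ p, x p ≤ 1 := fun p => by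
    have := hbig k p
    omega
  have hpast : ∀ p, x p = 1 → x (p - n) = 0 := fun p hp => by
    have h3 := h1' p
    have h4 := hle (p - n)
    omega
  -- A 1 just after a 0 is possible only for even n, and then after 1 0. For odd n every 1 therefore
  -- propagates to the left. For even n there is no 0 0, which would persist to the right, hence no
  -- 1 1, which would follow a 0 0 at distance n; the word alternates. Either way there is a 1 at
  -- distance n before a 1.
  have h3 : ∀ p, x p = 1 → x (p - 1) = 0 → Even n ∧ x (p - 2) = 1 := fun p hp hp1 => by
    have h4 := (hcon (p - n)).2.2 (hpast p hp) (by simpa using hp) (by simpa using hp1)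
    rw [sub_add_cancel] at h4
    have := hle (p - 2)
    exact ⟨h4.1, by omega⟩
  have hone : ∃ p, x p = 1 := by
    obtain ⟨t, ht⟩ := h2 0
    exact ⟨0 + t, by have := hle (0 + t); omega⟩
  rcases Nat.even_or_odd n with he | ho
  · have h00 : ∀ p, ¬ (x p = 0 ∧ x (p + 1) = 0) := fun p hp => by
      have hall : ∀ t : ℕ, x (p + t) = 0 ∧ x (p + t + 1) = 0 := fun t => by
        induction t with
        | zero => simpa using hp
        | succ t ih =>
          push_cast
          rw [← add_assoc]
          refine ⟨ih.2, ?_⟩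
          by_contra hne
          have h4 := hle (p + t + 1 + 1)
          have h5 := h3 (p + t + 1 + 1) (by omega) (by rw [add_sub_cancel_right]; exact ih.2)
          rw [show p + (t : ℤ) + 1 + 1 - 2 = p + t by ring] at h5
          omega
      obtain ⟨t, ht⟩ := h2 p
      exact ht (hall t).1
    have h11 : ∀ p, ¬ (x p = 1 ∧ x (p + 1) = 1) := fun p hp => by
      refine h00 (p - n) ⟨hpast p hp.1, ?_⟩
      rw [show p - (n : ℤ) + 1 = p + 1 - n by ring]
      exact hpast _ hp.2
    have hstep : ∀ p, x p = 1 → x (p - 2) = 1 := fun p hp => by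
      have h4 := h11 (p - 1)
      rw [sub_add_cancel] at h4
      have := hle (p - 1)
      exact (h3 p hp (by omega)).2
    obtain ⟨p, hp⟩ := hone
    have hall : ∀ t : ℕ, x (p - 2 * t) = 1 := fun t => by
      induction t with
      | zero => simpa using hp
      | succ t ih =>
        have := hstep _ ih
        rwa [show p - 2 * (t : ℤ) - 2 = p - 2 * (t + 1 : ℕ) by push_cast; ring] at this
    obtain ⟨r, hr⟩ := he
    have h4 := hall r
    have h5 := hpast p hp
    rw [show p - (n : ℤ) = p - 2 * r by rw [hr]; push_cast; ring] at h5
    omega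
  · have hstep : ∀ p, x p = 1 → x (p - 1) = 1 := fun p hp => by
      by_contra hne
      have := hle (p - 1)
      exact Nat.not_even_iff_odd.2 ho (h3 p hp (by omega)).1
    obtain ⟨p, hp⟩ := hone
    have hall : ∀ t : ℕ, x (p - t) = 1 := fun t => by
      induction t with
      | zero => simpa using hp
      | succ t ih =>
        have := hstep _ ih
        rwa [show p - (t : ℤ) - 1 = p - (t + 1 : ℕ) by push_cast; ring] at this
    have h4 := hall n
    have h5 := hpast p hp
    omega

section

variable {A : Type} {n : ℕ}

theorem ends_zero (a b : A) : ends (n + 1) a b 0 = some a := by simp [ends]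

theorem ends_last (hn : 0 < n) (a b : A) : ends (n + 1) a b (Fin.last n) = some b := by
  simp [ends, hn.ne']

theorem ends_injective (hn : 0 < n) {a b a' b' : A}
    (h : ends (n + 1) a b = ends (n + 1) a' b') : a = a' ∧ b = b' := by
  have h1 := congrFun h 0
  have h2 := congrFun h (Fin.last n)
  rw [ends_zero, ends_zero] at h1
  rw [ends_last hn, ends_last hn] at h2
  exact ⟨Option.some.inj h1, Option.some.inj h2⟩

theorem meets_of_ends_eq {w : ℤ → A} {p : ℤ} {a b : A} (u : PartialWord A (n + 1))
    (ha : w p = a) (hb : w (p + n) = b)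
    (hu : ∀ (q : Fin (n + 1)) c, 0 < (q : ℕ) → (q : ℕ) < n → u q = some c → w (p + (q : ℕ)) = c)
    (h0 : u 0 = some a) (hl : u (Fin.last n) = some b) : Meets w u := by
  refine meets_of_forall p fun q c hc => ?_
  rcases Nat.eq_zero_or_pos (q : ℕ) with h | h
  · rw [show q = 0 from Fin.ext h, h0] at hc
    rw [h]
    simpa [ha] using hc
  rcases Nat.lt_or_ge (q : ℕ) n with h' | h'
  · exact hu q c h h' hc
  · have hq : (q : ℕ) = n := by omega
    rw [show q = Fin.last n from Fin.ext hq, hl] at hc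
    rw [hq]
    simpa [hb] using hc

theorem card_holes_ends (hn : 0 < n) (a b : A) : holes (ends (n + 1) a b) = n - 1 := by
  have h1 : (Finset.univ.filter fun p : Fin (n + 1) => (ends (n + 1) a b p).isNone) =
      Finset.univ \ {0, Fin.last n} := by
    ext p
    have h2 : p = 0 ↔ (p : ℕ) = 0 := Fin.ext_iff
    have h3 : p = Fin.last n ↔ (p : ℕ) = n := Fin.ext_iff
    rw [Finset.mem_filter, Finset.mem_sdiff, Finset.mem_insert, Finset.mem_singleton, h2, h3, ends]
    simp only [Finset.mem_univ, true_and]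
    split_ifs <;> simp <;> omega
  have h4 : (0 : Fin (n + 1)) ≠ Fin.last n := fun h => by
    have := congrArg Fin.val h
    simp at this
    omega
  rw [holes, h1, Finset.card_sdiff_of_subset (Finset.subset_univ _), Finset.card_pair h4,
    Finset.card_univ, Fintype.card_fin]
  omega

theorem numFilled_add_holes {u v : PartialWord A (n + 1)} (h : Fills u v) :
    numFilled u v + holes v = holes u := by
  rw [numFilled, holes, holes, ← Finset.card_union_of_disjoint]
  · congr 1
    ext p
    have := h p
    simp only [Finset.mem_union, Finset.mem_filter, Finset.mem_univ, true_and]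
    rcases hu : u p with _ | a <;> rcases hv : v p with _ | b <;> simp_all
  · rw [Finset.disjoint_left]
    intro p hp hp'
    simp only [Finset.mem_filter, Finset.mem_univ, true_and] at hp hp'
    rcases hv : v p with _ | b <;> simp_all

end

/-- The filling of the words of the basic set: all holes of `0⋄…⋄0` with `0`, and the last hole
(the last two holes if `n` is even) of `0⋄…⋄1` with `0`. -/
def optimalFilling {k : ℕ} (n : ℕ) (z o : Fin k) (u : PartialWord (Fin k) (n + 1)) :
    PartialWord (Fin k) (n + 1) := by
  classical
  exact if u = ends (n + 1) z z then fun _ => some z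
    else if u = ends (n + 1) z o then fun p => if (p : ℕ) + 1 = n ∨ (Even n ∧ (p : ℕ) + 2 = n)
      then some z else u p
    else u

theorem fills_optimalFilling {k n : ℕ} (hn : 3 ≤ n) (z o : Fin k)
    (u : PartialWord (Fin k) (n + 1)) : Fills u (optimalFilling n z o u) := by
  intro p a hp
  rw [optimalFilling]
  split_ifs with h1 h2
  · rw [h1, ends] at hp
    split_ifs at hp <;> simpa using hp
  · beta_reduce
    split_ifs with h3
    · rw [h2, ends] at hp
      split_ifs at hp with h4 h5 <;> omega
    · exact hp
  · exact hp

theorem numFilled_optimalFilling_left {k n : ℕ} (hn : 0 < n) (z o : Fin k) :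
    numFilled (ends (n + 1) z z) (optimalFilling n z o (ends (n + 1) z z)) = n - 1 := by
  rw [← card_holes_ends hn z z, numFilled, holes]
  simp [optimalFilling]

theorem numFilled_optimalFilling_right {k n : ℕ} (hn : 3 ≤ n) {z o : Fin k} (hzo : z ≠ o) :
    numFilled (ends (n + 1) z o) (optimalFilling n z o (ends (n + 1) z o)) =
      if Odd n then 1 else 2 := by
  have h1 : ends (n + 1) z o ≠ ends (n + 1) z z := fun h =>
    hzo (ends_injective (by omega) h).2.symm
  have h2 : (Finset.univ.filter fun p : Fin (n + 1) => (ends (n + 1) z o p).isNone ∧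
      (optimalFilling n z o (ends (n + 1) z o) p).isSome) =
      Finset.univ.filter fun p : Fin (n + 1) => (p : ℕ) + 1 = n ∨ (Even n ∧ (p : ℕ) + 2 = n) := by
    ext p
    simp only [optimalFilling, if_neg h1, if_true, Finset.mem_filter, Finset.mem_univ, true_and]
    constructor
    · rintro ⟨h3, h4⟩
      by_contra h5
      rw [if_neg h5] at h4
      rw [Option.isNone_iff_eq_none] at h3
      simp [h3] at h4
    · intro h5
      rw [if_pos h5]
      refine ⟨?_, rfl⟩
      rw [ends, if_neg (by omega), if_neg (by omega)]
      rfl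
  rw [numFilled, h2]
  split_ifs with ho
  · have : ¬ Even n := Nat.not_even_iff_odd.2 ho
    rw [Finset.card_eq_one]
    refine ⟨⟨n - 1, by omega⟩, ?_⟩
    ext p
    simp only [this, false_and, or_false, Finset.mem_filter, Finset.mem_univ, true_and,
      Finset.mem_singleton, Fin.ext_iff]
    omega
  · have : Even n := Nat.not_odd_iff_even.1 ho
    rw [Finset.card_eq_two]
    refine ⟨⟨n - 1, by omega⟩, ⟨n - 2, by omega⟩, by simp only [ne_eq, Fin.ext_iff]; omega, ?_⟩
    ext p
    simp only [this, true_and, Finset.mem_filter, Finset.mem_univ,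
      Finset.mem_singleton, Finset.mem_insert, Fin.ext_iff]
    omega

theorem optimalFilling_of_ne {k n : ℕ} {z o : Fin k} {u : PartialWord (Fin k) (n + 1)}
    (h1 : u ≠ ends (n + 1) z z) (h2 : u ≠ ends (n + 1) z o) : optimalFilling n z o u = u := by
  rw [optimalFilling, if_neg h1, if_neg h2]

theorem mem_basicSet {k m : ℕ} {u : PartialWord (Fin k) m} :
    u ∈ basicSet k m ↔ ∃ i j, i ≤ j ∧ ends m i j = u := by
  simp [basicSet]

theorem mem_fillableCounts {k n : ℕ} (hk : 2 ≤ k) (hn : 3 ≤ n) :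
    (if Odd n then n else n + 1) ∈ fillableCounts (basicSet k (n + 1)) := by
  classical
  let z : Fin k := ⟨0, by omega⟩
  let o : Fin k := ⟨1, by omega⟩
  have hzo : z < o := by simp [z, o, Fin.lt_def]
  have hne : ends (n + 1) z z ≠ ends (n + 1) z o := fun h =>
    hzo.ne (ends_injective (by omega) h).2
  refine ⟨_, ⟨optimalFilling n z o, fun u _ => fills_optimalFilling hn z o u, rfl, ?_⟩, ?_⟩
  · have hsub : ({ends (n + 1) z z, ends (n + 1) z o} : Finset _) ⊆ basicSet k (n + 1) := by
      intro u hu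
      rw [Finset.mem_insert, Finset.mem_singleton] at hu
      rcases hu with rfl | rfl
      · exact mem_basicSet.2 ⟨z, z, le_rfl, rfl⟩
      · exact mem_basicSet.2 ⟨z, o, hzo.le, rfl⟩
    rw [← Finset.sum_subset hsub, Finset.sum_pair hne, numFilled_optimalFilling_left (by omega),
      numFilled_optimalFilling_right hn hzo.ne]
    · split_ifs <;> omega
    · intro u _ hu
      rw [Finset.mem_insert, Finset.mem_singleton, not_or] at hu
      rw [optimalFilling_of_ne hu.1 hu.2, numFilled, Finset.card_eq_zero,
        Finset.filter_eq_empty_iff]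
      rintro p - ⟨h1, h2⟩
      rw [Option.isNone_iff_eq_none] at h1
      simp [h1] at h2
  · intro w
    have mem : ∀ {i j}, i ≤ j → optimalFilling n z o (ends (n + 1) i j) ∈
        (((basicSet k (n + 1)).image (optimalFilling n z o) : Finset _) : Set _) := fun h =>
      Finset.mem_coe.2 (Finset.mem_image_of_mem _ (mem_basicSet.2 ⟨_, _, h, rfl⟩))
    obtain ⟨p, ⟨h1, h2⟩ | h | ⟨h1, h2, h3, h4⟩⟩ :=
      exists_meeting_position (n := n) (k := k) (fun q => (w q : ℕ)) fun q => (w q).2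
    · refine ⟨_, mem (i := w p) (j := w (p + n)) h1, ?_⟩
      rw [optimalFilling_of_ne]
      · exact meets_ends rfl rfl
      · intro h
        obtain ⟨h3, h4⟩ := ends_injective (by omega) h
        simp [h3, h4, z] at h2
      · intro h
        obtain ⟨h3, h4⟩ := ends_injective (by omega) h
        simp [h3, h4, z, o] at h2
    · refine ⟨_, mem (i := z) (j := z) le_rfl, meets_of_forall p fun q b hb => ?_⟩
      simp only [optimalFilling, if_true, Option.some.injEq] at hb
      rw [← hb]
      exact Fin.ext (h q)
    · refine ⟨_, mem (i := z) (j := o) hzo.le, meets_of_ends_eq _ (a := z) (b := o) (p := p)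
        (Fin.ext h1) (Fin.ext h2) ?_ ?_ ?_⟩
      · intro q c hq0 hqn hq
        simp only [optimalFilling, if_neg hne.symm, if_true] at hq
        split_ifs at hq with h5
        · rw [← Option.some.inj hq]
          apply Fin.ext
          rcases h5 with h5 | ⟨he, h5⟩
          · rw [show p + ((q : ℕ) : ℤ) = p + n - 1 by omega]
            exact h3
          · rw [show p + ((q : ℕ) : ℤ) = p + n - 2 by omega]
            exact h4 he
        · rw [ends, if_neg (by omega), if_neg (by omega)] at hq
          exact absurd hq (by simp)
      · exact fills_optimalFilling hn z o _ _ _ (ends_zero _ _)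
      · exact fills_optimalFilling hn z o _ _ _ (ends_last (by omega) _ _)

/-! ### From an arbitrary unavoidable set to a linear order -/

section

variable {A : Type} {n : ℕ}

/-- The letter at a position, if the position exists and is not a hole. -/
def letterAt (u : PartialWord A (n + 1)) (t : ℕ) : Option A :=
  if h : t < n + 1 then u ⟨t, h⟩ else none

theorem letterAt_val (u : PartialWord A (n + 1)) (p : Fin (n + 1)) : letterAt u p = u p := by
  rw [letterAt, dif_pos p.2]

theorem card_filter_letterAt_add_holes (u : PartialWord A (n + 1)) (hn : 0 < n)
    (h0 : (u 0).isSome) (hl : (u (Fin.last n)).isSome) :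
    ((Finset.Ioo 0 n).filter fun t => (letterAt u t).isSome).card + holes u = n - 1 := by
  have h1 : holes u = ((Finset.Ioo 0 n).filter fun t => ¬ (letterAt u t).isSome).card := by
    refine Finset.card_bij (fun p _ => (p : ℕ)) (fun p hp => ?_) (fun p _ q _ h => Fin.ext h)
      fun t ht => ?_
    · have hp := (Finset.mem_filter.1 hp).2
      rw [Finset.mem_filter, Finset.mem_Ioo, letterAt_val]
      rw [Option.isNone_iff_eq_none] at hp
      refine ⟨⟨?_, ?_⟩, by simp [hp]⟩
      · rw [Nat.pos_iff_ne_zero]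
        intro h
        rw [show p = 0 from Fin.ext h] at hp
        simp [hp] at h0
      · have : (p : ℕ) ≠ n := fun h => by
          rw [show p = Fin.last n from Fin.ext h] at hp
          simp [hp] at hl
        omega
    · obtain ⟨ht, hs⟩ := Finset.mem_filter.1 ht
      rw [Finset.mem_Ioo] at ht
      refine ⟨⟨t, by omega⟩, ?_, rfl⟩
      rw [letterAt, dif_pos (by omega : t < n + 1)] at hs
      rw [Finset.mem_filter]
      exact ⟨Finset.mem_univ _, by simpa using hs⟩
  rw [h1, Finset.card_filter_add_card_filter_not, Nat.card_Ioo]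
  omega

theorem exists_mem_of_meets_ends {X : Finset (PartialWord A (n + 1))}
    (hE : EndsDefined (X : Set (PartialWord A (n + 1))))
    (hX : Unavoidable (X : Set (PartialWord A (n + 1)))) (w : ℤ → A) :
    ∃ u ∈ X, ∃ p : ℤ, u 0 = some (w p) ∧ u (Fin.last n) = some (w (p + n)) ∧
      ∀ t a, letterAt u t = some a → w (p + t) = a := by
  obtain ⟨u, hu, p, hp⟩ := hX w
  have key : ∀ q b, u q = some b → w (p + (q : ℕ)) = b := fun q b hb => hp q _ b rfl hb
  refine ⟨u, hu, p, ?_, ?_, fun t a ht => ?_⟩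
  · obtain ⟨b, hb⟩ := Option.isSome_iff_exists.1 (hE u hu 0 (Or.inl rfl))
    have := key _ _ hb
    rw [hb, ← this]
    simp
  · obtain ⟨b, hb⟩ := Option.isSome_iff_exists.1 (hE u hu (Fin.last n) (Or.inr (by simp)))
    have := key _ _ hb
    rw [hb, ← this]
    simp
  · rw [letterAt] at ht
    split_ifs at ht with h
    exact key ⟨t, h⟩ a ht

/-- The ordered pairs of letters at the ends of the words of `X`. -/
def EndsOf (X : Finset (PartialWord A (n + 1))) (a b : A) : Prop :=
  ∃ u ∈ X, u 0 = some a ∧ u (Fin.last n) = some b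

variable {X : Finset (PartialWord A (n + 1))}

theorem endsOf_total (hn : 0 < n) (hE : EndsDefined (X : Set (PartialWord A (n + 1))))
    (hX : Unavoidable (X : Set (PartialWord A (n + 1)))) (a b : A) :
    EndsOf X a b ∨ EndsOf X b a := by
  have hN0 : (0 : ℤ) < 2 * n := by omega
  obtain ⟨u, hu, p, h0, hl, -⟩ :=
    exists_mem_of_meets_ends hE hX fun p => if p % (2 * n : ℤ) < n then a else b
  have h1 := emod_add_cases p (2 * n) hN0 n (by omega) (by omega)
  have h2 := Int.emod_nonneg p hN0.ne'
  have h3 := Int.emod_lt_of_pos p hN0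
  rcases lt_or_ge (p % (2 * n : ℤ)) n with h | h
  · rw [if_pos h] at h0
    rw [if_neg (by omega)] at hl
    exact Or.inl ⟨u, hu, h0, hl⟩
  · rw [if_neg (by omega)] at h0
    rw [if_pos (by omega)] at hl
    exact Or.inr ⟨u, hu, h0, hl⟩

theorem not_endsOf_cycle (hn : 0 < n) (hE : EndsDefined (X : Set (PartialWord A (n + 1))))
    (hX : Unavoidable (X : Set (PartialWord A (n + 1)))) (a b c : A) :
    EndsOf X a b ∨ EndsOf X b c ∨ EndsOf X c a := by
  have hN0 : (0 : ℤ) < 3 * n := by omega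
  obtain ⟨u, hu, p, h0, hl, -⟩ := exists_mem_of_meets_ends hE hX fun p =>
    if p % (3 * n : ℤ) < n then a else if p % (3 * n : ℤ) < 2 * n then b else c
  have h1 := emod_add_cases p (3 * n) hN0 n (by omega) (by omega)
  have h2 := Int.emod_nonneg p hN0.ne'
  have h3 := Int.emod_lt_of_pos p hN0
  rcases lt_or_ge (p % (3 * n : ℤ)) n with h | h
  · rw [if_pos h] at h0
    rw [if_neg (by omega), if_pos (by omega)] at hl
    exact Or.inl ⟨u, hu, h0, hl⟩
  rcases lt_or_ge (p % (3 * n : ℤ)) (2 * n) with h' | h'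
  · rw [if_neg (by omega), if_pos h'] at h0
    rw [if_neg (by omega), if_neg (by omega)] at hl
    exact Or.inr (Or.inl ⟨u, hu, h0, hl⟩)
  · rw [if_neg (by omega), if_neg (by omega)] at h0
    rw [if_pos (by omega)] at hl
    exact Or.inr (Or.inr ⟨u, hu, h0, hl⟩)

/-- Every unordered pair of letters occurs as ends, and there are C(k+1,2) of them, as many as X may
contain; a surjection between such sets is injective. -/
theorem eq_of_unordered_ends_eq [Fintype A] (hn : 0 < n)
    (hE : EndsDefined (X : Set (PartialWord A (n + 1))))
    (hX : Unavoidable (X : Set (PartialWord A (n + 1))))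
    (hcard : X.card ≤ (Fintype.card A + 1).choose 2) {u u' : PartialWord A (n + 1)} (hu : u ∈ X)
    (hu' : u' ∈ X) (h : s(u 0, u (Fin.last n)) = s(u' 0, u' (Fin.last n))) : u = u' := by
  classical
  have hsub : (Finset.univ : Finset (Sym2 A)).image (Sym2.map some) ⊆
      X.image fun u => s(u 0, u (Fin.last n)) := by
    intro x hx
    obtain ⟨y, -, rfl⟩ := Finset.mem_image.1 hx
    induction y using Sym2.ind with | _ a b =>
    rw [Sym2.map_mk, Finset.mem_image]
    rcases endsOf_total hn hE hX a b with ⟨u, hu, h1, h2⟩ | ⟨u, hu, h1, h2⟩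
    · exact ⟨u, hu, by rw [h1, h2]⟩
    · exact ⟨u, hu, by rw [h1, h2, Sym2.eq_swap]⟩
  have h1 := Finset.card_le_card hsub
  rw [Finset.card_image_of_injective _ (Sym2.map.injective (Option.some_injective A)),
    Finset.card_univ, Sym2.card] at h1
  have h2 : Set.InjOn (fun u : PartialWord A (n + 1) => s(u 0, u (Fin.last n))) X :=
    Finset.card_image_iff.1 (le_antisymm Finset.card_image_le (hcard.trans h1))
  exact h2 hu hu' h

theorem card_mul_le_sum_holes [Fintype A] (hconj : AvoidabilityConjecture) (hn : 3 ≤ n)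
    (hE : EndsDefined (X : Set (PartialWord A (n + 1))))
    (hX : Unavoidable (X : Set (PartialWord A (n + 1))))
    (hcard : X.card ≤ (Fintype.card A + 1).choose 2) :
    X.card * (n - 1) ≤ ∑ u ∈ X, holes u + if Odd n then n else n + 1 := by
  classical
  have hn0 : 0 < n := by omega
  have huniq : ∀ {u u' : PartialWord A (n + 1)}, u ∈ X → u' ∈ X → u 0 = u' 0 →
      u (Fin.last n) = u' (Fin.last n) → u = u' := fun hu hu' h0 hl =>
    eq_of_unordered_ends_eq hn0 hE hX hcard hu hu' (by rw [h0, hl])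
  have hanti : ∀ a b, EndsOf X a b → EndsOf X b a → a = b := by
    rintro a b ⟨u, hu, h0, hl⟩ ⟨u', hu', h0', hl'⟩
    have := eq_of_unordered_ends_eq hn0 hE hX hcard hu hu' (by
      rw [h0, hl, h0', hl', Sym2.eq_swap])
    rw [← this, h0] at h0'
    exact Option.some.inj h0'
  have htrans : ∀ a b c, EndsOf X a b → EndsOf X b c → EndsOf X a c := by
    intro a b c hab hbc
    rcases not_endsOf_cycle hn0 hE hX a c b with h | h | h
    · exact h
    · rwa [← hanti b c hbc h]
    · rwa [hanti a b hab h]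
  -- The end pairs themselves are the order: totality comes from words of period 2n, antisymmetry
  -- from the count, and transitivity from words of period 3n.
  let : LinearOrder A :=
    { le := EndsOf X
      le_refl := fun a => by simpa using endsOf_total hn0 hE hX a a
      le_trans := htrans
      le_antisymm := hanti
      le_total := endsOf_total hn0 hE hX
      toDecidableLE := Classical.decRel _ }
  have hU' : ∀ a b : A, ∃ u : PartialWord A (n + 1), a ≤ b →
      u ∈ X ∧ u 0 = some a ∧ u (Fin.last n) = some b := fun a b => by
    by_cases h : a ≤ b
    · obtain ⟨u, hu⟩ := h
      exact ⟨u, fun _ => hu⟩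
    · exact ⟨fun _ => none, fun h' => absurd h' h⟩
  choose U hU using hU'
  have hits : ∀ w, Hits n (fun a b t => letterAt (U a b) t) w := fun w => by
    obtain ⟨u, hu, p, h0, hl, hp⟩ := exists_mem_of_meets_ends hE hX w
    have hle : w p ≤ w (p + n) := ⟨u, hu, h0, hl⟩
    refine ⟨p, hle, fun t _ _ a ha => hp t a ?_⟩
    obtain ⟨h1, h2, h3⟩ := hU _ _ hle
    rwa [huniq hu h1 (h0.trans h2.symm) (hl.trans h3.symm)]
  have hmain := sum_card_filled_le hconj hits hn
  have hsum : ∑ q ∈ Finset.univ.filter (fun q : A × A => q.1 ≤ q.2),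
      (filled n (fun a b t => letterAt (U a b) t) q.1 q.2).card =
      ∑ u ∈ X, ((Finset.Ioo 0 n).filter fun t => (letterAt u t).isSome).card := by
    refine Finset.sum_nbij (fun q => U q.1 q.2) ?_ ?_ ?_ fun q _ => rfl
    · intro q hq
      exact (hU _ _ (Finset.mem_filter.1 hq).2).1
    · intro q hq q' hq' h
      obtain ⟨-, h1, h2⟩ := hU _ _ (Finset.mem_filter.1 hq).2
      obtain ⟨-, h3, h4⟩ := hU _ _ (Finset.mem_filter.1 hq').2
      simp only at h
      rw [h, h3] at h1
      rw [h, h4] at h2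
      exact Prod.ext (Option.some.inj h1).symm (Option.some.inj h2).symm
    · intro u hu
      obtain ⟨a, ha⟩ := Option.isSome_iff_exists.1 (hE u hu 0 (Or.inl rfl))
      obtain ⟨b, hb⟩ := Option.isSome_iff_exists.1 (hE u hu (Fin.last n) (Or.inr (by simp)))
      have hab : a ≤ b := ⟨u, hu, ha, hb⟩
      refine ⟨(a, b), by simpa using hab, ?_⟩
      obtain ⟨h1, h2, h3⟩ := hU _ _ hab
      exact huniq h1 hu (h2.trans ha.symm) (h3.trans hb.symm)
  rw [hsum] at hmain
  have hholes : X.card * (n - 1) =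
      ∑ u ∈ X, ((Finset.Ioo 0 n).filter fun t => (letterAt u t).isSome).card +
        ∑ u ∈ X, holes u := by
    rw [← Finset.sum_add_distrib, Finset.sum_congr rfl fun u hu =>
      card_filter_letterAt_add_holes u hn0 (hE u hu 0 (Or.inl rfl))
        (hE u hu (Fin.last n) (Or.inr (by simp)))]
    simp
  omega

end

/-! ### Counting holes and conclusion -/

theorem add_choose_two (k : ℕ) : k + k.choose 2 = (k + 1).choose 2 := by
  rw [Nat.choose_succ_succ, Nat.choose_one_right]

theorem card_basicSet {n : ℕ} (hn : 0 < n) (k : ℕ) :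
    (basicSet k (n + 1)).card = (k + 1).choose 2 := by
  rw [basicSet, Finset.card_image_of_injective _ fun q q' h => ?_]
  · have := Sym2.card (α := Fin k)
    rw [Fintype.card_congr Sym2.sortEquiv, Fintype.card_fin] at this
    rw [← this, Fintype.card_subtype]
  · obtain ⟨h1, h2⟩ := ends_injective hn h
    exact Prod.ext h1 h2

theorem fillsHoles_properties {k n N : ℕ} (hn : 0 < n) {X : Finset (PartialWord (Fin k) (n + 1))}
    (h : FillsHoles (basicSet k (n + 1)) X N) :
    EndsDefined (X : Set (PartialWord (Fin k) (n + 1))) ∧ X.card = (k + 1).choose 2 ∧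
      N + ∑ u ∈ X, holes u = (k + 1).choose 2 * (n - 1) := by
  obtain ⟨f, hf, rfl, rfl⟩ := h
  have hinj : Set.InjOn f (basicSet k (n + 1)) := by
    intro u hu u' hu' h
    have h1 := hf u hu
    have h2 := hf u' hu'
    obtain ⟨i, j, -, rfl⟩ := mem_basicSet.1 hu
    obtain ⟨i', j', -, rfl⟩ := mem_basicSet.1 hu'
    rw [h] at h1
    have h3 := (h1 _ _ (ends_zero i j)).symm.trans (h2 _ _ (ends_zero i' j'))
    have h4 := (h1 _ _ (ends_last hn i j)).symm.trans (h2 _ _ (ends_last hn i' j'))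
    rw [Option.some.inj h3, Option.some.inj h4]
  refine ⟨?_, by rw [Finset.card_image_of_injOn hinj, card_basicSet hn], ?_⟩
  · intro u hu p hp
    obtain ⟨u', hu', rfl⟩ := Finset.mem_image.1 (Finset.mem_coe.1 hu)
    have h1 := hf u' hu'
    obtain ⟨i, j, -, rfl⟩ := mem_basicSet.1 hu'
    rcases hp with hp | hp
    · rw [show p = 0 from Fin.ext hp, h1 _ _ (ends_zero i j)]
      rfl
    · rw [show p = Fin.last n from Fin.ext (by simpa using hp), h1 _ _ (ends_last hn i j)]
      rfl
  · rw [Finset.sum_image hinj, ← Finset.sum_add_distrib, ← card_basicSet hn,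
      Finset.sum_congr rfl fun u hu => numFilled_add_holes (hf u hu), ← smul_eq_mul]
    refine Finset.sum_eq_card_nsmul fun u hu => ?_
    obtain ⟨i, j, -, rfl⟩ := mem_basicSet.1 hu
    exact card_holes_ends hn i j

theorem theorem4p3 (hconj : AvoidabilityConjecture) (k m : ℕ) (hk : 2 ≤ k) (hm : 4 ≤ m) :
    IsGreatest (fillableCounts (basicSet k m)) (if Even m then m - 1 else m) ∧
    IsLeast (holeCounts k m (k + k.choose 2))
      ((k + k.choose 2) * (m - 2) - (if Even m then m - 1 else m)) := by
  obtain ⟨n, rfl⟩ : ∃ n, m = n + 1 := ⟨m - 1, by omega⟩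
  have hn : 3 ≤ n := by omega
  have hbound : (if Even (n + 1) then n + 1 - 1 else n + 1) = if Odd n then n else n + 1 := by
    simp only [Nat.even_add_one, Nat.not_even_iff_odd, Nat.add_sub_cancel]
  have hmem := mem_fillableCounts hk hn
  rw [hbound, add_choose_two, show n + 1 - 2 = n - 1 by omega]
  refine ⟨⟨hmem, ?_⟩, ?_, ?_⟩
  · rintro N ⟨X, hX, hU⟩
    obtain ⟨h1, h2, h3⟩ := fillsHoles_properties (by omega) hX
    have h4 := card_mul_le_sum_holes hconj hn h1 hU (by rw [h2, Fintype.card_fin])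
    rw [h2, ← h3] at h4
    omega
  · obtain ⟨X, hX, hU⟩ := hmem
    obtain ⟨h1, h2, h3⟩ := fillsHoles_properties (by omega) hX
    exact ⟨X, h1, h2, hU, by omega⟩
  · rintro h ⟨X, h1, h2, hU, rfl⟩
    have h4 := card_mul_le_sum_holes hconj hn h1 hU (by rw [h2, Fintype.card_fin])
    rw [h2] at h4
    omega
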